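/- **Conventions.** All monoidal categories are strict. A *CD-category* is a symmetric monoidal category in which every object carries a commutative comonoid (copy, delete) compatible with $\otimes$; a *hypergraph category* is a CD-category in which every object carries moreover a commutative monoid (compare, omni) compatible with $\otimes$ such that the two form a special Frobenius algebra. CD-functors (hypergraph functors) are strict symmetric monoidal functors preserving copy and delete (and compare and omni). A morphism $f\colon A\to X$ is *total* if $\mathrm{del}_X\circ f=\mathrm{del}_A$; $\mathcal C_{\mathrm{tot}}$ is the CD-category of total morphisms of $\mathcal C$. $\mathcal C$ *has total conditionals* if for each $f\colon A\to X\otimes Y$ there is a total $g\colon A\otimes X\to Y$ such that $f$ equals: copy $A$, apply $f$ to one copy and delete its output $Y$, copy the output $X$, and apply $g$ to the other copy of $A$ and one copy of $X$. A *normalisation cospan* $\mathcal C_{\mathrm{tot}}\xrightarrow{i}\mathcal D\xleftarrow{q}\mathcal C$ is a hypergraph functor $q$ whose restriction $i$ to $\mathcal C_{\mathrm{tot}}$ is faithful. An *ordered DAG* $\mathcal G$ is a finite directed graph with a totally ordered vertex set $V_{\mathcal G}$ such that every edge $v\to w$ satisfies $v<w$. It is *ordered chordal* if $u\to w$, $v\to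 w$ and $u<v$ imply $u\to v$. Morphisms are monotone maps that send each edge to an edge or contract it to a vertex. $\mathsf{CDSyn}_{\mathcal G}$ (resp. $\mathsf{Syn}_{\mathcal G}$) is the free CD-category (resp. free hypergraph category) with the vertices as generating objects and, for each vertex $v$, one generating morphism from the list of parents of $v$ to $v$; $\star_{\mathcal G}\colon\mathsf{CDSyn}_{\mathcal G}\to\mathsf{Syn}_{\mathcal G}$ is the CD-functor that is the identity on generators. $\mathsf V_{\mathcal G}$ is the free symmetric monoidal category on the vertices; a morphism $\alpha\colon\mathcal G'\to\mathcal G$ induces $\mathsf V_\alpha\colon\mathsf V_{\mathcal G}\to\mathsf V_{\mathcal G'}$ by $v\mapsto\alpha^{-1}(v)$. Let $\bullet$ be the one-vertex graph; its generator is a state of the object $\bullet$. The CD-functor $!_{\mathcal G}\colon\mathsf{CDSyn}_\bullet\to\mathsf{CDSyn}_{\mathcal G}$ sends $\bullet$ to the list $V_{\mathcal G}$ of all vertices in increasing order and the generator to the copy-composition of all generators of $\mathsf{CDSyn}_{\mathcal G}$, that is, recursively: take the copy-composition of the generators of all vertices but the largest, $v$; copy its outputs; apply the generator of $v$ to the copies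 of the parents of $v$ and delete the other copies. **Theorem (Functorial Variable Elimination).** (1) Let $\mathcal G$ be an ordered chordal graph, $\mathcal C$ a hypergraph category with total conditionals and $\mathcal C_{\mathrm{tot}}\xrightarrow{i}\mathcal D\xleftarrow{q}\mathcal C$ a normalisation cospan. Let $\omega\colon\mathsf{CDSyn}_\bullet\to\mathcal C_{\mathrm{tot}}$ be a CD-functor and $F\colon\mathsf{Syn}_{\mathcal G}\to\mathcal C$ a hypergraph functor such that $\omega(\bullet)=F(V_{\mathcal G})$ and $$i\circ\omega=q\circ F\circ\star_{\mathcal G}\circ{!_{\mathcal G}}.$$ Then there is a CD-functor $K\colon\mathsf{CDSyn}_{\mathcal G}\to\mathcal C_{\mathrm{tot}}$ with $\omega=K\circ{!_{\mathcal G}}$ and $K(v)=F(v)$ for every vertex $v$. (2) Let $\mathsf{Mat}$ be the hypergraph category of finite sets and matrices with entries in $\mathbb R^{\ge0}$ (made strict by taking finite sets of lists of one length as objects and concatenation as tensor product), $\mathsf{FinStoch}=\mathsf{Mat}_{\mathrm{tot}}$, and $q\colon\mathsf{Mat}\to\mathsf{FinProjStoch}$ the quotient identifying matrices that differ by a global positive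 factor; let $i$ be its restriction to $\mathsf{FinStoch}$. Consider triples $(\omega,\mathcal G,\tau)$ of a CD-functor $\omega\colon\mathsf{CDSyn}_\bullet\to\mathsf{FinStoch}$, an ordered DAG $\mathcal G$ and a symmetric monoidal functor $\tau\colon\mathsf V_{\mathcal G}\to\mathsf{FinStoch}$ such that $\mathsf V_\bullet\hookrightarrow\mathsf{CDSyn}_\bullet\xrightarrow{\omega}\mathsf{FinStoch}$ equals $\mathsf V_\bullet\to\mathsf V_{\mathcal G}\xrightarrow{\tau}\mathsf{FinStoch}$. A morphism $(\omega,\mathcal G,\tau)\to(\omega',\mathcal G',\tau')$ is a triple $(\alpha,\eta,\hat\eta)$ of a morphism $\alpha\colon\mathcal G'\to\mathcal G$ and (not necessarily natural) monoidal transformations $\eta\colon\tau\to\tau'\circ\mathsf V_\alpha$ and $\hat\eta\colon\omega\to\omega'$, where $\hat\eta_\bullet$ composed with the state given by $\omega$ is the state given by $\omega'$, and where $\eta$ and $\hat\eta$ coincide on $\mathsf V_\bullet$; composition is component-wise. The category $\mathbf{BN}$ of Bayesian networks consists of the triples for which there is a CD-functor $K\colon\mathsf{CDSyn}_{\mathcal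 G}\to\mathsf{FinStoch}$ that restricts to $\tau$ on $\mathsf V_{\mathcal G}$ and satisfies $K\circ{!_{\mathcal G}}=\omega$. The category $\mathbf{CN}$ of chordal networks consists of the triples with $\mathcal G$ ordered chordal for which there is a hypergraph functor $F\colon\mathsf{Syn}_{\mathcal G}\to\mathsf{Mat}$ such that $q\circ F$ restricts to $i\circ\tau$ on $\mathsf V_{\mathcal G}$ and $q\circ F\circ\star_{\mathcal G}\circ{!_{\mathcal G}}=i\circ\omega$. Both have all of the above morphisms. Then there is a functor $\mathrm{VE}\colon\mathbf{CN}\to\mathbf{BN}$ that is the identity on objects and morphisms. -/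

import Mathlib

open CategoryTheory MonoidalCategory ComonObj MonObj
open scoped NNReal

universe u v u₁ v₁ u₂ v₂ u₃ v₃ w

namespace PGM

/-! ### Strict monoidal categories, CD-categories, hypergraph categories and their functors -/

/-- A monoidal category is strict: associators and unitors are identities. -/
class StrictMonoidal (C : Type u) [Category.{v} C] [MonoidalCategory C] : Prop where
  tensor_assoc : ∀ X Y Z : C, (X ⊗ Y) ⊗ Z = X ⊗ (Y ⊗ Z)
  unit_tensor : ∀ X : C, 𝟙_ C ⊗ X = X
  tensor_unit : ∀ X : C, X ⊗ 𝟙_ C = X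
  associator_eq : ∀ X Y Z : C, (α_ X Y Z).hom = eqToHom (tensor_assoc X Y Z)
  leftUnitor_eq : ∀ X : C, (λ_ X).hom = eqToHom (unit_tensor X)
  rightUnitor_eq : ∀ X : C, (ρ_ X).hom = eqToHom (tensor_unit X)

/-- A hypergraph category: a CD-category (Mathlib's `CopyDiscardCategory`) in which every object
also carries a commutative monoid (compare `μ` and omni `η`), compatible with the monoidal
structure and forming a special Frobenius algebra with the comonoid. -/
class HypergraphCategory (C : Type u) [Category.{v} C] [MonoidalCategory C]
    extends CopyDiscardCategory C where
  [monObj : (X : C) → MonObj X]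
  [isCommMonObj : (X : C) → IsCommMonObj X]
  compare_tensor : ∀ X Y : C, μ[X ⊗ Y] = tensorμ X Y X Y ≫ (μ[X] ⊗ₘ μ[Y])
  omni_tensor : ∀ X Y : C, η[X ⊗ Y] = (λ_ (𝟙_ C)).inv ≫ (η[X] ⊗ₘ η[Y])
  compare_unit : μ[𝟙_ C] = (λ_ (𝟙_ C)).hom
  omni_unit : η[𝟙_ C] = 𝟙 (𝟙_ C)
  special : ∀ X : C, Δ[X] ≫ μ[X] = 𝟙 X
  frobenius_left : ∀ X : C, (Δ[X] ▷ X) ≫ (α_ X X X).hom ≫ (X ◁ μ[X]) = μ[X] ≫ Δ[X]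
  frobenius_right : ∀ X : C, (X ◁ Δ[X]) ≫ (α_ X X X).inv ≫ (μ[X] ▷ X) = μ[X] ≫ Δ[X]

attribute [reducible] HypergraphCategory.monObj
attribute [instance] HypergraphCategory.monObj HypergraphCategory.isCommMonObj

/-- Strict symmetric monoidal functors. -/
structure SymFunctor (C : Type u₁) [Category.{v₁} C] [MonoidalCategory C] [SymmetricCategory C]
    (D : Type u₂) [Category.{v₂} D] [MonoidalCategory D] [SymmetricCategory D]
    extends C ⥤ D where
  obj_unit : obj (𝟙_ C) = 𝟙_ D
  obj_tensor : ∀ X Y : C, obj (X ⊗ Y) = obj X ⊗ obj Y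
  map_tensor : ∀ {X X' Y Y' : C} (f : X ⟶ Y) (g : X' ⟶ Y'),
    map (f ⊗ₘ g) = eqToHom (obj_tensor X X') ≫ (map f ⊗ₘ map g) ≫ eqToHom (obj_tensor Y Y').symm
  map_braiding : ∀ X Y : C,
    map (β_ X Y).hom =
      eqToHom (obj_tensor X Y) ≫ (β_ (obj X) (obj Y)).hom ≫ eqToHom (obj_tensor Y X).symm

/-- CD-functors: strict symmetric monoidal functors preserving copy and delete. -/
structure CDFunctor (C : Type u₁) [Category.{v₁} C] [MonoidalCategory C] [CopyDiscardCategory C]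
    (D : Type u₂) [Category.{v₂} D] [MonoidalCategory D] [CopyDiscardCategory D]
    extends SymFunctor C D where
  map_copy : ∀ X : C, map Δ[X] = Δ[obj X] ≫ eqToHom (obj_tensor X X).symm
  map_del : ∀ X : C, map ε[X] = ε[obj X] ≫ eqToHom obj_unit.symm

/-- Hypergraph functors: CD-functors that also preserve compare and omni. -/
structure HypergraphFunctor
    (C : Type u₁) [Category.{v₁} C] [MonoidalCategory C] [HypergraphCategory C]
    (D : Type u₂) [Category.{v₂} D] [MonoidalCategory D] [HypergraphCategory D]
    extends CDFunctor C D where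
  map_compare : ∀ X : C, map μ[X] = eqToHom (obj_tensor X X) ≫ μ[obj X]
  map_omni : ∀ X : C, map η[X] = eqToHom obj_unit ≫ η[obj X]

/-- Composition of strict symmetric monoidal functors. -/
def SymFunctor.comp {C : Type u₁} [Category.{v₁} C] [MonoidalCategory C] [SymmetricCategory C]
    {D : Type u₂} [Category.{v₂} D] [MonoidalCategory D] [SymmetricCategory D]
    {E : Type u₃} [Category.{v₃} E] [MonoidalCategory E] [SymmetricCategory E]
    (F : SymFunctor C D) (G : SymFunctor D E) : SymFunctor C E where
  toFunctor := F.toFunctor ⋙ G.toFunctor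
  obj_unit := by simp [F.obj_unit, G.obj_unit]
  obj_tensor X Y := by simp [F.obj_tensor, G.obj_tensor]
  map_tensor f g := by
    simp [F.map_tensor, G.map_tensor, eqToHom_map]
  map_braiding X Y := by
    simp [F.map_braiding, G.map_braiding, eqToHom_map]

/-! ### Total morphisms, conditionals, normalisation cospans -/

section Total

variable (C : Type u) [Category.{v} C] [MonoidalCategory C] [CopyDiscardCategory C]

/-- A morphism `f` is total if deleting its output amounts to deleting its input. -/
def total : MorphismProperty C := fun X Y f => f ≫ ε[Y] = ε[X]

end Total

section

variable {C : Type u} [Category.{v} C] [MonoidalCategory C] [CopyDiscardCategory C]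

lemma total_iff {X Y : C} (f : X ⟶ Y) : total C f ↔ f ≫ ε[Y] = ε[X] := Iff.rfl

lemma total_tensorHom {X X' Y Y' : C} (f : X ⟶ Y) (g : X' ⟶ Y')
    (hf : total C f) (hg : total C g) : total C (f ⊗ₘ g) := by
  rw [total_iff] at *
  simp only [CopyDiscardCategory.discard_tensor, ← Category.assoc, tensorHom_comp_tensorHom, hf, hg]

lemma total_id (X : C) : total C (𝟙 X) := by simp [total_iff]

instance : (total C).IsMultiplicative where
  id_mem X := total_id X
  comp_mem f g hf hg := by
    rw [total_iff] at *
    rw [Category.assoc, hg, hf]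

lemma total_of_inv {X Y : C} (e : X ≅ Y) (h : total C e.hom) : total C e.inv := by
  rw [total_iff] at *
  rw [← h, Iso.inv_hom_id_assoc]

lemma total_associator (X Y Z : C) : total C (α_ X Y Z).hom := by
  rw [total_iff]
  simp only [CopyDiscardCategory.discard_tensor]
  monoidal

lemma total_leftUnitor (X : C) : total C (λ_ X).hom := by
  rw [total_iff]
  simp only [CopyDiscardCategory.discard_tensor, CopyDiscardCategory.discard_unit]
  monoidal

lemma total_rightUnitor (X : C) : total C (ρ_ X).hom := by
  rw [total_iff]
  simp only [CopyDiscardCategory.discard_tensor, CopyDiscardCategory.discard_unit]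
  monoidal

lemma total_braiding (X Y : C) : total C (β_ X Y).hom := by
  rw [total_iff]
  simp only [CopyDiscardCategory.discard_tensor]
  rw [← BraidedCategory.braiding_naturality_assoc]
  simp only [braiding_leftUnitor, ← unitors_equal]

instance : (total C).IsMonoidalStable where
  whiskerLeft X _ _ f hf := by
    rw [← id_tensorHom]; exact total_tensorHom _ _ (total_id X) hf
  whiskerRight f hf X := by
    rw [← tensorHom_id]; exact total_tensorHom _ _ hf (total_id X)
  associator_hom_mem X Y Z := total_associator X Y Z
  associator_inv_mem X Y Z := total_of_inv _ (total_associator X Y Z)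
  leftUnitor_hom_mem X := total_leftUnitor X
  leftUnitor_inv_mem X := total_of_inv _ (total_leftUnitor X)
  rightUnitor_hom_mem X := total_rightUnitor X
  rightUnitor_inv_mem X := total_of_inv _ (total_rightUnitor X)

instance : (total C).IsStableUnderBraiding where
  braiding_hom_mem X Y := total_braiding X Y
  braiding_inv_mem X Y := total_of_inv _ (total_braiding X Y)

instance (X : C) : (total C).IsStableUnderComonoid X where
  counit_mem := by simp [total_iff, CopyDiscardCategory.discard_unit]
  comul_mem := by
    rw [total_iff, CopyDiscardCategory.discard_tensor, MonoidalCategory.tensorHom_def]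
    simp

end

/-- The CD-category of total morphisms of `C` (a wide subcategory, with the CD-structure of `C`). -/
abbrev Tot (C : Type u) [Category.{v} C] [MonoidalCategory C] [CopyDiscardCategory C] : Type u :=
  WideSubcategory (total C)

/-- The inclusion of the total morphisms. -/
abbrev totInclusion (C : Type u) [Category.{v} C] [MonoidalCategory C] [CopyDiscardCategory C] :
    Tot C ⥤ C :=
  wideSubcategoryInclusion (total C)

/-- `g : A ⊗ X ⟶ Y` is a conditional of `f : A ⟶ X ⊗ Y`: copy the input, apply `f` and delete its
output `Y`, copy the output `X`, and produce `Y` by applying `g` to the copies of the input and of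
`X`; this gives back `f`. -/
def IsConditional {C : Type u} [Category.{v} C] [MonoidalCategory C] [CopyDiscardCategory C]
    {A X Y : C} (f : A ⟶ X ⊗ Y) (g : A ⊗ X ⟶ Y) : Prop :=
  f = Δ[A] ≫ (A ◁ (f ≫ (X ◁ ε[Y]) ≫ (ρ_ X).hom ≫ Δ[X])) ≫ (α_ A X X).inv ≫
    (β_ (A ⊗ X) X).hom ≫ (X ◁ g)

/-- Every morphism `A ⟶ X ⊗ Y` has a total conditional. -/
def HasTotalConditionals (C : Type u) [Category.{v} C] [MonoidalCategory C]
    [CopyDiscardCategory C] : Prop :=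
  ∀ (A X Y : C) (f : A ⟶ X ⊗ Y), ∃ g : A ⊗ X ⟶ Y, total C g ∧ IsConditional f g

/-- The leg `Tot C ⥤ C ⥤ D` of a normalisation cospan. -/
abbrev totLeg {C : Type u₁} [Category.{v₁} C] [MonoidalCategory C] [HypergraphCategory C]
    {D : Type u₂} [Category.{v₂} D] [MonoidalCategory D] [HypergraphCategory D]
    (q : HypergraphFunctor C D) : Tot C ⥤ D :=
  totInclusion C ⋙ q.toFunctor

/-- A hypergraph functor `q : C ⥤ D` is a normalisation cospan if its restriction to the total
morphisms of `C` is faithful. -/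
def IsNormalisationCospan {C : Type u₁} [Category.{v₁} C] [MonoidalCategory C]
    [HypergraphCategory C] {D : Type u₂} [Category.{v₂} D] [MonoidalCategory D]
    [HypergraphCategory D] (q : HypergraphFunctor C D) : Prop :=
  (totLeg q).Faithful

end PGM

/-! ### Free symmetric monoidal, CD- and hypergraph categories on a monoidal signature -/

namespace PGM

/-- The three kinds of structure that we freely generate. -/
inductive Theory
  | sym
  | cd
  | hyp

/-- The theory has copy and delete. -/
class Theory.HasCopy (T : Theory) : Prop where
  ne_sym : T ≠ Theory.sym

/-- The theory has compare and omni (besides copy and delete). -/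
class Theory.HasCompare (T : Theory) : Prop extends T.HasCopy where
  eq_hyp : T = Theory.hyp

instance : Theory.cd.HasCopy := ⟨by simp⟩
instance : Theory.hyp.HasCompare where
  ne_sym := by simp
  eq_hyp := rfl

/-- A monoidal signature with generating objects `A`: a type of generating morphisms, each with
a list of inputs and a list of outputs. -/
structure Signature (A : Type u) where
  Gen : Type u
  dom : Gen → List A
  cod : Gen → List A

variable {A B : Type u}

/-- Formal string diagrams on the signature `S`. -/
inductive Tm (T : Theory) (S : Signature A) : List A → List A → Type u
  | id (X : List A) : Tm T S X X
  | comp {X Y Z : List A} (f : Tm T S X Y) (g : Tm T S Y Z) : Tm T S X Z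
  | tensor {X Y X' Y' : List A} (f : Tm T S X Y) (g : Tm T S X' Y') : Tm T S (X ++ X') (Y ++ Y')
  | braid (X Y : List A) : Tm T S (X ++ Y) (Y ++ X)
  | gen (σ : S.Gen) : Tm T S (S.dom σ) (S.cod σ)
  | copy [T.HasCopy] (X : List A) : Tm T S X (X ++ X)
  | del [T.HasCopy] (X : List A) : Tm T S X []
  | compare [T.HasCompare] (X : List A) : Tm T S (X ++ X) X
  | omni [T.HasCompare] (X : List A) : Tm T S [] X

namespace Tm

variable {T : Theory} {S : Signature A}

/-- The identity between two equal lists. -/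
def eqTo {X Y : List A} (h : X = Y) : Tm T S X Y := h ▸ Tm.id X

/-- The associator (an identity). -/
def assoc (X Y Z : List A) : Tm T S ((X ++ Y) ++ Z) (X ++ (Y ++ Z)) :=
  eqTo (List.append_assoc X Y Z)

/-- The inverse associator (an identity). -/
def assocInv (X Y Z : List A) : Tm T S (X ++ (Y ++ Z)) ((X ++ Y) ++ Z) :=
  eqTo (List.append_assoc X Y Z).symm

/-- The exchange of the two middle factors. -/
def middle (X X' Y Y' : List A) : Tm T S ((X ++ X') ++ (Y ++ Y')) ((X ++ Y) ++ (X' ++ Y')) :=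
  (assoc X X' (Y ++ Y')).comp <|
    ((id X).tensor (assocInv X' Y Y')).comp <|
      ((id X).tensor ((braid X' Y).tensor (id Y'))).comp <|
        ((id X).tensor (assoc Y X' Y')).comp (assocInv X Y (X' ++ Y'))

/-- The laws: the axioms of strict symmetric monoidal categories, those of copy and delete (if
present), those of compare and omni (if present), and closure under composition and tensor. The
structure maps of a list are determined by those of its entries through the laws `copy_tensor`,
`copy_unit` etc. -/
inductive Rel : ∀ {X Y : List A}, Tm T S X Y → Tm T S X Y → Prop
  | comp_left {X Y Z : List A} {f f' : Tm T S X Y} (g : Tm T S Y Z) :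
      Rel f f' → Rel (f.comp g) (f'.comp g)
  | comp_right {X Y Z : List A} (f : Tm T S X Y) {g g' : Tm T S Y Z} :
      Rel g g' → Rel (f.comp g) (f.comp g')
  | tensor_left {X Y X' Y' : List A} {f f' : Tm T S X Y} (g : Tm T S X' Y') :
      Rel f f' → Rel (f.tensor g) (f'.tensor g)
  | tensor_right {X Y X' Y' : List A} (f : Tm T S X Y) {g g' : Tm T S X' Y'} :
      Rel g g' → Rel (f.tensor g) (f.tensor g')
  | id_comp {X Y : List A} (f : Tm T S X Y) : Rel ((id X).comp f) f
  | comp_id {X Y : List A} (f : Tm T S X Y) : Rel (f.comp (id Y)) f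
  | comp_assoc {X Y Z W : List A} (f : Tm T S X Y) (g : Tm T S Y Z) (h : Tm T S Z W) :
      Rel ((f.comp g).comp h) (f.comp (g.comp h))
  | tensor_id (X Y : List A) : Rel ((id X).tensor (id Y)) (id (X ++ Y))
  | tensor_comp {X Y Z X' Y' Z' : List A} (f : Tm T S X Y) (f' : Tm T S X' Y')
      (g : Tm T S Y Z) (g' : Tm T S Y' Z') :
      Rel ((f.tensor f').comp (g.tensor g')) ((f.comp g).tensor (f'.comp g'))
  | assoc_naturality {X Y X' Y' X'' Y'' : List A} (f : Tm T S X Y) (f' : Tm T S X' Y')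
      (f'' : Tm T S X'' Y'') :
      Rel (((f.tensor f').tensor f'').comp (assoc Y Y' Y''))
        ((assoc X X' X'').comp (f.tensor (f'.tensor f'')))
  | unit_tensor {X Y : List A} (f : Tm T S X Y) :
      Rel (((id []).tensor f).comp (eqTo (List.nil_append Y)))
        ((eqTo (List.nil_append X)).comp f)
  | tensor_unit {X Y : List A} (f : Tm T S X Y) :
      Rel ((f.tensor (id [])).comp (eqTo (List.append_nil Y)))
        ((eqTo (List.append_nil X)).comp f)
  | braid_naturality {X Y X' Y' : List A} (f : Tm T S X Y) (g : Tm T S X' Y') :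
      Rel ((f.tensor g).comp (braid Y Y')) ((braid X X').comp (g.tensor f))
  | hexagon_forward (X Y Z : List A) :
      Rel ((assoc X Y Z).comp ((braid X (Y ++ Z)).comp (assoc Y Z X)))
        (((braid X Y).tensor (id Z)).comp ((assoc Y X Z).comp ((id Y).tensor (braid X Z))))
  | hexagon_reverse (X Y Z : List A) :
      Rel ((assocInv X Y Z).comp ((braid (X ++ Y) Z).comp (assocInv Z X Y)))
        (((id X).tensor (braid Y Z)).comp ((assocInv X Z Y).comp ((braid X Z).tensor (id Y))))
  | symmetry (X Y : List A) : Rel ((braid X Y).comp (braid Y X)) (id (X ++ Y))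
  | copy_del_left [T.HasCopy] (X : List A) :
      Rel ((copy X).comp ((del X).tensor (id X))) (eqTo (List.nil_append X).symm)
  | copy_del_right [T.HasCopy] (X : List A) :
      Rel ((copy X).comp ((id X).tensor (del X))) (eqTo (List.append_nil X).symm)
  | copy_assoc [T.HasCopy] (X : List A) :
      Rel ((copy X).comp ((id X).tensor (copy X)))
        ((copy X).comp (((copy X).tensor (id X)).comp (assoc X X X)))
  | copy_comm [T.HasCopy] (X : List A) : Rel ((copy X).comp (braid X X)) (copy X)
  | copy_tensor [T.HasCopy] (X Y : List A) :
      Rel (copy (X ++ Y)) (((copy X).tensor (copy Y)).comp (middle X X Y Y))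
  | del_tensor [T.HasCopy] (X Y : List A) :
      Rel (del (X ++ Y)) (((del X).tensor (del Y)).comp (eqTo (List.nil_append [])))
  | copy_unit [T.HasCopy] : Rel (copy []) (eqTo (List.nil_append []).symm)
  | del_unit [T.HasCopy] : Rel (del []) (id [])
  | compare_omni_left [T.HasCompare] (X : List A) :
      Rel (((omni X).tensor (id X)).comp (compare X)) (eqTo (List.nil_append X))
  | compare_omni_right [T.HasCompare] (X : List A) :
      Rel (((id X).tensor (omni X)).comp (compare X)) (eqTo (List.append_nil X))
  | compare_assoc [T.HasCompare] (X : List A) :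
      Rel (((compare X).tensor (id X)).comp (compare X))
        ((assoc X X X).comp (((id X).tensor (compare X)).comp (compare X)))
  | compare_comm [T.HasCompare] (X : List A) : Rel ((braid X X).comp (compare X)) (compare X)
  | compare_tensor [T.HasCompare] (X Y : List A) :
      Rel (compare (X ++ Y)) ((middle X Y X Y).comp ((compare X).tensor (compare Y)))
  | omni_tensor [T.HasCompare] (X Y : List A) :
      Rel (omni (X ++ Y)) ((eqTo (List.nil_append []).symm).comp ((omni X).tensor (omni Y)))
  | compare_unit [T.HasCompare] : Rel (compare []) (eqTo (List.nil_append []))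
  | omni_unit [T.HasCompare] : Rel (omni []) (id [])
  | special [T.HasCompare] (X : List A) : Rel ((copy X).comp (compare X)) (id X)
  | frobenius_left [T.HasCompare] (X : List A) :
      Rel (((copy X).tensor (id X)).comp ((assoc X X X).comp ((id X).tensor (compare X))))
        ((compare X).comp (copy X))
  | frobenius_right [T.HasCompare] (X : List A) :
      Rel (((id X).tensor (copy X)).comp ((assocInv X X X).comp ((compare X).tensor (id X))))
        ((compare X).comp (copy X))

end Tm

/-- The free strict symmetric monoidal, CD- or hypergraph category (according to `T`) on the
signature `S`. Its objects are lists of generating objects. -/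
def Free (_T : Theory) (_S : Signature A) : Type u := List A

namespace Free

variable {T : Theory} {S : Signature A}

instance : Category.{u} (Free T S) where
  Hom X Y := Quot (Tm.Rel (T := T) (S := S) (X := X) (Y := Y))
  id X := Quot.mk _ (Tm.id X)
  comp f g := Quot.map₂ Tm.comp (fun f _ _ h => .comp_right f h) (fun _ _ g h => .comp_left g h) f g
  id_comp := by rintro X Y ⟨f⟩; exact Quot.sound (.id_comp f)
  comp_id := by rintro X Y ⟨f⟩; exact Quot.sound (.comp_id f)
  assoc := by rintro X Y Z W ⟨f⟩ ⟨g⟩ ⟨h⟩; exact Quot.sound (.comp_assoc f g h)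

/-- The morphism represented by a formal diagram. -/
def mk {X Y : List A} (f : Tm T S X Y) : (show Free T S from X) ⟶ (show Free T S from Y) :=
  Quot.mk _ f

lemma eqToHom_eq {X Y : Free T S} (h : X = Y) : eqToHom h = mk (Tm.eqTo h) := by
  cases h; rfl

/-- The isomorphism between equal lists. -/
def eqIso {X Y : Free T S} (h : X = Y) : X ≅ Y where
  hom := mk (Tm.eqTo h)
  inv := mk (Tm.eqTo h.symm)
  hom_inv_id := by cases h; exact Quot.sound (.id_comp _)
  inv_hom_id := by cases h; exact Quot.sound (.id_comp _)

lemma eqIso_hom {X Y : Free T S} (h : X = Y) : (eqIso h).hom = eqToHom h := (eqToHom_eq h).symm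

/-- The tensor product of morphisms. -/
def tensorMap {X Y X' Y' : Free T S} (f : X ⟶ Y) (g : X' ⟶ Y') :
    (show Free T S from List.append X X') ⟶ (show Free T S from List.append Y Y') :=
  Quot.map₂ Tm.tensor (fun f _ _ h => .tensor_right f h) (fun _ _ g h => .tensor_left g h) f g

instance : MonoidalCategoryStruct (Free T S) where
  tensorObj X Y := List.append X Y
  whiskerLeft X _ _ f := tensorMap (𝟙 X) f
  whiskerRight f X := tensorMap f (𝟙 X)
  tensorHom f g := tensorMap f g
  tensorUnit := ([] : List A)
  associator X Y Z := eqIso (List.append_assoc X Y Z)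
  leftUnitor X := eqIso (List.nil_append X)
  rightUnitor X := eqIso (List.append_nil X)

lemma tensor_id' (X Y : Free T S) : (𝟙 X) ⊗ₘ (𝟙 Y) = 𝟙 (X ⊗ Y) := Quot.sound (.tensor_id X Y)

lemma eqToHom_tensor {X Y : Free T S} (h : X = Y) (Z : Free T S) :
    eqToHom h ⊗ₘ 𝟙 Z = eqToHom (congrArg (· ⊗ Z) h) := by
  cases h; exact tensor_id' _ _

lemma tensor_eqToHom {X Y : Free T S} (h : X = Y) (Z : Free T S) :
    𝟙 Z ⊗ₘ eqToHom h = eqToHom (congrArg (Z ⊗ ·) h) := by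
  cases h; exact tensor_id' _ _

lemma tensor_assoc' (X Y Z : Free T S) : (X ⊗ Y) ⊗ Z = X ⊗ (Y ⊗ Z) := List.append_assoc X Y Z

lemma unit_tensor' (X : Free T S) : 𝟙_ (Free T S) ⊗ X = X := List.nil_append X

lemma tensor_unit' (X : Free T S) : X ⊗ 𝟙_ (Free T S) = X := List.append_nil X

lemma associator_eq' (X Y Z : Free T S) : (α_ X Y Z).hom = eqToHom (tensor_assoc' X Y Z) :=
  eqIso_hom _

lemma leftUnitor_eq' (X : Free T S) : (λ_ X).hom = eqToHom (unit_tensor' X) := eqIso_hom _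

lemma rightUnitor_eq' (X : Free T S) : (ρ_ X).hom = eqToHom (tensor_unit' X) := eqIso_hom _

instance : MonoidalCategory (Free T S) :=
  MonoidalCategory.ofTensorHom
    (id_tensorHom_id := tensor_id')
    (id_tensorHom := fun _ _ _ _ => rfl)
    (tensorHom_id := fun _ _ => rfl)
    (tensorHom_comp_tensorHom := by
      rintro _ _ _ _ _ _ ⟨f⟩ ⟨f'⟩ ⟨g⟩ ⟨g'⟩; exact Quot.sound (.tensor_comp f f' g g'))
    (associator_naturality := by
      rintro _ _ _ _ _ _ ⟨f⟩ ⟨g⟩ ⟨h⟩; exact Quot.sound (.assoc_naturality f g h))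
    (leftUnitor_naturality := by
      rintro _ _ ⟨f⟩; exact Quot.sound (.unit_tensor f))
    (rightUnitor_naturality := by
      rintro _ _ ⟨f⟩; exact Quot.sound (.tensor_unit f))
    (pentagon := fun W X Y Z => by
      simp only [associator_eq', eqToHom_tensor, tensor_eqToHom, eqToHom_trans])
    (triangle := fun X Y => by
      simp only [associator_eq', leftUnitor_eq', rightUnitor_eq', eqToHom_tensor, tensor_eqToHom,
        eqToHom_trans])

instance : StrictMonoidal (Free T S) where
  tensor_assoc := tensor_assoc'
  unit_tensor := unit_tensor'
  tensor_unit := tensor_unit'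
  associator_eq := associator_eq'
  leftUnitor_eq := leftUnitor_eq'
  rightUnitor_eq := rightUnitor_eq'

instance : SymmetricCategory (Free T S) where
  braiding X Y :=
    { hom := mk (Tm.braid X Y)
      inv := mk (Tm.braid Y X)
      hom_inv_id := Quot.sound (.symmetry X Y)
      inv_hom_id := Quot.sound (.symmetry Y X) }
  braiding_naturality_right := by
    rintro X Y Z ⟨f⟩; exact Quot.sound (.braid_naturality (Tm.id X) f)
  braiding_naturality_left := by
    rintro X Y ⟨f⟩ Z; exact Quot.sound (.braid_naturality f (Tm.id Z))
  hexagon_forward X Y Z := Quot.sound (.hexagon_forward X Y Z)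
  hexagon_reverse X Y Z := Quot.sound (.hexagon_reverse X Y Z)
  symmetry X Y := Quot.sound (.symmetry X Y)

/-- The comonoid structure of an object. -/
@[reducible]
def comon [T.HasCopy] (X : Free T S) : ComonObj X where
  counit := mk (Tm.del X)
  comul := mk (Tm.copy X)
  counit_comul := Quot.sound (.copy_del_left X)
  comul_counit := Quot.sound (.copy_del_right X)
  comul_assoc := Quot.sound (.copy_assoc X)

/-- The monoid structure of an object. -/
@[reducible]
def mon [T.HasCompare] (X : Free T S) : MonObj X where
  one := mk (Tm.omni X)
  mul := mk (Tm.compare X)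
  one_mul := Quot.sound (.compare_omni_left X)
  mul_one := Quot.sound (.compare_omni_right X)
  mul_assoc := Quot.sound (.compare_assoc X)

instance [T.HasCopy] : CopyDiscardCategory (Free T S) where
  comonObj X := comon X
  isCommComonObj X := letI := comon X; ⟨Quot.sound (.copy_comm X)⟩
  copy_tensor X Y := Quot.sound (.copy_tensor X Y)
  discard_tensor X Y := Quot.sound (.del_tensor X Y)
  copy_unit := Quot.sound .copy_unit
  discard_unit := Quot.sound .del_unit

instance [T.HasCompare] : HypergraphCategory (Free T S) where
  monObj X := mon X
  isCommMonObj X := letI := mon X; ⟨Quot.sound (.compare_comm X)⟩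
  compare_tensor X Y := Quot.sound (.compare_tensor X Y)
  omni_tensor X Y := Quot.sound (.omni_tensor X Y)
  compare_unit := Quot.sound .compare_unit
  omni_unit := Quot.sound .omni_unit
  special X := Quot.sound (.special X)
  frobenius_left X := Quot.sound (.frobenius_left X)
  frobenius_right X := Quot.sound (.frobenius_right X)

end Free

end PGM

namespace PGM

section StrictLemmas

variable {E : Type u} [Category.{v} E] [MonoidalCategory E]

lemma eqToHom_comp_tensorHom {X X' Y Z W : E} (h : X = X') (a : X' ⟶ Y) (b : Z ⟶ W) :
    (eqToHom h ≫ a) ⊗ₘ b = eqToHom (by rw [h]) ≫ (a ⊗ₘ b) := by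
  cases h; simp

lemma comp_eqToHom_tensorHom {X Y Y' Z W : E} (h : Y = Y') (a : X ⟶ Y) (b : Z ⟶ W) :
    (a ≫ eqToHom h) ⊗ₘ b = (a ⊗ₘ b) ≫ eqToHom (by rw [h]) := by
  cases h; simp

lemma tensorHom_eqToHom_comp {X X' Y Z W : E} (h : X = X') (a : X' ⟶ Y) (b : Z ⟶ W) :
    b ⊗ₘ (eqToHom h ≫ a) = eqToHom (by rw [h]) ≫ (b ⊗ₘ a) := by
  cases h; simp

lemma tensorHom_comp_eqToHom {X Y Y' Z W : E} (h : Y = Y') (a : X ⟶ Y) (b : Z ⟶ W) :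
    b ⊗ₘ (a ≫ eqToHom h) = (b ⊗ₘ a) ≫ eqToHom (by rw [h]) := by
  cases h; simp

lemma eqToHom_tensorHom_id {X X' Z : E} (h : X = X') :
    eqToHom h ⊗ₘ 𝟙 Z = eqToHom (by rw [h]) := by
  cases h; simp

lemma id_tensorHom_eqToHom {X X' Z : E} (h : X = X') :
    𝟙 Z ⊗ₘ eqToHom h = eqToHom (by rw [h]) := by
  cases h; simp

lemma tensorHom_assoc_eq [StrictMonoidal E] {X X' Y Y' Z Z' : E} (a : X ⟶ X') (b : Y ⟶ Y')
    (c : Z ⟶ Z') : (a ⊗ₘ b) ⊗ₘ c =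
      eqToHom (StrictMonoidal.tensor_assoc _ _ _) ≫ (a ⊗ₘ (b ⊗ₘ c)) ≫
        eqToHom (StrictMonoidal.tensor_assoc _ _ _).symm := by
  have h := associator_naturality a b c
  rw [StrictMonoidal.associator_eq, StrictMonoidal.associator_eq] at h
  rw [← Category.assoc, ← h]; simp

lemma id_tensorHom_of_unit [StrictMonoidal E] {U X Y : E} (hU : U = 𝟙_ E) (f : X ⟶ Y) :
    𝟙 U ⊗ₘ f = eqToHom (by rw [hU, StrictMonoidal.unit_tensor]) ≫ f ≫
      eqToHom (by rw [hU, StrictMonoidal.unit_tensor]) := by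
  subst hU
  have h := leftUnitor_naturality f
  rw [StrictMonoidal.leftUnitor_eq, StrictMonoidal.leftUnitor_eq] at h
  rw [← Category.assoc, ← h]; simp

lemma tensorHom_id_of_unit [StrictMonoidal E] {U X Y : E} (hU : U = 𝟙_ E) (f : X ⟶ Y) :
    f ⊗ₘ 𝟙 U = eqToHom (by rw [hU, StrictMonoidal.tensor_unit]) ≫ f ≫
      eqToHom (by rw [hU, StrictMonoidal.tensor_unit]) := by
  subst hU
  have h := rightUnitor_naturality f
  rw [StrictMonoidal.rightUnitor_eq, StrictMonoidal.rightUnitor_eq] at h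
  rw [← Category.assoc, ← h]; simp

lemma associator_inv_eq [StrictMonoidal E] (X Y Z : E) :
    (α_ X Y Z).inv = eqToHom (StrictMonoidal.tensor_assoc X Y Z).symm := by
  rw [Iso.inv_eq_inv _ (eqToIso (StrictMonoidal.tensor_assoc X Y Z)) |>.2]
  · rfl
  · exact StrictMonoidal.associator_eq X Y Z

lemma leftUnitor_inv_eq [StrictMonoidal E] (X : E) :
    (λ_ X).inv = eqToHom (StrictMonoidal.unit_tensor X).symm := by
  rw [Iso.inv_eq_inv _ (eqToIso (StrictMonoidal.unit_tensor X)) |>.2]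
  · rfl
  · exact StrictMonoidal.leftUnitor_eq X

lemma rightUnitor_inv_eq [StrictMonoidal E] (X : E) :
    (ρ_ X).inv = eqToHom (StrictMonoidal.tensor_unit X).symm := by
  rw [Iso.inv_eq_inv _ (eqToIso (StrictMonoidal.tensor_unit X)) |>.2]
  · rfl
  · exact StrictMonoidal.rightUnitor_eq X

lemma braiding_congr [SymmetricCategory E] {X X' Y Y' : E} (h : X = X') (h' : Y = Y') :
    (β_ X Y).hom = eqToHom (by rw [h, h']) ≫ (β_ X' Y').hom ≫ eqToHom (by rw [h, h']) := by
  subst h h'; simp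

lemma copy_congr [CopyDiscardCategory E] {X X' : E} (h : X = X') :
    Δ[X] = eqToHom h ≫ Δ[X'] ≫ eqToHom (by rw [h]) := by subst h; simp

lemma del_congr [CopyDiscardCategory E] {X X' : E} (h : X = X') :
    ε[X] = eqToHom h ≫ ε[X'] := by subst h; simp

lemma compare_congr [HypergraphCategory E] {X X' : E} (h : X = X') :
    μ[X] = eqToHom (by rw [h]) ≫ μ[X'] ≫ eqToHom h.symm := by subst h; simp

lemma omni_congr [HypergraphCategory E] {X X' : E} (h : X = X') :
    η[X] = η[X'] ≫ eqToHom h.symm := by subst h; simp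

end StrictLemmas

/-- `T ≤ T'`: the structure of `T` is part of that of `T'`. -/
structure Theory.Le (T T' : Theory) : Prop where
  copy : T.HasCopy → T'.HasCopy
  compare : T.HasCompare → T'.HasCompare

lemma Theory.le_refl (T : Theory) : T.Le T := ⟨id, id⟩

lemma Theory.sym_le (T : Theory) : Theory.sym.Le T :=
  ⟨fun h => absurd rfl h.ne_sym, fun h => absurd rfl h.ne_sym⟩

lemma Theory.cd_le_hyp : Theory.cd.Le Theory.hyp :=
  ⟨fun _ => inferInstance, fun h => absurd h.eq_hyp (by simp)⟩

namespace Free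

variable {A B : Type u} {T T' : Theory} {S : Signature A} {S' : Signature B}

section Extend

variable (hT : T.Le T') (m : List A → Free T' S') (m_nil : m [] = 𝟙_ (Free T' S'))
  (m_append : ∀ X Y, m (X ++ Y) = m X ⊗ m Y) (ψ : ∀ σ : S.Gen, m (S.dom σ) ⟶ m (S.cod σ))

/-- Interpretation of formal diagrams, given the images of the generators. -/
def eval : ∀ {X Y : List A}, Tm T S X Y → (m X ⟶ m Y)
  | _, _, .id X => 𝟙 (m X)
  | _, _, .comp f g => eval f ≫ eval g
  | _, _, .tensor f g => eqToHom (m_append _ _) ≫ (eval f ⊗ₘ eval g) ≫ eqToHom (m_append _ _).symm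
  | _, _, .braid X Y =>
      eqToHom (m_append _ _) ≫ (β_ (m X) (m Y)).hom ≫ eqToHom (m_append _ _).symm
  | _, _, .gen σ => ψ σ
  | _, _, @Tm.copy _ _ _ h X => haveI := hT.copy h; Δ[m X] ≫ eqToHom (m_append _ _).symm
  | _, _, @Tm.del _ _ _ h X => haveI := hT.copy h; ε[m X] ≫ eqToHom m_nil.symm
  | _, _, @Tm.compare _ _ _ h X => haveI := hT.compare h; eqToHom (m_append _ _) ≫ μ[m X]
  | _, _, @Tm.omni _ _ _ h X => haveI := hT.compare h; eqToHom m_nil ≫ η[m X]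

lemma eval_eqTo {X Y : List A} (h : X = Y) :
    eval hT m m_nil m_append ψ (Tm.eqTo h) = eqToHom (congrArg m h) := by
  cases h; simp [Tm.eqTo, eval]

lemma eval_comp {X Y Z : List A} (f : Tm T S X Y) (g : Tm T S Y Z) :
    eval hT m m_nil m_append ψ (f.comp g) =
      eval hT m m_nil m_append ψ f ≫ eval hT m m_nil m_append ψ g := rfl

lemma eval_id (X : List A) : eval hT m m_nil m_append ψ (Tm.id X) = 𝟙 (m X) := rfl

lemma eval_tensor {X Y X' Y' : List A} (f : Tm T S X Y) (g : Tm T S X' Y') :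
    eval hT m m_nil m_append ψ (f.tensor g) = eqToHom (m_append _ _) ≫
      (eval hT m m_nil m_append ψ f ⊗ₘ eval hT m m_nil m_append ψ g) ≫
        eqToHom (m_append _ _).symm := rfl

lemma eval_braid (X Y : List A) : eval hT m m_nil m_append ψ (Tm.braid X Y) =
    eqToHom (m_append _ _) ≫ (β_ (m X) (m Y)).hom ≫ eqToHom (m_append _ _).symm := rfl

lemma eval_copy [T.HasCopy] [T'.HasCopy] (X : List A) :
    eval hT m m_nil m_append ψ (Tm.copy X) = Δ[m X] ≫ eqToHom (m_append _ _).symm := rfl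

lemma eval_del [T.HasCopy] [T'.HasCopy] (X : List A) :
    eval hT m m_nil m_append ψ (Tm.del X) = ε[m X] ≫ eqToHom m_nil.symm := rfl

lemma eval_compare [T.HasCompare] [T'.HasCompare] (X : List A) :
    eval hT m m_nil m_append ψ (Tm.compare X) = eqToHom (m_append _ _) ≫ μ[m X] := rfl

lemma eval_omni [T.HasCompare] [T'.HasCompare] (X : List A) :
    eval hT m m_nil m_append ψ (Tm.omni X) = eqToHom m_nil ≫ η[m X] := rfl

lemma eval_middle (X X' Y Y' : List A) :
    eval hT m m_nil m_append ψ (Tm.middle X X' Y Y') =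
      eqToHom (by simp only [m_append]) ≫ tensorμ (m X) (m X') (m Y) (m Y') ≫
        eqToHom (by simp only [m_append]) := by
  simp only [Tm.middle, Tm.assoc, Tm.assocInv, eval_comp, eval_tensor, eval_id, eval_braid,
    eval_eqTo, tensorμ, StrictMonoidal.associator_eq, associator_inv_eq, ← id_tensorHom,
    ← tensorHom_id, eqToHom_comp_tensorHom, comp_eqToHom_tensorHom,
    tensorHom_eqToHom_comp, tensorHom_comp_eqToHom, id_tensorHom_eqToHom,
    Category.assoc, eqToHom_trans, eqToHom_trans_assoc]

set_option linter.unusedSimpArgs false in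
lemma eval_rel {X Y : List A} {f g : Tm T S X Y} (h : Tm.Rel f g) :
    eval hT m m_nil m_append ψ f = eval hT m m_nil m_append ψ g := by
  induction h with
  | comp_left g _ ih => simp [eval, ih]
  | comp_right f _ ih => simp [eval, ih]
  | tensor_left g _ ih => simp [eval, ih]
  | tensor_right f _ ih => simp [eval, ih]
  | id_comp f => simp [eval]
  | comp_id f => simp [eval]
  | comp_assoc f g h => simp [eval]
  | tensor_id X Y => simp [eval]
  | tensor_comp f f' g g' => simp [eval]
  | assoc_naturality f f' f'' =>
    simp only [eval_comp, eval_tensor, eval_id, eval_braid, Tm.assoc, Tm.assocInv,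
      eval_eqTo, eqToHom_comp_tensorHom, comp_eqToHom_tensorHom, tensorHom_eqToHom_comp,
      tensorHom_comp_eqToHom, Category.assoc, eqToHom_trans, eqToHom_trans_assoc,
      eqToHom_refl, Category.id_comp, Category.comp_id,
      tensorHom_assoc_eq]
  | unit_tensor f =>
    simp only [eval, eval_eqTo, id_tensorHom_of_unit m_nil]
    simp
  | tensor_unit f =>
    simp only [eval, eval_eqTo, tensorHom_id_of_unit m_nil]
    simp
  | braid_naturality f g => simp [eval]
  | hexagon_forward X Y Z =>
    have h := BraidedCategory.hexagon_forward (m X) (m Y) (m Z)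
    simp only [StrictMonoidal.associator_eq, associator_inv_eq, StrictMonoidal.leftUnitor_eq,
      leftUnitor_inv_eq, StrictMonoidal.rightUnitor_eq, rightUnitor_inv_eq, ← id_tensorHom,
      ← tensorHom_id] at h
    simp only [eval_comp, eval_tensor, eval_id, eval_braid, Tm.assoc, Tm.assocInv,
      eval_eqTo, eqToHom_comp_tensorHom, comp_eqToHom_tensorHom, tensorHom_eqToHom_comp,
      tensorHom_comp_eqToHom, Category.assoc, eqToHom_trans, eqToHom_trans_assoc,
      eqToHom_refl, Category.id_comp, Category.comp_id,
      braiding_congr (rfl : m X = m X) (m_append Y Z), reassoc_of% h.symm]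
  | hexagon_reverse X Y Z =>
    have h := BraidedCategory.hexagon_reverse (m X) (m Y) (m Z)
    simp only [StrictMonoidal.associator_eq, associator_inv_eq, StrictMonoidal.leftUnitor_eq,
      leftUnitor_inv_eq, StrictMonoidal.rightUnitor_eq, rightUnitor_inv_eq, ← id_tensorHom,
      ← tensorHom_id] at h
    simp only [eval_comp, eval_tensor, eval_id, eval_braid, Tm.assoc, Tm.assocInv,
      eval_eqTo, eqToHom_comp_tensorHom, comp_eqToHom_tensorHom, tensorHom_eqToHom_comp,
      tensorHom_comp_eqToHom, Category.assoc, eqToHom_trans, eqToHom_trans_assoc,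
      eqToHom_refl, Category.id_comp, Category.comp_id,
      braiding_congr (m_append X Y) (rfl : m Z = m Z), reassoc_of% h.symm]
  | symmetry X Y => simp [eval]
  | copy_del_left X =>
    have := hT.copy ‹_›
    have h := ComonObj.counit_comul (m X)
    simp only [StrictMonoidal.associator_eq, associator_inv_eq, StrictMonoidal.leftUnitor_eq,
      leftUnitor_inv_eq, StrictMonoidal.rightUnitor_eq, rightUnitor_inv_eq, ← id_tensorHom,
      ← tensorHom_id] at h
    simp only [eval_comp, eval_tensor, eval_id, eval_braid, Tm.assoc, Tm.assocInv, eval_copy, eval_del,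
      eval_eqTo, eqToHom_comp_tensorHom, comp_eqToHom_tensorHom, tensorHom_eqToHom_comp,
      tensorHom_comp_eqToHom, Category.assoc, eqToHom_trans, eqToHom_trans_assoc,
      eqToHom_refl, Category.id_comp, Category.comp_id,
      reassoc_of% h]
    exact h
  | copy_del_right X =>
    have := hT.copy ‹_›
    have h := ComonObj.comul_counit (m X)
    simp only [StrictMonoidal.associator_eq, associator_inv_eq, StrictMonoidal.leftUnitor_eq,
      leftUnitor_inv_eq, StrictMonoidal.rightUnitor_eq, rightUnitor_inv_eq, ← id_tensorHom,
      ← tensorHom_id] at h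
    simp only [eval_comp, eval_tensor, eval_id, eval_braid, Tm.assoc, Tm.assocInv, eval_copy, eval_del,
      eval_eqTo, eqToHom_comp_tensorHom, comp_eqToHom_tensorHom, tensorHom_eqToHom_comp,
      tensorHom_comp_eqToHom, Category.assoc, eqToHom_trans, eqToHom_trans_assoc,
      eqToHom_refl, Category.id_comp, Category.comp_id,
      reassoc_of% h]
  | copy_assoc X =>
    have := hT.copy ‹_›
    have h := ComonObj.comul_assoc (m X)
    simp only [StrictMonoidal.associator_eq, associator_inv_eq, StrictMonoidal.leftUnitor_eq,
      leftUnitor_inv_eq, StrictMonoidal.rightUnitor_eq, rightUnitor_inv_eq, ← id_tensorHom,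
      ← tensorHom_id] at h
    simp only [eval_comp, eval_tensor, eval_id, eval_braid, Tm.assoc, Tm.assocInv, eval_copy, eval_del,
      eval_eqTo, eqToHom_comp_tensorHom, comp_eqToHom_tensorHom, tensorHom_eqToHom_comp,
      tensorHom_comp_eqToHom, Category.assoc, eqToHom_trans, eqToHom_trans_assoc,
      eqToHom_refl, Category.id_comp, Category.comp_id,
      reassoc_of% h]
  | copy_comm X =>
    have := hT.copy ‹_›
    have h := IsCommComonObj.comul_comm (m X)
    simp only [eval_comp, eval_tensor, eval_id, eval_braid, Tm.assoc, Tm.assocInv, eval_copy, eval_del,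
      eval_eqTo, eqToHom_comp_tensorHom, comp_eqToHom_tensorHom, tensorHom_eqToHom_comp,
      tensorHom_comp_eqToHom, Category.assoc, eqToHom_trans, eqToHom_trans_assoc,
      eqToHom_refl, Category.id_comp, Category.comp_id,
      reassoc_of% h]
  | copy_tensor X Y =>
    have := hT.copy ‹_›
    have h := CopyDiscardCategory.copy_tensor (m X) (m Y)
    simp only [eval_comp, eval_tensor, eval_id, eval_braid, Tm.assoc, Tm.assocInv, eval_copy, eval_del,
      eval_eqTo, eqToHom_comp_tensorHom, comp_eqToHom_tensorHom, tensorHom_eqToHom_comp,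
      tensorHom_comp_eqToHom, Category.assoc, eqToHom_trans, eqToHom_trans_assoc,
      eqToHom_refl, Category.id_comp, Category.comp_id,
      eval_middle, copy_congr (m_append X Y), h]
  | del_tensor X Y =>
    have := hT.copy ‹_›
    have h := CopyDiscardCategory.discard_tensor (m X) (m Y)
    simp only [StrictMonoidal.associator_eq, associator_inv_eq, StrictMonoidal.leftUnitor_eq,
      leftUnitor_inv_eq, StrictMonoidal.rightUnitor_eq, rightUnitor_inv_eq, ← id_tensorHom,
      ← tensorHom_id] at h
    simp only [eval_comp, eval_tensor, eval_id, eval_braid, Tm.assoc, Tm.assocInv, eval_copy, eval_del,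
      eval_eqTo, eqToHom_comp_tensorHom, comp_eqToHom_tensorHom, tensorHom_eqToHom_comp,
      tensorHom_comp_eqToHom, Category.assoc, eqToHom_trans, eqToHom_trans_assoc,
      eqToHom_refl, Category.id_comp, Category.comp_id,
      del_congr (m_append X Y), h]
  | copy_unit =>
    have := hT.copy ‹_›
    have h := CopyDiscardCategory.copy_unit (C := Free T' S')
    simp only [StrictMonoidal.associator_eq, associator_inv_eq, StrictMonoidal.leftUnitor_eq,
      leftUnitor_inv_eq, StrictMonoidal.rightUnitor_eq, rightUnitor_inv_eq, ← id_tensorHom,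
      ← tensorHom_id] at h
    simp only [eval_comp, eval_tensor, eval_id, eval_braid, Tm.assoc, Tm.assocInv, eval_copy, eval_del,
      eval_eqTo, eqToHom_comp_tensorHom, comp_eqToHom_tensorHom, tensorHom_eqToHom_comp,
      tensorHom_comp_eqToHom, Category.assoc, eqToHom_trans, eqToHom_trans_assoc,
      eqToHom_refl, Category.id_comp, Category.comp_id,
      copy_congr m_nil, h]
  | del_unit =>
    have := hT.copy ‹_›
    have h := CopyDiscardCategory.discard_unit (C := Free T' S')
    simp only [eval_comp, eval_tensor, eval_id, eval_braid, Tm.assoc, Tm.assocInv, eval_copy, eval_del,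
      eval_eqTo, eqToHom_comp_tensorHom, comp_eqToHom_tensorHom, tensorHom_eqToHom_comp,
      tensorHom_comp_eqToHom, Category.assoc, eqToHom_trans, eqToHom_trans_assoc,
      eqToHom_refl, Category.id_comp, Category.comp_id,
      del_congr m_nil, h]
  | compare_omni_left X =>
    have := hT.compare ‹_›
    have h := MonObj.one_mul (m X)
    simp only [StrictMonoidal.associator_eq, associator_inv_eq, StrictMonoidal.leftUnitor_eq,
      leftUnitor_inv_eq, StrictMonoidal.rightUnitor_eq, rightUnitor_inv_eq, ← id_tensorHom,
      ← tensorHom_id] at h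
    simp only [eval_comp, eval_tensor, eval_id, eval_braid, Tm.assoc, Tm.assocInv, eval_copy, eval_del, eval_compare, eval_omni,
      eval_eqTo, eqToHom_comp_tensorHom, comp_eqToHom_tensorHom, tensorHom_eqToHom_comp,
      tensorHom_comp_eqToHom, Category.assoc, eqToHom_trans, eqToHom_trans_assoc,
      eqToHom_refl, Category.id_comp, Category.comp_id,
      h]
    rfl
  | compare_omni_right X =>
    have := hT.compare ‹_›
    have h := MonObj.mul_one (m X)
    simp only [StrictMonoidal.associator_eq, associator_inv_eq, StrictMonoidal.leftUnitor_eq,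
      leftUnitor_inv_eq, StrictMonoidal.rightUnitor_eq, rightUnitor_inv_eq, ← id_tensorHom,
      ← tensorHom_id] at h
    simp only [eval_comp, eval_tensor, eval_id, eval_braid, Tm.assoc, Tm.assocInv, eval_copy, eval_del, eval_compare, eval_omni,
      eval_eqTo, eqToHom_comp_tensorHom, comp_eqToHom_tensorHom, tensorHom_eqToHom_comp,
      tensorHom_comp_eqToHom, Category.assoc, eqToHom_trans, eqToHom_trans_assoc,
      eqToHom_refl, Category.id_comp, Category.comp_id,
      h]
  | compare_assoc X =>
    have := hT.compare ‹_›
    have h := MonObj.mul_assoc (m X)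
    simp only [StrictMonoidal.associator_eq, associator_inv_eq, StrictMonoidal.leftUnitor_eq,
      leftUnitor_inv_eq, StrictMonoidal.rightUnitor_eq, rightUnitor_inv_eq, ← id_tensorHom,
      ← tensorHom_id] at h
    simp only [eval_comp, eval_tensor, eval_id, eval_braid, Tm.assoc, Tm.assocInv, eval_copy, eval_del, eval_compare, eval_omni,
      eval_eqTo, eqToHom_comp_tensorHom, comp_eqToHom_tensorHom, tensorHom_eqToHom_comp,
      tensorHom_comp_eqToHom, Category.assoc, eqToHom_trans, eqToHom_trans_assoc,
      eqToHom_refl, Category.id_comp, Category.comp_id,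
      h]
  | compare_comm X =>
    have := hT.compare ‹_›
    have h := IsCommMonObj.mul_comm (m X)
    simp only [eval_comp, eval_tensor, eval_id, eval_braid, Tm.assoc, Tm.assocInv, eval_copy, eval_del, eval_compare, eval_omni,
      eval_eqTo, eqToHom_comp_tensorHom, comp_eqToHom_tensorHom, tensorHom_eqToHom_comp,
      tensorHom_comp_eqToHom, Category.assoc, eqToHom_trans, eqToHom_trans_assoc,
      eqToHom_refl, Category.id_comp, Category.comp_id,
      h]
  | compare_tensor X Y =>
    have := hT.compare ‹_›
    have h := HypergraphCategory.compare_tensor (m X) (m Y)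
    simp only [eval_comp, eval_tensor, eval_id, eval_braid, Tm.assoc, Tm.assocInv, eval_copy, eval_del, eval_compare, eval_omni,
      eval_eqTo, eqToHom_comp_tensorHom, comp_eqToHom_tensorHom, tensorHom_eqToHom_comp,
      tensorHom_comp_eqToHom, Category.assoc, eqToHom_trans, eqToHom_trans_assoc,
      eqToHom_refl, Category.id_comp, Category.comp_id,
      eval_middle, compare_congr (m_append X Y), h]
  | omni_tensor X Y =>
    have := hT.compare ‹_›
    have h := HypergraphCategory.omni_tensor (m X) (m Y)
    simp only [StrictMonoidal.associator_eq, associator_inv_eq, StrictMonoidal.leftUnitor_eq,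
      leftUnitor_inv_eq, StrictMonoidal.rightUnitor_eq, rightUnitor_inv_eq, ← id_tensorHom,
      ← tensorHom_id] at h
    simp only [eval_comp, eval_tensor, eval_id, eval_braid, Tm.assoc, Tm.assocInv, eval_copy, eval_del, eval_compare, eval_omni,
      eval_eqTo, eqToHom_comp_tensorHom, comp_eqToHom_tensorHom, tensorHom_eqToHom_comp,
      tensorHom_comp_eqToHom, Category.assoc, eqToHom_trans, eqToHom_trans_assoc,
      eqToHom_refl, Category.id_comp, Category.comp_id,
      omni_congr (m_append X Y), h]
  | compare_unit =>
    have := hT.compare ‹_›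
    have h := HypergraphCategory.compare_unit (C := Free T' S')
    simp only [StrictMonoidal.associator_eq, associator_inv_eq, StrictMonoidal.leftUnitor_eq,
      leftUnitor_inv_eq, StrictMonoidal.rightUnitor_eq, rightUnitor_inv_eq, ← id_tensorHom,
      ← tensorHom_id] at h
    simp only [eval_comp, eval_tensor, eval_id, eval_braid, Tm.assoc, Tm.assocInv, eval_copy, eval_del, eval_compare, eval_omni,
      eval_eqTo, eqToHom_comp_tensorHom, comp_eqToHom_tensorHom, tensorHom_eqToHom_comp,
      tensorHom_comp_eqToHom, Category.assoc, eqToHom_trans, eqToHom_trans_assoc,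
      eqToHom_refl, Category.id_comp, Category.comp_id,
      compare_congr m_nil, h]
  | omni_unit =>
    have := hT.compare ‹_›
    have h := HypergraphCategory.omni_unit (C := Free T' S')
    simp only [eval_comp, eval_tensor, eval_id, eval_braid, Tm.assoc, Tm.assocInv, eval_copy, eval_del, eval_compare, eval_omni,
      eval_eqTo, eqToHom_comp_tensorHom, comp_eqToHom_tensorHom, tensorHom_eqToHom_comp,
      tensorHom_comp_eqToHom, Category.assoc, eqToHom_trans, eqToHom_trans_assoc,
      eqToHom_refl, Category.id_comp, Category.comp_id,
      omni_congr m_nil, h]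
  | special X =>
    have := hT.compare ‹_›
    have h := HypergraphCategory.special (m X)
    simp only [eval_comp, eval_tensor, eval_id, eval_braid, Tm.assoc, Tm.assocInv, eval_copy, eval_del, eval_compare, eval_omni,
      eval_eqTo, eqToHom_comp_tensorHom, comp_eqToHom_tensorHom, tensorHom_eqToHom_comp,
      tensorHom_comp_eqToHom, Category.assoc, eqToHom_trans, eqToHom_trans_assoc,
      eqToHom_refl, Category.id_comp, Category.comp_id,
      h]
  | frobenius_left X =>
    have := hT.compare ‹_›
    have h := HypergraphCategory.frobenius_left (m X)
    simp only [StrictMonoidal.associator_eq, associator_inv_eq, StrictMonoidal.leftUnitor_eq,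
      leftUnitor_inv_eq, StrictMonoidal.rightUnitor_eq, rightUnitor_inv_eq, ← id_tensorHom,
      ← tensorHom_id] at h
    simp only [eval_comp, eval_tensor, eval_id, eval_braid, Tm.assoc, Tm.assocInv, eval_copy, eval_del, eval_compare, eval_omni,
      eval_eqTo, eqToHom_comp_tensorHom, comp_eqToHom_tensorHom, tensorHom_eqToHom_comp,
      tensorHom_comp_eqToHom, Category.assoc, eqToHom_trans, eqToHom_trans_assoc,
      eqToHom_refl, Category.id_comp, Category.comp_id,
      reassoc_of% h]
  | frobenius_right X =>
    have := hT.compare ‹_›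
    have h := HypergraphCategory.frobenius_right (m X)
    simp only [StrictMonoidal.associator_eq, associator_inv_eq, StrictMonoidal.leftUnitor_eq,
      leftUnitor_inv_eq, StrictMonoidal.rightUnitor_eq, rightUnitor_inv_eq, ← id_tensorHom,
      ← tensorHom_id] at h
    simp only [eval_comp, eval_tensor, eval_id, eval_braid, Tm.assoc, Tm.assocInv, eval_copy, eval_del, eval_compare, eval_omni,
      eval_eqTo, eqToHom_comp_tensorHom, comp_eqToHom_tensorHom, tensorHom_eqToHom_comp,
      tensorHom_comp_eqToHom, Category.assoc, eqToHom_trans, eqToHom_trans_assoc,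
      eqToHom_refl, Category.id_comp, Category.comp_id,
      reassoc_of% h]

/-- The strict symmetric monoidal functor out of a free category that is given by the monoid
homomorphism `m` on objects and by `ψ` on generating morphisms. -/
def extend : SymFunctor (Free T S) (Free T' S') where
  obj := m
  map f := Quot.lift (eval hT m m_nil m_append ψ)
    (fun _ _ h => eval_rel hT m m_nil m_append ψ h) f
  map_id X := rfl
  map_comp := by rintro X Y Z ⟨f⟩ ⟨g⟩; rfl
  obj_unit := m_nil
  obj_tensor := m_append
  map_tensor := by rintro X X' Y Y' ⟨f⟩ ⟨g⟩; rfl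
  map_braiding X Y := rfl

end Extend

/-- The CD-functor between free CD-categories given on generators. -/
def extendCD [T.HasCopy] [T'.HasCopy] (hT : T.Le T')
    (m : List A → Free T' S') {S : Signature A} (m_nil : m [] = 𝟙_ (Free T' S'))
    (m_append : ∀ X Y, m (X ++ Y) = m X ⊗ m Y)
    (ψ : ∀ σ : S.Gen, m (S.dom σ) ⟶ m (S.cod σ)) : CDFunctor (Free T S) (Free T' S') where
  toSymFunctor := extend hT m m_nil m_append ψ
  map_copy X := rfl
  map_del X := rfl

end Free
end PGM

/-! ### Ordered DAGs and their syntax categories -/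

namespace PGM

noncomputable section

/-- An ordered DAG: a finite directed graph with a total order such that every edge `v → w`
satisfies `v < w`. -/
structure OrderedDAG : Type (u + 1) where
  V : Type u
  [order : LinearOrder V]
  [fintype : Fintype V]
  Edge : V → V → Prop
  lt_of_edge : ∀ {v w : V}, Edge v w → v < w

attribute [instance] OrderedDAG.order OrderedDAG.fintype

namespace OrderedDAG

/-- The vertices, in increasing order. -/
def vertices (G : OrderedDAG.{u}) : List G.V := (Finset.univ : Finset G.V).sort (· ≤ ·)

open Classical in
/-- Whether `w` is a parent of `v`. -/
def isParent (G : OrderedDAG.{u}) (v w : G.V) : Bool := decide (G.Edge w v)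

lemma isParent_iff (G : OrderedDAG.{u}) (v w : G.V) : G.isParent v w = true ↔ G.Edge w v := by
  simp [isParent]

/-- The parents of a vertex, in increasing order. -/
def parents (G : OrderedDAG.{u}) (v : G.V) : List G.V := G.vertices.filter (G.isParent v)

/-- Ordered chordal graphs: any two parents of a vertex are joined by an edge. -/
def IsChordal (G : OrderedDAG.{u}) : Prop :=
  ∀ u v w : G.V, G.Edge u w → G.Edge v w → u < v → G.Edge u v

/-- Order-preserving graph homomorphisms; edges may be contracted. -/
@[ext]
structure Hom (G G' : OrderedDAG.{u}) where
  toFun : G.V → G'.V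
  monotone : Monotone toFun
  map_edge : ∀ {v w : G.V}, G.Edge v w → toFun v = toFun w ∨ G'.Edge (toFun v) (toFun w)

/-- The category of ordered DAGs. -/
instance : Category.{u} OrderedDAG.{u} where
  Hom := Hom
  id G := ⟨id, monotone_id, fun h => Or.inr h⟩
  comp f g := ⟨g.toFun ∘ f.toFun, g.monotone.comp f.monotone, fun h => by
    rcases f.map_edge h with h | h
    · exact Or.inl (congrArg g.toFun h)
    · exact g.map_edge h⟩

/-- The one-vertex graph. -/
def point : OrderedDAG.{u} where
  V := PUnit.{u + 1}
  Edge _ _ := False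
  lt_of_edge h := h.elim

/-- The unique morphism to the one-vertex graph. -/
def toPoint (G : OrderedDAG.{u}) : G ⟶ point.{u} where
  toFun _ := PUnit.unit
  monotone _ _ _ := le_rfl
  map_edge _ := Or.inl rfl

open Classical in
/-- The preimage of a vertex, in increasing order. -/
def fiber {G G' : OrderedDAG.{u}} (α : G ⟶ G') (v : G'.V) : List G.V :=
  G.vertices.filter fun w => decide (Hom.toFun α w = v)

lemma pairwise_vertices (G : OrderedDAG.{u}) : G.vertices.Pairwise (· < ·) :=
  (Finset.sortedLT_sort _).pairwise

lemma mem_vertices (G : OrderedDAG.{u}) (v : G.V) : v ∈ G.vertices := by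
  simp [vertices]

lemma mem_fiber {G G' : OrderedDAG.{u}} (α : G ⟶ G') (v : G'.V) (w : G.V) :
    w ∈ fiber α v ↔ Hom.toFun α w = v := by
  simp [fiber, mem_vertices]

lemma pairwise_fiber {G G' : OrderedDAG.{u}} (α : G ⟶ G') (v : G'.V) :
    (fiber α v).Pairwise (· < ·) := (pairwise_vertices G).filter _

lemma pairwise_flatMap_fiber {G G' : OrderedDAG.{u}} (α : G ⟶ G') (L : List G'.V)
    (hL : L.Pairwise (· < ·)) : (L.flatMap (fiber α)).Pairwise (· < ·) := by
  rw [List.pairwise_flatMap]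
  refine ⟨fun v _ => pairwise_fiber α v, hL.imp fun {v v'} h w hw w' hw' => ?_⟩
  rw [mem_fiber] at hw hw'
  by_contra hc
  have := Hom.monotone α (not_lt.1 hc)
  rw [hw, hw'] at this
  exact absurd h (not_lt.2 this)

lemma eq_of_pairwise {V : Type u} [LinearOrder V] {L L' : List V} (h : L.Pairwise (· < ·))
    (h' : L'.Pairwise (· < ·)) (hm : ∀ v, v ∈ L ↔ v ∈ L') : L = L' := by
  refine List.Perm.eq_of_pairwise (le := (· ≤ ·)) (fun a b _ _ => le_antisymm)
    (h.imp le_of_lt) (h'.imp le_of_lt) ?_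
  exact (List.perm_ext_iff_of_nodup (h.imp ne_of_lt) (h'.imp ne_of_lt)).2 hm

lemma flatMap_fiber_vertices {G G' : OrderedDAG.{u}} (α : G ⟶ G') :
    G'.vertices.flatMap (fiber α) = G.vertices :=
  eq_of_pairwise (pairwise_flatMap_fiber α _ (pairwise_vertices G')) (pairwise_vertices G)
    (by simp [mem_fiber, mem_vertices])

lemma fiber_comp {G G' G'' : OrderedDAG.{u}} (α : G ⟶ G') (β : G' ⟶ G'') (v : G''.V) :
    fiber (α ≫ β) v = (fiber β v).flatMap (fiber α) :=
  eq_of_pairwise (pairwise_fiber _ _) (pairwise_flatMap_fiber α _ (pairwise_fiber _ _))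
    (by simp [mem_fiber]; intro w; rfl)

lemma fiber_id {G : OrderedDAG.{u}} (v : G.V) : fiber (𝟙 G) v = [v] :=
  eq_of_pairwise (pairwise_fiber _ _) (List.pairwise_singleton _ _)
    (by intro w; rw [mem_fiber, List.mem_singleton]; rfl)

lemma fiber_toPoint (G : OrderedDAG.{u}) (v : point.{u}.V) : fiber G.toPoint v = G.vertices :=
  eq_of_pairwise (pairwise_fiber _ _) (pairwise_vertices G)
    (by intro w; rw [mem_fiber]; exact ⟨fun _ => G.mem_vertices w, fun _ => rfl⟩)

lemma parents_point (v : point.{u}.V) : point.{u}.parents v = [] := by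
  rw [parents, List.filter_eq_nil_iff]
  intro w _ h
  exact (isParent_iff _ _ _).1 h

/-- The parents of `v` all lie in the initial segment below `v`. -/
lemma filter_isParent (G : OrderedDAG.{u}) (v : G.V) (L : List G.V)
    (h : (L ++ [v]) <+: G.vertices) : L.filter (G.isParent v) = G.parents v := by
  obtain ⟨R, hR⟩ := h
  have hp := G.pairwise_vertices
  unfold parents
  rw [← hR] at hp ⊢
  have h2 : R.filter (G.isParent v) = [] := by
    rw [List.filter_eq_nil_iff]
    intro w hw he
    have h1 : v < w := (List.pairwise_append.1 hp).2.2 v (by simp) w hw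
    exact lt_asymm h1 (G.lt_of_edge ((G.isParent_iff _ _).1 he))
  have h3 : ¬ (G.isParent v v = true) := fun he =>
    lt_irrefl _ (G.lt_of_edge ((G.isParent_iff _ _).1 he))
  simp [List.filter_append, h2, h3]

end OrderedDAG

end

end PGM

namespace PGM

noncomputable section

/-- In a free category with copy and delete: delete the wires that do not satisfy `p`. -/
def marginalise {A : Type u} {T : Theory} [T.HasCopy] {S : Signature A} (p : A → Bool) :
    ∀ L : List A, (show Free T S from L) ⟶ (show Free T S from L.filter p)
  | [] => 𝟙 (𝟙_ (Free T S))
  | a :: L =>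
    if h : p a = true then
      (𝟙 (show Free T S from [a]) ⊗ₘ marginalise p L) ≫
        eqToHom (List.filter_cons_of_pos (p := p) (l := L) h).symm
    else
      (ε[(show Free T S from [a])] ⊗ₘ marginalise p L) ≫
        eqToHom (List.filter_cons_of_neg (p := p) (l := L) h).symm

namespace OrderedDAG

/-- The signature of an ordered DAG: its generating objects are the vertices, and every vertex `v`
contributes a generating morphism from the list of parents of `v` to `v`. -/
def signature (G : OrderedDAG.{u}) : Signature G.V where
  Gen := G.V
  dom v := G.parents v
  cod v := [v]

/-- The signature with the vertices as generating objects and without generating morphisms. -/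
def vertexSignature (G : OrderedDAG.{u}) : Signature G.V where
  Gen := PEmpty.{u + 1}
  dom := PEmpty.elim
  cod := PEmpty.elim

end OrderedDAG

open OrderedDAG

/-- The vertex-list category: the free symmetric monoidal category on the vertices. -/
abbrev VCat (G : OrderedDAG.{u}) : Type u := Free .sym G.vertexSignature

/-- The free CD-category generated by an ordered DAG. -/
abbrev CDSyn (G : OrderedDAG.{u}) : Type u := Free .cd G.signature

/-- The free hypergraph category generated by an ordered DAG. -/
abbrev Syn (G : OrderedDAG.{u}) : Type u := Free .hyp G.signature

/-- The generator of `CDSyn G` at a vertex. -/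
def box (G : OrderedDAG.{u}) (v : G.V) : (show CDSyn G from G.parents v) ⟶ (show CDSyn G from [v]) :=
  Free.mk (Tm.gen (S := G.signature) v)

/-- The copy-composition of the generators that correspond to the vertices of an initial segment
(given as a list `r` in decreasing order): take the copy-composition of all generators but the one
of the biggest vertex `v`, copy its outputs, marginalise one of the copies to the parents of `v`
and apply the generator of `v` to them. -/
def copyComp (G : OrderedDAG.{u}) : ∀ r : List G.V, r.reverse <+: G.vertices →
    (𝟙_ (CDSyn G) ⟶ (show CDSyn G from r.reverse))
  | [], _ => 𝟙 (𝟙_ (CDSyn G))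
  | v :: r, h =>
    have h' : (r.reverse ++ [v]) <+: G.vertices := List.reverse_cons ▸ h
    copyComp G r ((List.prefix_append _ _).trans h') ≫ Δ[(show CDSyn G from r.reverse)] ≫
      (𝟙 (show CDSyn G from r.reverse) ⊗ₘ
        (marginalise (G.isParent v) r.reverse ≫ eqToHom (G.filter_isParent v r.reverse h') ≫
          box G v)) ≫ eqToHom (List.reverse_cons (a := v) (as := r)).symm

/-- The copy-composition of all generators of `CDSyn G`. -/
def copyCompAll (G : OrderedDAG.{u}) : 𝟙_ (CDSyn G) ⟶ (show CDSyn G from G.vertices) :=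
  copyComp G G.vertices.reverse (by rw [List.reverse_reverse]) ≫
    eqToHom (List.reverse_reverse G.vertices)

/-- The one generating object of `CDSyn point`. -/
def pt : CDSyn point.{u} := [PUnit.unit]

/-- The one generating morphism of `CDSyn point`. -/
def state : 𝟙_ (CDSyn point.{u}) ⟶ pt.{u} :=
  eqToHom (parents_point.{u} PUnit.unit).symm ≫ box point.{u} PUnit.unit

/-- The functor `VCat G' ⥤ VCat G` induced by a morphism `α : G ⟶ G'`: it sends a vertex to the
list of its preimages. -/
def VCat.map {G G' : OrderedDAG.{u}} (α : G ⟶ G') : SymFunctor (VCat G') (VCat G) :=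
  Free.extend (Theory.le_refl _) (fun L => L.flatMap (fiber α)) rfl (fun _ _ => List.flatMap_append)
    (fun σ => σ.elim)

/-- The inclusion of the vertex-list category. -/
def vertexInclusion (G : OrderedDAG.{u}) : SymFunctor (VCat G) (CDSyn G) :=
  Free.extend (Theory.sym_le _) (fun L => L) rfl
    (fun _ _ => rfl) (fun σ => σ.elim)

/-- The CD-functor `⋆_G` from the free CD-category to the free hypergraph category that is the
identity on generators. -/
def star (G : OrderedDAG.{u}) : CDFunctor (CDSyn G) (Syn G) :=
  Free.extendCD Theory.cd_le_hyp (fun L => L) rfl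
    (fun _ _ => rfl) (fun v => Free.mk (Tm.gen (S := G.signature) v))

/-- The CD-functor `!_G` that is induced by the morphism from `G` to the one-vertex graph: it
sends the generating object to the list of all vertices and the generating morphism to the
copy-composition of all generators. -/
def bang (G : OrderedDAG.{u}) : CDFunctor (CDSyn point.{u}) (CDSyn G) :=
  Free.extendCD (Theory.le_refl _) (fun L => L.flatMap fun _ => G.vertices) rfl
    (fun _ _ => List.flatMap_append)
    (fun v => eqToHom (congrArg _ (parents_point v)) ≫ copyCompAll G ≫
      eqToHom (List.flatMap_singleton _ _).symm)

end

end PGM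

/-! ### Networks -/

namespace PGM

/-- Monoidal transformations between strict symmetric monoidal functors (not required to be
natural). -/
@[ext]
structure MonoidalTransformation
    {C : Type u₁} [Category.{v₁} C] [MonoidalCategory C] [SymmetricCategory C]
    {D : Type u₂} [Category.{v₂} D] [MonoidalCategory D] [SymmetricCategory D]
    (F G : SymFunctor C D) where
  app : ∀ X : C, F.obj X ⟶ G.obj X
  app_unit : app (𝟙_ C) = eqToHom (F.obj_unit.trans G.obj_unit.symm)
  app_tensor : ∀ X Y : C, app (X ⊗ Y) =
    eqToHom (F.obj_tensor X Y) ≫ (app X ⊗ₘ app Y) ≫ eqToHom (G.obj_tensor X Y).symm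

lemma MonoidalTransformation.app_congr
    {C : Type u₁} [Category.{v₁} C] [MonoidalCategory C] [SymmetricCategory C]
    {D : Type u₂} [Category.{v₂} D] [MonoidalCategory D] [SymmetricCategory D]
    {F G : SymFunctor C D} (t : MonoidalTransformation F G) {X Y : C} (h : X = Y) :
    t.app X = eqToHom (congrArg F.obj h) ≫ t.app Y ≫ eqToHom (congrArg G.obj h.symm) := by
  subst h; simp

lemma MonoidalTransformation.app_heq
    {C : Type u₁} [Category.{v₁} C] [MonoidalCategory C] [SymmetricCategory C]
    {D : Type u₂} [Category.{v₂} D] [MonoidalCategory D] [SymmetricCategory D]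
    {F G : SymFunctor C D} (t : MonoidalTransformation F G) {X Y : C} (h : X = Y) :
    t.app X ≍ t.app Y := by
  subst h; rfl

open OrderedDAG

noncomputable section

lemma VCat.map_obj {G G' : OrderedDAG.{u}} (α : G ⟶ G') (L : VCat G') :
    (VCat.map α).obj L = List.flatMap (fiber α) L := rfl

lemma VCat.map_id_obj {G : OrderedDAG.{u}} (L : VCat G) : (VCat.map (𝟙 G)).obj L = L := by
  rw [VCat.map_obj]
  simp only [funext fiber_id]
  exact List.flatMap_singleton' L

lemma VCat.map_comp_obj {G G' G'' : OrderedDAG.{u}} (α : G ⟶ G') (β : G' ⟶ G'') (L : VCat G'') :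
    (VCat.map (α ≫ β)).obj L = (VCat.map α).obj ((VCat.map β).obj L) := by
  simp only [VCat.map_obj, funext (fiber_comp α β)]
  exact List.flatMap_assoc.symm

lemma toPoint_unique {G : OrderedDAG.{u}} (α : G ⟶ point.{u}) : α = G.toPoint := rfl

/-- Triples `(ω, G, τ)`: a state `ω` of total morphisms of `C` (given as a CD-functor on
`CDSyn point`), an ordered DAG `G`, and an assignment `τ` of an object to each vertex of `G`, such
that `ω` is a state on the tensor product of the objects assigned to the vertices. -/
structure Net (C : Type u₁) [Category.{v₁} C] [MonoidalCategory C] [CopyDiscardCategory C] where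
  graph : OrderedDAG.{u}
  dist : CDFunctor (CDSyn point.{u}) (Tot C)
  assign : SymFunctor (VCat graph) (Tot C)
  compat : (vertexInclusion point.{u}).toFunctor ⋙ dist.toFunctor =
    (VCat.map graph.toPoint).toFunctor ⋙ assign.toFunctor

namespace Net

lemma eqToHom_tensorHom_eqToHom {E : Type u} [Category.{v} E] [MonoidalCategory E] {X X' Y Y' : E}
    (h : X = X') (h' : Y = Y') : eqToHom h ⊗ₘ eqToHom h' = eqToHom (by rw [h, h']) := by
  subst h h'; simp

lemma eqToHom_tensor_aux {E : Type u} [Category.{v} E] [MonoidalCategory E]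
    {A A' B B' P P' : E} (hA : A = A') (hB : B = B') (hP : P = A ⊗ B) (hP' : P' = A' ⊗ B')
    (h : P = P') : eqToHom h = eqToHom hP ≫ (eqToHom hA ⊗ₘ eqToHom hB) ≫ eqToHom hP'.symm := by
  subst hA hB hP hP'; simp

lemma eqToHom_aux {E : Type u} [Category.{v} E] {A B C D : E} (h : A = B) (h' : B = C)
    (h'' : C = D) (h₃ : A = D) : eqToHom h ≫ eqToHom h' ≫ eqToHom h'' = eqToHom h₃ := by
  subst h h' h''; simp

lemma comp_eqToHom_aux {E : Type u} [Category.{v} E] {A B C : E} (a : A ⟶ B) (h : B = C)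
    (h' : C = B) : a ≫ eqToHom h ≫ eqToHom h' = a := by
  subst h; simp

lemma eqToHom_comp_aux {E : Type u} [Category.{v} E] {A B A' B' : E} (a : A ⟶ B) (h : A = A')
    (h' : A' = A) (h₁ : B = B') (h₂ : B' = B) :
    eqToHom h ≫ (eqToHom h' ≫ a ≫ eqToHom h₁) ≫ eqToHom h₂ = a := by
  subst h h₁; simp

lemma comp_assoc_aux {E : Type u} [Category.{v} E] {A B C C' D D' D₂ : E} (a : A ⟶ B) (b : B ⟶ C)
    (h₁ : C = C') (h₂ : C' = C) (c : C ⟶ D) (h₃ : D = D') (h₄ : D' = D₂) {D₃ : E} (h₅ : D = D₃)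
    (h₆ : D₃ = D₂) :
    (a ≫ b ≫ eqToHom h₁) ≫ (eqToHom h₂ ≫ c ≫ eqToHom h₃) ≫ eqToHom h₄ =
      a ≫ (b ≫ c ≫ eqToHom h₅) ≫ eqToHom h₆ := by
  subst h₁ h₃ h₅ h₄; simp

lemma comp_tensor_aux {E : Type u} [Category.{v} E] [MonoidalCategory E]
    {A A' A'' A₃ B B' B'' B₃ P P' P'' P₃ : E} (a : A ⟶ A') (a' : A' ⟶ A'') (b : B ⟶ B')
    (b' : B' ⟶ B'') (hA : A'' = A₃) (hB : B'' = B₃) (hP : P = A ⊗ B) (hP' : P' = A' ⊗ B')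
    (hP'' : P'' = A'' ⊗ B'') (hP₃ : P₃ = A₃ ⊗ B₃) (h : P'' = P₃) :
    (eqToHom hP ≫ (a ⊗ₘ b) ≫ eqToHom hP'.symm) ≫
        (eqToHom hP' ≫ (a' ⊗ₘ b') ≫ eqToHom hP''.symm) ≫ eqToHom h =
      eqToHom hP ≫ ((a ≫ a' ≫ eqToHom hA) ⊗ₘ (b ≫ b' ≫ eqToHom hB)) ≫ eqToHom hP₃.symm := by
  subst hA hB hP hP' hP'' hP₃
  simp

variable {C : Type u₁} [Category.{v₁} C] [MonoidalCategory C] [CopyDiscardCategory C]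

lemma assign_obj (X : Net.{u} C) (n : VCat point.{u}) :
    X.assign.obj ((VCat.map X.graph.toPoint).obj n) =
      X.dist.obj ((vertexInclusion point).obj n) :=
  (congrArg (fun F => F.obj n) X.compat).symm

/-- Morphisms `(α, η, η')` of networks `(ω, G, τ) ⟶ (ω', G', τ')`: a morphism `α : G' ⟶ G`, a
monoidal transformation `η` from `τ` to `τ' ∘ VCat α`, and a distribution-preserving monoidal
transformation `η'` from `ω` to `ω'`, such that `η` and `η'` coincide on `VCat point`. -/
@[ext]
structure Hom (X Y : Net.{u} C) where
  α : Y.graph ⟶ X.graph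
  trans : MonoidalTransformation X.assign ((VCat.map α).comp Y.assign)
  distTrans : MonoidalTransformation X.dist.toSymFunctor Y.dist.toSymFunctor
  preserves : X.dist.map state ≫ distTrans.app pt =
    eqToHom (X.dist.obj_unit.trans Y.dist.obj_unit.symm) ≫ Y.dist.map state
  coincide : ∀ n : VCat point.{u},
    trans.app ((VCat.map X.graph.toPoint).obj n) ≍ distTrans.app ((vertexInclusion point).obj n)

/-- The identity morphism. -/
def Hom.id (X : Net.{u} C) : Hom X X where
  α := 𝟙 X.graph
  trans :=
    { app := fun L => eqToHom (congrArg X.assign.obj (VCat.map_id_obj L).symm)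
      app_unit := rfl
      app_tensor := fun L M => by
        exact eqToHom_tensor_aux _ _ _ (((VCat.map (𝟙 X.graph)).comp X.assign).obj_tensor L M) _ }
  distTrans :=
    { app := fun n => 𝟙 _
      app_unit := by simp
      app_tensor := by simp }
  preserves := by simp
  coincide n := (eqToHom_heq_id_dom _ _
    (congrArg X.assign.obj (VCat.map_id_obj _).symm)).trans (by rw [X.assign_obj n])

/-- Composition is component-wise. -/
def Hom.comp {X Y Z : Net.{u} C} (f : Hom X Y) (g : Hom Y Z) : Hom X Z where
  α := g.α ≫ f.α
  trans :=
    { app := fun L => f.trans.app L ≫ g.trans.app ((VCat.map f.α).obj L) ≫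
        eqToHom (congrArg Z.assign.obj (VCat.map_comp_obj g.α f.α L).symm)
      app_unit := by
        have h : g.trans.app ((VCat.map f.α).obj (𝟙_ _)) = _ := g.trans.app_unit
        have h' := f.trans.app_unit
        exact (congrArg₂ (fun x y => x ≫ y ≫ eqToHom _) h' h).trans 
          (eqToHom_aux _ _ _ _)
      app_tensor := fun L M => by
        have h : g.trans.app ((VCat.map f.α).obj (L ⊗ M)) =
            eqToHom (congrArg Y.assign.obj ((VCat.map f.α).obj_tensor L M)) ≫
              g.trans.app ((VCat.map f.α).obj L ⊗ (VCat.map f.α).obj M) ≫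
                eqToHom (congrArg ((VCat.map g.α).comp Z.assign).obj
                  ((VCat.map f.α).obj_tensor L M).symm) :=
          g.trans.app_congr ((VCat.map f.α).obj_tensor L M)
        rw [g.trans.app_tensor] at h
        simp only [Category.assoc, eqToHom_trans, eqToHom_trans_assoc] at h
        exact (congrArg₂ (fun x y => x ≫ y ≫ eqToHom _) (f.trans.app_tensor L M) h).trans
          (comp_tensor_aux _ _ _ _ _ _ _ _
            ((congrArg Z.assign.obj (congrArg _ ((VCat.map f.α).obj_tensor L M))).trans
              (((VCat.map g.α).comp Z.assign).obj_tensor _ _))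
            (((VCat.map (g.α ≫ f.α)).comp Z.assign).obj_tensor L M)
            (congrArg Z.assign.obj (VCat.map_comp_obj g.α f.α (L ⊗ M)).symm)) }
  distTrans :=
    { app := fun n => f.distTrans.app n ≫ g.distTrans.app n
      app_unit := by simp [f.distTrans.app_unit, g.distTrans.app_unit]
      app_tensor := by simp [f.distTrans.app_tensor, g.distTrans.app_tensor] }
  preserves := by
    rw [reassoc_of% f.preserves, g.preserves, eqToHom_trans_assoc]
  coincide n := by
    have hn : (VCat.map f.α).obj ((VCat.map X.graph.toPoint).obj n) =
        (VCat.map Y.graph.toPoint).obj n := (VCat.map_comp_obj f.α X.graph.toPoint n).symm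
    have h1 : ((VCat.map f.α).comp Y.assign).obj ((VCat.map X.graph.toPoint).obj n) = 
        Y.dist.obj ((vertexInclusion point).obj n) := (congrArg Y.assign.obj hn).trans (Y.assign_obj n)
    have h2 : ((VCat.map g.α).comp Z.assign).obj 
        ((VCat.map f.α).obj ((VCat.map X.graph.toPoint).obj n)) =
        Z.dist.obj ((vertexInclusion point).obj n) := by
      rw [hn]
      exact (congrArg Z.assign.obj (VCat.map_comp_obj g.α Y.graph.toPoint n).symm).trans
        (Z.assign_obj n)
    refine heq_comp (X.assign_obj n) h1 ?_ (f.coincide n) ?_ 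
    · exact (congrArg Z.assign.obj (VCat.map_comp_obj (g.α ≫ f.α) X.graph.toPoint n).symm).trans
        (Z.assign_obj n)
    refine (comp_eqToHom_heq _ _).trans ?_
    exact (g.trans.app_heq hn).trans (g.coincide n)

instance : Category (Net.{u} C) where
  Hom := Hom
  id := Hom.id
  comp := Hom.comp
  id_comp {X Y} f := by
    refine Hom.ext rfl (heq_of_eq ?_)
      (MonoidalTransformation.ext (funext fun n => Category.id_comp (f.distTrans.app n)))
    refine MonoidalTransformation.ext (G := (VCat.map f.α).comp Y.assign) (funext fun L => ?_)
    change eqToHom (congrArg X.assign.obj (VCat.map_id_obj L).symm) ≫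
      f.trans.app ((VCat.map (𝟙 X.graph)).obj L) ≫
        eqToHom (congrArg Y.assign.obj (VCat.map_comp_obj f.α (𝟙 X.graph) L).symm) = f.trans.app L
    rw [f.trans.app_congr (VCat.map_id_obj L)]
    exact eqToHom_comp_aux _ _ _ _ _
  comp_id {X Y} f := by
    refine Hom.ext rfl (heq_of_eq ?_)
      (MonoidalTransformation.ext (funext fun n => Category.comp_id (f.distTrans.app n)))
    refine MonoidalTransformation.ext (G := (VCat.map f.α).comp Y.assign) (funext fun L => ?_)
    exact comp_eqToHom_aux _
      (congrArg Y.assign.obj (VCat.map_id_obj ((VCat.map f.α).obj L)).symm)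
      (congrArg Y.assign.obj (VCat.map_comp_obj (𝟙 Y.graph) f.α L).symm)
  assoc {X Y Z W} f g h := by
    refine Hom.ext rfl (heq_of_eq (MonoidalTransformation.ext (funext fun L => ?_)))
      ((MonoidalTransformation.ext (funext fun n => Category.assoc _ _ _)))
    change (f.trans.app L ≫ g.trans.app ((VCat.map f.α).obj L) ≫ eqToHom _) ≫
      h.trans.app ((VCat.map (g.α ≫ f.α)).obj L) ≫ eqToHom _ = 
      f.trans.app L ≫ (g.trans.app ((VCat.map f.α).obj L) ≫ h.trans.app ((VCat.map g.α).obj ((VCat.map f.α).obj L)) ≫ eqToHom _) ≫ eqToHom _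
    rw [h.trans.app_congr (VCat.map_comp_obj g.α f.α L)]
    exact comp_assoc_aux _ _ _ _ _ _ _ _ _

end Net

/-- `(ω, G, τ)` is a Bayesian network: there is a CD-functor `F` from `CDSyn G` to the total
morphisms such that `τ` is the restriction of `F` to the vertices and `ω` is `F` after `!_G`. -/
def IsBayesian (C : Type u₁) [Category.{v₁} C] [MonoidalCategory C] [CopyDiscardCategory C] :
    ObjectProperty (Net.{u} C) := fun X =>
  ∃ F : CDFunctor (CDSyn X.graph) (Tot C),
    (vertexInclusion X.graph).toFunctor ⋙ F.toFunctor = X.assign.toFunctor ∧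
    (bang X.graph).toFunctor ⋙ F.toFunctor = X.dist.toFunctor

/-- `(ω, G, τ)` is a chordal network with respect to `q`: `G` is an ordered chordal graph and there
is a hypergraph functor `F` from `Syn G` such that, after normalisation, `τ` is the restriction of
`F` to the vertices and `ω` is `F` after `!_G`. -/
def IsChordalNet {C : Type u₁} [Category.{v₁} C] [MonoidalCategory C] [HypergraphCategory C]
    {D : Type u₂} [Category.{v₂} D] [MonoidalCategory D] [HypergraphCategory D]
    (q : HypergraphFunctor C D) : ObjectProperty (Net.{u} C) := fun X =>
  X.graph.IsChordal ∧ ∃ F : HypergraphFunctor (Syn X.graph) C,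
    (vertexInclusion X.graph).toFunctor ⋙ (star X.graph).toFunctor ⋙ F.toFunctor ⋙ q.toFunctor =
      X.assign.toFunctor ⋙ totLeg q ∧
    (bang X.graph).toFunctor ⋙ (star X.graph).toFunctor ⋙ F.toFunctor ⋙ q.toFunctor =
      X.dist.toFunctor ⋙ totLeg q

end

end PGM

/-! ### Finite sets and nonnegative matrices -/

namespace PGM

noncomputable section

/-- Finite sets whose elements are finite lists (of one length, so that concatenation is a
product) of elements of `U`: the objects of the strict versions of the categories of matrices. -/
structure NNMat (U : Type w) where
  len : ℕ
  carrier : Finset (List U)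
  length_eq : ∀ l ∈ carrier, l.length = len

namespace NNMat

variable {U : Type w}

lemma ext_obj {X Y : NNMat U} (h : X.len = Y.len) (h' : X.carrier = Y.carrier) : X = Y := by
  cases X; cases Y; cases h; cases h'; rfl

/-- The elements of the finite set. -/
abbrev El (X : NNMat U) : Type w := {l : List U // l ∈ X.carrier}

/-- Matrices with nonnegative entries; `f.entry y x` is written `f(y | x)`. -/
@[ext]
structure Hom (X Y : NNMat U) where
  entry : Y.El → X.El → ℝ≥0

open Classical in
/-- A function as a `0`-`1` matrix. -/
def ofFun {X Y : NNMat U} (h : X.El → Y.El) : Hom X Y where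
  entry y x := if y = h x then 1 else 0

instance : Category (NNMat U) where
  Hom := Hom
  id X := ofFun fun x => x
  comp f g := ⟨fun z x => ∑ y, g.entry z y * f.entry y x⟩
  id_comp f := by ext; simp [ofFun]
  comp_id f := by ext; simp [ofFun]
  assoc f g h := by
    ext w x
    simp only [Finset.mul_sum, Finset.sum_mul, _root_.mul_assoc]
    exact congrArg _ Finset.sum_comm

@[ext]
lemma hom_ext {X Y : NNMat U} {f g : X ⟶ Y} (h : ∀ y x, f.entry y x = g.entry y x) : f = g :=
  Hom.ext (funext fun y => funext fun x => h y x)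

lemma comp_entry {X Y Z : NNMat U} (f : X ⟶ Y) (g : Y ⟶ Z) (z : Z.El) (x : X.El) :
    (f ≫ g).entry z x = ∑ y, g.entry z y * f.entry y x := rfl

/-- A function as a morphism. -/
def fn {X Y : NNMat U} (h : X.El → Y.El) : X ⟶ Y := ofFun h

open Classical in
lemma fn_entry {X Y : NNMat U} (h : X.El → Y.El) (y : Y.El) (x : X.El) :
    (fn h).entry y x = if y = h x then 1 else 0 := rfl

lemma id_eq_fn (X : NNMat U) : 𝟙 X = fn fun x => x := rfl

lemma fn_comp_entry {X Y Z : NNMat U} (h : X.El → Y.El) (g : Y ⟶ Z) (z : Z.El) (x : X.El) :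
    (fn h ≫ g).entry z x = g.entry z (h x) := by
  simp [comp_entry, fn_entry]

lemma comp_fn_entry {X Y Z : NNMat U} (f : X ⟶ Y) (e : Y.El ≃ Z.El) (z : Z.El) (x : X.El) :
    (f ≫ fn e).entry z x = f.entry (e.symm z) x := by
  rw [comp_entry, Finset.sum_eq_single (e.symm z)]
  · simp [fn_entry]
  · intro y _ hy
    rw [fn_entry, if_neg (fun h => hy (by rw [h, Equiv.symm_apply_apply])), zero_mul]
  · simp

lemma fn_comp_fn {X Y Z : NNMat U} (h : X.El → Y.El) (k : Y.El → Z.El) :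
    fn h ≫ fn k = fn fun x => k (h x) := by
  ext z x
  rw [fn_comp_entry, fn_entry, fn_entry]

/-- The set with one element, the empty list. -/
def one : NNMat U where
  len := 0
  carrier := {[]}
  length_eq l hl := by
    rw [Finset.mem_singleton] at hl; rw [hl]; rfl

open Classical in
/-- The set of all concatenations. -/
def prod (X Y : NNMat U) : NNMat U where
  len := X.len + Y.len
  carrier := Finset.image₂ (· ++ ·) X.carrier Y.carrier
  length_eq l hl := by
    obtain ⟨a, ha, b, hb, rfl⟩ := Finset.mem_image₂.1 hl
    rw [List.length_append, X.length_eq a ha, Y.length_eq b hb]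

lemma prod_assoc (X Y Z : NNMat U) : prod (prod X Y) Z = prod X (prod Y Z) :=
  ext_obj (Nat.add_assoc _ _ _) (by
    classical exact Finset.image₂_assoc fun _ _ _ => List.append_assoc _ _ _)

lemma one_prod (X : NNMat U) : prod one X = X :=
  ext_obj (Nat.zero_add _) (by simp [prod, one])

lemma prod_one (X : NNMat U) : prod X one = X :=
  ext_obj (Nat.add_zero _) (by simp [prod, one])

/-- The element of the one-element set. -/
def nil : (one : NNMat U).El := ⟨[], Finset.mem_singleton_self _⟩

lemma eq_nil (x : (one : NNMat U).El) : x = nil := Subtype.ext (Finset.mem_singleton.1 x.2)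

section Pair

variable {X Y : NNMat U}

open Classical in
/-- Pairs are concatenations. -/
def pair (x : X.El) (y : Y.El) : (prod X Y).El :=
  ⟨x.1 ++ y.1, Finset.mem_image₂_of_mem x.2 y.2⟩

open Classical in
/-- The first component of a concatenation. -/
def fst (z : (prod X Y).El) : X.El :=
  ⟨z.1.take X.len, by
    obtain ⟨a, ha, b, hb, h⟩ := Finset.mem_image₂.1 z.2
    rw [← h, ← X.length_eq a ha, List.take_left]; exact ha⟩

open Classical in
/-- The second component of a concatenation. -/
def snd (z : (prod X Y).El) : Y.El :=
  ⟨z.1.drop X.len, by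
    obtain ⟨a, ha, b, hb, h⟩ := Finset.mem_image₂.1 z.2
    rw [← h, ← X.length_eq a ha, List.drop_left]; exact hb⟩

lemma fst_pair (x : X.El) (y : Y.El) : fst (pair x y) = x := by
  refine Subtype.ext ?_
  change (x.1 ++ y.1).take X.len = x.1
  rw [← X.length_eq x.1 x.2, List.take_left]

lemma snd_pair (x : X.El) (y : Y.El) : snd (pair x y) = y := by
  refine Subtype.ext ?_
  change (x.1 ++ y.1).drop X.len = y.1
  rw [← X.length_eq x.1 x.2, List.drop_left]

lemma pair_fst_snd (z : (prod X Y).El) : pair (fst z) (snd z) = z :=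
  Subtype.ext (List.take_append_drop _ _)

lemma exists_pair (z : (prod X Y).El) : ∃ x y, z = pair x y := ⟨_, _, (pair_fst_snd z).symm⟩

lemma pair_inj {x x' : X.El} {y y' : Y.El} : pair x y = pair x' y' ↔ x = x' ∧ y = y' := by
  refine ⟨fun h => ⟨?_, ?_⟩, fun h => by rw [h.1, h.2]⟩
  · rw [← fst_pair x y, h, fst_pair]
  · rw [← snd_pair x y, h, snd_pair]

/-- Concatenations are pairs. -/
def pairEquiv (X Y : NNMat U) : X.El × Y.El ≃ (prod X Y).El where
  toFun p := pair p.1 p.2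
  invFun z := (fst z, snd z)
  left_inv _ := Prod.ext (fst_pair _ _) (snd_pair _ _)
  right_inv z := pair_fst_snd z

lemma sum_prod (F : (prod X Y).El → ℝ≥0) : ∑ z, F z = ∑ x : X.El, ∑ y : Y.El, F (pair x y) := by
  rw [← (pairEquiv X Y).sum_comp, Fintype.sum_prod_type]; rfl

end Pair

/-- The tensor product of matrices: `(f ⊗ g)(y, y' | x, x') = f(y | x) g(y' | x')`. -/
def tensorMap {X Y X' Y' : NNMat U} (f : X ⟶ Y) (g : X' ⟶ Y') : prod X X' ⟶ prod Y Y' :=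
  Hom.mk fun y x => f.entry (fst y) (fst x) * g.entry (snd y) (snd x)

/-- The identity function between equal sets. -/
def castEl {X Y : NNMat U} (h : X = Y) (x : X.El) : Y.El := ⟨x.1, h ▸ x.2⟩

/-- The identity between equal sets. -/
def castIso {X Y : NNMat U} (h : X = Y) : X ≅ Y where
  hom := fn (castEl h)
  inv := fn (castEl h.symm)
  hom_inv_id := by cases h; exact Category.id_comp _
  inv_hom_id := by cases h; exact Category.id_comp _

lemma castIso_hom {X Y : NNMat U} (h : X = Y) : (castIso h).hom = eqToHom h := by
  cases h; rfl

instance : MonoidalCategoryStruct (NNMat U) where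
  tensorObj := prod
  whiskerLeft X _ _ f := tensorMap (𝟙 X) f
  whiskerRight f X := tensorMap f (𝟙 X)
  tensorHom f g := tensorMap f g
  tensorUnit := one
  associator X Y Z := castIso (prod_assoc X Y Z)
  leftUnitor X := castIso (one_prod X)
  rightUnitor X := castIso (prod_one X)

lemma tensor_entry {X Y X' Y' : NNMat U} (f : X ⟶ Y) (g : X' ⟶ Y') (y : (prod Y Y').El)
    (x : (prod X X').El) :
    (f ⊗ₘ g).entry y x = f.entry (fst y) (fst x) * g.entry (snd y) (snd x) := rfl

open Classical in
lemma fn_tensor_fn {X Y X' Y' : NNMat U} (h : X.El → Y.El) (k : X'.El → Y'.El) :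
    fn h ⊗ₘ fn k = fn (X := prod X X') (Y := prod Y Y') fun z => pair (h (fst z)) (k (snd z)) := by
  refine hom_ext fun y x => ?_
  obtain ⟨y, y', rfl⟩ := exists_pair y
  obtain ⟨x, x', rfl⟩ := exists_pair x
  have e : (fn (X := prod X X') (Y := prod Y Y')
      fun z => pair (h (fst z)) (k (snd z))).entry (pair y y') (pair x x') =
      if y = h x ∧ y' = k x' then 1 else 0 := by
    rw [fn_entry, fst_pair, snd_pair]
    simp only [pair_inj]
  refine Eq.trans ?_ e.symm
  rw [tensor_entry]
  simp only [fn_entry, fst_pair, snd_pair, pair_inj]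
  by_cases h1 : y = h x <;> by_cases h2 : y' = k x' <;> simp [h1, h2]

lemma tensor_id' (X Y : NNMat U) : (𝟙 X) ⊗ₘ (𝟙 Y) = 𝟙 (X ⊗ Y) := by
  rw [id_eq_fn, id_eq_fn, fn_tensor_fn]
  simp only [pair_fst_snd]
  rfl

lemma tensor_comp' {X Y Z X' Y' Z' : NNMat U} (f : X ⟶ Y) (f' : X' ⟶ Y') (g : Y ⟶ Z)
    (g' : Y' ⟶ Z') : (f ⊗ₘ f') ≫ (g ⊗ₘ g') = (f ≫ g) ⊗ₘ (f' ≫ g') := by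
  refine hom_ext fun z x => ?_
  rw [comp_entry, tensor_entry]
  erw [sum_prod]
  simp only [tensor_entry, comp_entry, Finset.sum_mul_sum, fst_pair, snd_pair]
  exact Finset.sum_congr rfl fun _ _ => Finset.sum_congr rfl fun _ _ => by ring

lemma eqToHom_tensor {X Y : NNMat U} (h : X = Y) (Z : NNMat U) :
    eqToHom h ⊗ₘ 𝟙 Z = eqToHom (congrArg (· ⊗ Z) h) := by
  cases h; exact tensor_id' _ _

lemma tensor_eqToHom {X Y : NNMat U} (h : X = Y) (Z : NNMat U) :
    𝟙 Z ⊗ₘ eqToHom h = eqToHom (congrArg (Z ⊗ ·) h) := by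
  cases h; exact tensor_id' _ _

lemma tensor_assoc' (X Y Z : NNMat U) : (X ⊗ Y) ⊗ Z = X ⊗ (Y ⊗ Z) := prod_assoc X Y Z

lemma unit_tensor' (X : NNMat U) : 𝟙_ (NNMat U) ⊗ X = X := one_prod X

lemma tensor_unit' (X : NNMat U) : X ⊗ 𝟙_ (NNMat U) = X := prod_one X

lemma associator_eq' (X Y Z : NNMat U) : (α_ X Y Z).hom = eqToHom (tensor_assoc' X Y Z) :=
  castIso_hom _

lemma leftUnitor_eq' (X : NNMat U) : (λ_ X).hom = eqToHom (unit_tensor' X) := castIso_hom _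

lemma rightUnitor_eq' (X : NNMat U) : (ρ_ X).hom = eqToHom (tensor_unit' X) := castIso_hom _

lemma castEl_assoc {X Y Z : NNMat U} (x : X.El) (y : Y.El) (z : Z.El) :
    castEl (prod_assoc X Y Z) (pair (pair x y) z) = pair x (pair y z) :=
  Subtype.ext (List.append_assoc _ _ _)

lemma castEl_assoc_symm {X Y Z : NNMat U} (x : X.El) (y : Y.El) (z : Z.El) :
    castEl (prod_assoc X Y Z).symm (pair x (pair y z)) = pair (pair x y) z :=
  Subtype.ext (List.append_assoc _ _ _).symm

lemma castEl_one_prod {X : NNMat U} (x : X.El) : castEl (one_prod X) (pair nil x) = x :=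
  Subtype.ext (List.nil_append _)

lemma castEl_one_prod_symm {X : NNMat U} (x : X.El) : castEl (one_prod X).symm x = pair nil x :=
  Subtype.ext (List.nil_append _).symm

lemma castEl_prod_one {X : NNMat U} (x : X.El) : castEl (prod_one X) (pair x nil) = x :=
  Subtype.ext (List.append_nil _)

lemma castEl_prod_one_symm {X : NNMat U} (x : X.El) : castEl (prod_one X).symm x = pair x nil :=
  Subtype.ext (List.append_nil _).symm

/-- `castEl` as a bijection. -/
def castEquiv {X Y : NNMat U} (h : X = Y) : X.El ≃ Y.El where
  toFun := castEl h
  invFun := castEl h.symm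
  left_inv _ := rfl
  right_inv _ := rfl

lemma comp_fn_cast_entry {X Y Z : NNMat U} (f : X ⟶ Y) (h : Y = Z) (z : Z.El) (x : X.El) :
    (f ≫ fn (castEl h)).entry z x = f.entry (castEl h.symm z) x :=
  comp_fn_entry f (castEquiv h) z x

instance : MonoidalCategory (NNMat U) :=
  MonoidalCategory.ofTensorHom
    (id_tensorHom_id := tensor_id')
    (id_tensorHom := fun _ _ _ _ => rfl)
    (tensorHom_id := fun _ _ => rfl)
    (tensorHom_comp_tensorHom := fun f g f' g' => tensor_comp' f g f' g')
    (associator_naturality := fun {X X' X'' Y Y' Y''} f g h => by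
      refine hom_ext fun y x => ?_
      obtain ⟨y, y', rfl⟩ := exists_pair y
      obtain ⟨y', y'', rfl⟩ := exists_pair y'
      obtain ⟨x, x'', rfl⟩ := exists_pair x
      obtain ⟨x, x', rfl⟩ := exists_pair x
      refine (comp_fn_cast_entry _ _ _ _).trans (Eq.trans ?_ (fn_comp_entry _ _ _ _).symm)
      rw [castEl_assoc, castEl_assoc_symm]
      simp only [tensor_entry, fst_pair, snd_pair, _root_.mul_assoc])
    (leftUnitor_naturality := fun {X Y} f => by
      refine hom_ext fun y x => ?_
      obtain ⟨n, x, rfl⟩ := exists_pair x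
      refine (comp_fn_cast_entry _ _ _ _).trans (Eq.trans ?_ (fn_comp_entry _ _ _ _).symm)
      obtain rfl := eq_nil n
      rw [castEl_one_prod, castEl_one_prod_symm]
      simp [tensor_entry, fst_pair, snd_pair, id_eq_fn, fn_entry])
    (rightUnitor_naturality := fun {X Y} f => by
      refine hom_ext fun y x => ?_
      obtain ⟨x, n, rfl⟩ := exists_pair x
      refine (comp_fn_cast_entry _ _ _ _).trans (Eq.trans ?_ (fn_comp_entry _ _ _ _).symm)
      obtain rfl := eq_nil n
      rw [castEl_prod_one, castEl_prod_one_symm]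
      simp [tensor_entry, fst_pair, snd_pair, id_eq_fn, fn_entry])
    (pentagon := fun W X Y Z => by
      simp only [associator_eq', eqToHom_tensor, tensor_eqToHom, eqToHom_trans])
    (triangle := fun X Y => by
      simp only [associator_eq', leftUnitor_eq', rightUnitor_eq', eqToHom_tensor, tensor_eqToHom,
        eqToHom_trans])

instance : StrictMonoidal (NNMat U) where
  tensor_assoc := tensor_assoc'
  unit_tensor := unit_tensor'
  tensor_unit := tensor_unit'
  associator_eq := associator_eq'
  leftUnitor_eq := leftUnitor_eq'
  rightUnitor_eq := rightUnitor_eq'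

/-- The exchange of the components. -/
def swap {X Y : NNMat U} (z : (prod X Y).El) : (prod Y X).El := pair (snd z) (fst z)

lemma swap_pair {X Y : NNMat U} (x : X.El) (y : Y.El) : swap (pair x y) = pair y x := by
  rw [swap, fst_pair, snd_pair]

lemma swap_swap {X Y : NNMat U} (z : (prod X Y).El) : swap (swap z) = z := by
  obtain ⟨x, y, rfl⟩ := exists_pair z
  rw [swap_pair, swap_pair]

lemma whiskerLeft_fn (X : NNMat U) {Y Z : NNMat U} (h : Y.El → Z.El) :
    X ◁ fn h = fn (X := prod X Y) (Y := prod X Z) fun z => pair (fst z) (h (snd z)) :=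
  fn_tensor_fn _ _

lemma fn_whiskerRight {Y Z : NNMat U} (h : Y.El → Z.El) (X : NNMat U) :
    fn h ▷ X = fn (X := prod Y X) (Y := prod Z X) fun z => pair (h (fst z)) (snd z) :=
  fn_tensor_fn _ _

lemma fn_congr {X Y : NNMat U} {h k : X.El → Y.El} (e : ∀ x, h x = k x) : fn h = fn k :=
  congrArg fn (funext e)

lemma fn_congr_pair {X Y Z : NNMat U} {h k : (prod X Y).El → Z.El}
    (e : ∀ x y, h (pair x y) = k (pair x y)) : fn h = fn k :=
  fn_congr fun z => by
    obtain ⟨x, y, rfl⟩ := exists_pair z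
    exact e x y

lemma associator_hom_fn (X Y Z : NNMat U) : (α_ X Y Z).hom = fn (castEl (prod_assoc X Y Z)) := rfl

lemma associator_inv_fn (X Y Z : NNMat U) :
    (α_ X Y Z).inv = fn (castEl (prod_assoc X Y Z).symm) := rfl

lemma leftUnitor_hom_fn (X : NNMat U) : (λ_ X).hom = fn (castEl (one_prod X)) := rfl

lemma leftUnitor_inv_fn (X : NNMat U) : (λ_ X).inv = fn (castEl (one_prod X).symm) := rfl

lemma rightUnitor_hom_fn (X : NNMat U) : (ρ_ X).hom = fn (castEl (prod_one X)) := rfl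

lemma rightUnitor_inv_fn (X : NNMat U) : (ρ_ X).inv = fn (castEl (prod_one X).symm) := rfl

lemma swap_natural {X X' Y Y' : NNMat U} (f : X ⟶ Y) (g : X' ⟶ Y') :
    (f ⊗ₘ g) ≫ fn (X := prod Y Y') (Y := prod Y' Y) swap =
      fn (X := prod X X') (Y := prod X' X) swap ≫ (g ⊗ₘ f) := by
  refine hom_ext fun y x => ?_
  obtain ⟨y, y', rfl⟩ := exists_pair y
  obtain ⟨x, x', rfl⟩ := exists_pair x
  refine (comp_fn_entry (Y := prod Y Y') (Z := prod Y' Y) _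
    ⟨swap, swap, swap_swap, swap_swap⟩ _ _).trans (Eq.trans ?_ (fn_comp_entry _ _ _ _).symm)
  change (f ⊗ₘ g).entry (swap (pair y y')) _ = _
  rw [swap_pair, swap_pair, tensor_entry, tensor_entry]
  simp only [fst_pair, snd_pair]
  exact mul_comm _ _

instance : SymmetricCategory (NNMat U) where
  braiding X Y :=
    { hom := fn (X := prod X Y) (Y := prod Y X) swap
      inv := fn (X := prod Y X) (Y := prod X Y) swap
      hom_inv_id := by
        refine (fn_comp_fn _ _).trans (fn_congr swap_swap)
      inv_hom_id := by
        refine (fn_comp_fn _ _).trans (fn_congr swap_swap) }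
  braiding_naturality_right X Y Z f := swap_natural (𝟙 X) f
  braiding_naturality_left f Z := swap_natural f (𝟙 Z)
  hexagon_forward X Y Z := by
    simp only [associator_hom_fn, whiskerLeft_fn, fn_whiskerRight, fn_comp_fn]
    refine fn_congr_pair (X := prod X Y) fun w z => ?_
    obtain ⟨x, y, rfl⟩ := exists_pair w
    simp only [castEl_assoc, swap_pair, fst_pair, snd_pair]
  hexagon_reverse X Y Z := by
    simp only [associator_inv_fn, whiskerLeft_fn, fn_whiskerRight, fn_comp_fn]
    refine fn_congr_pair (Y := prod Y Z) fun x w => ?_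
    obtain ⟨y, z, rfl⟩ := exists_pair w
    simp only [castEl_assoc_symm, swap_pair, fst_pair, snd_pair]
  symmetry X Y := (fn_comp_fn _ _).trans (fn_congr swap_swap)

lemma braiding_hom_fn (X Y : NNMat U) :
    (β_ X Y).hom = fn (X := prod X Y) (Y := prod Y X) swap := rfl

/-- Copy and delete: `copy(y, z | x) = 1` if `x = y = z` and `0` otherwise, and `del( | x) = 1`. -/
@[reducible]
def comon (X : NNMat U) : ComonObj X where
  counit := fn (Y := one) fun _ => nil
  comul := fn (Y := prod X X) fun x => pair x x
  counit_comul := by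
    simp only [leftUnitor_inv_fn, fn_whiskerRight, fn_comp_fn]
    refine fn_congr fun x => ?_
    simp only [castEl_one_prod_symm, fst_pair, snd_pair]
  comul_counit := by
    simp only [rightUnitor_inv_fn, whiskerLeft_fn, fn_comp_fn]
    refine fn_congr fun x => ?_
    simp only [castEl_prod_one_symm, fst_pair, snd_pair]
  comul_assoc := by
    simp only [associator_hom_fn, whiskerLeft_fn, fn_whiskerRight, fn_comp_fn]
    refine fn_congr fun x => ?_
    simp only [castEl_assoc, fst_pair, snd_pair]

instance : CopyDiscardCategory (NNMat U) where
  comonObj X := comon X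
  isCommComonObj X := by
    let := comon X
    refine ⟨?_⟩
    refine (fn_comp_fn _ _).trans (fn_congr fun x => swap_pair _ _)
  copy_tensor X Y := by
    change fn (Y := prod (prod X Y) (prod X Y)) (fun x => pair x x) =
      (fn (Y := prod X X) (fun x => pair x x) ⊗ₘ fn (Y := prod Y Y) (fun y => pair y y)) ≫
        tensorμ X X Y Y
    simp only [tensorμ, associator_hom_fn, associator_inv_fn, braiding_hom_fn, fn_tensor_fn,
      whiskerLeft_fn, fn_whiskerRight, fn_comp_fn]
    refine fn_congr_pair fun x y => ?_
    simp only [castEl_assoc, castEl_assoc_symm, swap_pair, fst_pair, snd_pair]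
  discard_tensor X Y := by
    change fn (X := prod X Y) (Y := one) (fun _ => nil) =
      (fn (X := X) (Y := one) (fun _ => nil) ⊗ₘ fn (X := Y) (Y := one) (fun _ => nil)) ≫
        (λ_ (𝟙_ (NNMat U))).hom
    simp only [leftUnitor_hom_fn, fn_tensor_fn, fn_comp_fn]
    refine fn_congr_pair fun x y => ?_
    simp only [castEl_one_prod]
  copy_unit := by
    refine fn_congr fun x => ?_
    rw [castEl_one_prod_symm, ← eq_nil x]
  discard_unit := by
    refine fn_congr fun x => ?_
    rw [← eq_nil x]

/-- The transposed matrix. -/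
def transpose {X Y : NNMat U} (f : X ⟶ Y) : Y ⟶ X := Hom.mk fun x y => f.entry y x

lemma transpose_entry {X Y : NNMat U} (f : X ⟶ Y) (x : X.El) (y : Y.El) :
    (transpose f).entry x y = f.entry y x := rfl

lemma transpose_comp {X Y Z : NNMat U} (f : X ⟶ Y) (g : Y ⟶ Z) :
    transpose (f ≫ g) = transpose g ≫ transpose f := by
  refine hom_ext fun x z => ?_
  simp only [transpose_entry, comp_entry]
  exact Finset.sum_congr rfl fun _ _ => mul_comm _ _

lemma transpose_tensor {X Y X' Y' : NNMat U} (f : X ⟶ Y) (g : X' ⟶ Y') :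
    transpose (f ⊗ₘ g) = transpose f ⊗ₘ transpose g := rfl

open Classical in
lemma transpose_iso {X Y : NNMat U} (e : X.El ≃ Y.El) : transpose (fn e) = fn e.symm := by
  refine hom_ext fun x y => ?_
  rw [transpose_entry, fn_entry, fn_entry]
  refine if_congr ?_ rfl rfl
  rw [Equiv.eq_symm_apply, eq_comm]

lemma transpose_cast {X Y : NNMat U} (h : X = Y) :
    transpose (fn (castEl h)) = fn (castEl h.symm) := transpose_iso (castEquiv h)

lemma transpose_swap (X Y : NNMat U) : transpose (β_ X Y).hom = (β_ Y X).hom :=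
  transpose_iso (X := prod X Y) (Y := prod Y X) ⟨swap, swap, swap_swap, swap_swap⟩

lemma transpose_id (X : NNMat U) : transpose (𝟙 X) = 𝟙 X := transpose_iso (Equiv.refl _)

lemma transpose_whiskerLeft (X : NNMat U) {Y Z : NNMat U} (f : Y ⟶ Z) :
    transpose (X ◁ f) = X ◁ transpose f := by
  rw [← id_tensorHom, ← id_tensorHom, transpose_tensor, transpose_id]

lemma transpose_whiskerRight {Y Z : NNMat U} (f : Y ⟶ Z) (X : NNMat U) :
    transpose (f ▷ X) = transpose f ▷ X := by
  rw [← tensorHom_id, ← tensorHom_id, transpose_tensor, transpose_id]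

lemma transpose_associator_hom (X Y Z : NNMat U) : transpose (α_ X Y Z).hom = (α_ X Y Z).inv :=
  transpose_cast _

lemma transpose_associator_inv (X Y Z : NNMat U) : transpose (α_ X Y Z).inv = (α_ X Y Z).hom :=
  transpose_cast _

lemma transpose_leftUnitor_hom (X : NNMat U) : transpose (λ_ X).hom = (λ_ X).inv :=
  transpose_cast _

lemma transpose_leftUnitor_inv (X : NNMat U) : transpose (λ_ X).inv = (λ_ X).hom :=
  transpose_cast _

lemma transpose_rightUnitor_inv (X : NNMat U) : transpose (ρ_ X).inv = (ρ_ X).hom :=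
  transpose_cast _

/-- Compare and omni: `compare(z | x, y) = 1` if `x = y = z` and `0` otherwise, and
`omni(x | ) = 1`. -/
@[reducible]
def mon (X : NNMat U) : MonObj X where
  one := transpose ε[X]
  mul := transpose Δ[X]
  one_mul := by
    rw [← transpose_whiskerRight, ← transpose_comp, counit_comul, transpose_leftUnitor_inv]
  mul_one := by
    rw [← transpose_whiskerLeft, ← transpose_comp, comul_counit, transpose_rightUnitor_inv]
  mul_assoc := by
    rw [← transpose_whiskerRight, ← transpose_whiskerLeft, ← transpose_comp, ← transpose_comp,
      ← transpose_associator_inv, ← transpose_comp, comul_assoc_flip]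
    simp

lemma transpose_tensorμ (X Y Z W : NNMat U) :
    transpose (tensorμ X Y Z W) = tensorμ X Z Y W := by
  simp only [tensorμ, transpose_comp, transpose_whiskerLeft, transpose_whiskerRight,
    transpose_swap, transpose_associator_hom, transpose_associator_inv, Category.assoc]

open Classical in
lemma copy_entry (X : NNMat U) (y z x : X.El) :
    (Δ[X]).entry (pair y z) x = if y = x ∧ z = x then 1 else 0 := by
  refine (fn_entry _ _ _).trans (if_congr ?_ rfl rfl)
  exact pair_inj

open Classical in
lemma transpose_copy_comp_copy (X : NNMat U) (a b x y : X.El) :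
    (transpose Δ[X] ≫ Δ[X]).entry (pair a b) (pair x y) =
      if a = b ∧ x = y ∧ a = x then 1 else 0 := by
  rw [comp_entry, Finset.sum_eq_single a]
  · rw [copy_entry, transpose_entry, copy_entry]
    by_cases h1 : a = b <;> by_cases h2 : x = y <;> by_cases h3 : a = x <;>
      simp_all [eq_comm]
  · intro c _ hc
    rw [copy_entry, if_neg (fun h => hc h.1.symm), zero_mul]
  · simp

lemma transpose_copy_tensor (X Y : NNMat U) :
    transpose (CopyDiscardCategory.comonObj (X ⊗ Y)).comul = tensorμ X Y X Y ≫ (transpose Δ[X] ⊗ₘ transpose Δ[Y]) := by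
  rw [CopyDiscardCategory.copy_tensor, transpose_comp, transpose_tensor, transpose_tensorμ]

lemma transpose_discard_tensor (X Y : NNMat U) :
    transpose (CopyDiscardCategory.comonObj (X ⊗ Y)).counit = (λ_ (𝟙_ (NNMat U))).inv ≫ (transpose ε[X] ⊗ₘ transpose ε[Y]) := by
  rw [CopyDiscardCategory.discard_tensor, transpose_comp, transpose_tensor,
    transpose_leftUnitor_hom]

instance : HypergraphCategory (NNMat U) where
  monObj X := mon X
  isCommMonObj X := by
    let := mon X
    refine ⟨?_⟩
    change (β_ X X).hom ≫ transpose Δ[X] = transpose Δ[X]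
    rw [← transpose_swap, ← transpose_comp, IsCommComonObj.comul_comm]
  compare_tensor X Y := transpose_copy_tensor X Y
  omni_tensor X Y := transpose_discard_tensor X Y
  compare_unit := by
    change transpose Δ[𝟙_ (NNMat U)] = _
    rw [CopyDiscardCategory.copy_unit, transpose_leftUnitor_inv]
  omni_unit := by
    change transpose ε[𝟙_ (NNMat U)] = _
    rw [CopyDiscardCategory.discard_unit, transpose_id]
  special X := by
    change Δ[X] ≫ transpose Δ[X] = 𝟙 X
    refine hom_ext fun y x => (fn_comp_entry _ _ _ _).trans ?_
    rw [transpose_entry, id_eq_fn, fn_entry]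
    refine (copy_entry X x x y).trans ?_
    by_cases h : x = y
    · simp [h]
    · simp [h, Ne.symm h]
  frobenius_left X := by
    change (Δ[X] ▷ X) ≫ (α_ X X X).hom ≫ (X ◁ transpose Δ[X]) = transpose Δ[X] ≫ Δ[X]
    refine hom_ext fun c z => ?_
    obtain ⟨a, b, rfl⟩ := exists_pair c
    obtain ⟨x, y, rfl⟩ := exists_pair z
    refine Eq.trans ?_ (transpose_copy_comp_copy X a b x y).symm
    refine (congrArg (fun f => (f ≫ (α_ X X X).hom ≫ (X ◁ transpose Δ[X])).entry (pair a b)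
      (pair x y)) (fn_whiskerRight (Z := prod X X) (fun x => pair x x) X)).trans ?_
    refine (fn_comp_entry _ _ _ _).trans ((fn_comp_entry _ _ _ _).trans ?_)
    rw [fst_pair, snd_pair, castEl_assoc, ← id_tensorHom, tensor_entry, transpose_entry]
    simp only [fst_pair, snd_pair, copy_entry, id_eq_fn, fn_entry]
    by_cases h1 : a = b <;> by_cases h2 : x = y <;> by_cases h3 : a = x <;>
      simp_all [eq_comm]
  frobenius_right X := by
    change (X ◁ Δ[X]) ≫ (α_ X X X).inv ≫ (transpose Δ[X] ▷ X) = transpose Δ[X] ≫ Δ[X]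
    refine hom_ext fun c z => ?_
    obtain ⟨a, b, rfl⟩ := exists_pair c
    obtain ⟨x, y, rfl⟩ := exists_pair z
    refine Eq.trans ?_ (transpose_copy_comp_copy X a b x y).symm
    refine (congrArg (fun f => (f ≫ (α_ X X X).inv ≫ (transpose Δ[X] ▷ X)).entry (pair a b)
      (pair x y)) (whiskerLeft_fn X (Z := prod X X) (fun x => pair x x))).trans ?_
    refine (fn_comp_entry _ _ _ _).trans ((fn_comp_entry _ _ _ _).trans ?_)
    rw [fst_pair, snd_pair, castEl_assoc_symm, ← tensorHom_id, tensor_entry, transpose_entry]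
    simp only [fst_pair, snd_pair, copy_entry, id_eq_fn, fn_entry]
    by_cases h1 : a = b <;> by_cases h2 : x = y <;> by_cases h3 : a = x <;>
      simp_all [eq_comm]

end NNMat

end

end PGM

/-! ### Matrices up to a positive factor -/

namespace PGM

noncomputable section

variable {U : Type w}

/-- Two matrices are proportional if they differ by a global positive factor. -/
def Proportional {X Y : NNMat U} (f g : X ⟶ Y) : Prop :=
  ∃ c : ℝ≥0, 0 < c ∧ ∀ y x, c * f.entry y x = g.entry y x

lemma proportional_refl {X Y : NNMat U} (f : X ⟶ Y) : Proportional f f :=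
  ⟨1, one_pos, fun _ _ => _root_.one_mul _⟩

lemma Proportional.symm {X Y : NNMat U} {f g : X ⟶ Y} : Proportional f g → Proportional g f := by
  rintro ⟨c, hc, h⟩
  exact ⟨c⁻¹, inv_pos.2 hc, fun y x => by rw [← h, inv_mul_cancel_left₀ hc.ne']⟩

lemma Proportional.trans {X Y : NNMat U} {f g h : X ⟶ Y} :
    Proportional f g → Proportional g h → Proportional f h := by
  rintro ⟨c, hc, h⟩ ⟨d, hd, h'⟩
  exact ⟨d * c, mul_pos hd hc, fun y x => by rw [← h', ← h, _root_.mul_assoc]⟩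

lemma Proportional.comp {X Y Z : NNMat U} {f f' : X ⟶ Y} {g g' : Y ⟶ Z} :
    Proportional f f' → Proportional g g' → Proportional (f ≫ g) (f' ≫ g') := by
  rintro ⟨c, hc, h⟩ ⟨d, hd, h'⟩
  refine ⟨c * d, mul_pos hc hd, fun z x => ?_⟩
  rw [NNMat.comp_entry, NNMat.comp_entry, Finset.mul_sum]
  exact Finset.sum_congr rfl fun y _ => by rw [← h, ← h']; ring

lemma Proportional.tensor {X Y X' Y' : NNMat U} {f f' : X ⟶ Y} {g g' : X' ⟶ Y'} :
    Proportional f f' → Proportional g g' → Proportional (f ⊗ₘ g) (f' ⊗ₘ g') := by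
  rintro ⟨c, hc, h⟩ ⟨d, hd, h'⟩
  refine ⟨c * d, mul_pos hc hd, fun z x => ?_⟩
  rw [NNMat.tensor_entry, NNMat.tensor_entry, ← h, ← h']
  ring

/-- The setoid of proportionality. -/
def propSetoid (X Y : NNMat U) : Setoid (X ⟶ Y) where
  r := Proportional
  iseqv := ⟨proportional_refl, Proportional.symm, Proportional.trans⟩

/-- The category of matrices up to a global positive factor. -/
def FinProjStoch (U : Type w) : Type w := NNMat U

namespace FinProjStoch

/-- Proportionality classes of matrices. -/
def Hom (X Y : NNMat U) : Type w := Quotient (propSetoid X Y)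

/-- The class of a matrix. -/
def cls {X Y : NNMat U} (f : X ⟶ Y) : Hom X Y := Quotient.mk (propSetoid X Y) f

lemma cls_eq_iff {X Y : NNMat U} (f g : X ⟶ Y) : cls f = cls g ↔ Proportional f g :=
  ⟨fun h => Quotient.exact h, fun h => Quotient.sound (s := propSetoid X Y) h⟩

/-- The composition of proportionality classes. -/
def compCls {X Y Z : NNMat U} : Hom X Y → Hom Y Z → Hom X Z :=
  Quotient.map₂ (fun (f : X ⟶ Y) (g : Y ⟶ Z) => f ≫ g)
    (fun f f' (h : Proportional f f') g g' (h' : Proportional g g') => h.comp h')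

/-- The tensor product of proportionality classes. -/
def tensorCls {X Y X' Y' : NNMat U} : Hom X Y → Hom X' Y' → Hom (X ⊗ X') (Y ⊗ Y') :=
  Quotient.map₂ (fun (f : X ⟶ Y) (g : X' ⟶ Y') => f ⊗ₘ g)
    (fun f f' (h : Proportional f f') g g' (h' : Proportional g g') => h.tensor h')

instance : Category (FinProjStoch U) where
  Hom := Hom
  id X := cls (𝟙 (show NNMat U from X))
  comp f g := compCls f g
  id_comp := by rintro X Y ⟨f⟩; exact congrArg cls (Category.id_comp f)
  comp_id := by rintro X Y ⟨f⟩; exact congrArg cls (Category.comp_id f)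
  assoc := by rintro X Y Z W ⟨f⟩ ⟨g⟩ ⟨h⟩; exact congrArg cls (Category.assoc f g h)

/-- The quotient functor. -/
def quot (U : Type w) : NNMat U ⥤ FinProjStoch U where
  obj X := X
  map f := cls f

instance : MonoidalCategoryStruct (FinProjStoch U) where
  tensorObj X Y := tensorObj (C := NNMat U) X Y
  tensorHom f g := tensorCls f g
  whiskerLeft X _ _ g := tensorCls (cls (𝟙 (show NNMat U from X))) g
  whiskerRight f X := tensorCls f (cls (𝟙 (show NNMat U from X)))
  tensorUnit := 𝟙_ (NNMat U)
  associator X Y Z := (quot U).mapIso (α_ (show NNMat U from X) (show NNMat U from Y) (show NNMat U from Z))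
  leftUnitor X := (quot U).mapIso (λ_ (show NNMat U from X))
  rightUnitor X := (quot U).mapIso (ρ_ (show NNMat U from X))

instance : MonoidalCategory (FinProjStoch U) :=
  MonoidalCategory.ofTensorHom
    (id_tensorHom_id := fun X Y =>
      congrArg cls (id_tensorHom_id (show NNMat U from X) (show NNMat U from Y)))
    (id_tensorHom := fun _ _ _ _ => rfl)
    (tensorHom_id := fun _ _ => rfl)
    (tensorHom_comp_tensorHom := by
      rintro _ _ _ _ _ _ ⟨f⟩ ⟨f'⟩ ⟨g⟩ ⟨g'⟩
      exact congrArg cls (tensorHom_comp_tensorHom f f' g g'))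
    (associator_naturality := by
      rintro _ _ _ _ _ _ ⟨f⟩ ⟨g⟩ ⟨h⟩; exact congrArg cls (associator_naturality f g h))
    (leftUnitor_naturality := by
      rintro X Y ⟨f⟩
      exact congrArg cls ((congrArg (· ≫ _) (id_tensorHom _ f)).trans (leftUnitor_naturality f)))
    (rightUnitor_naturality := by
      rintro X Y ⟨f⟩
      exact congrArg cls ((congrArg (· ≫ _) (tensorHom_id f _)).trans (rightUnitor_naturality f)))
    (pentagon := fun W X Y Z => congrArg cls (pentagon (C := NNMat U) W X Y Z))
    (triangle := fun X Y => congrArg cls (triangle (C := NNMat U) X Y))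

lemma quot_eqToHom {X Y : NNMat U} (h : X = Y) :
    (quot U).map (eqToHom h) = eqToHom (congrArg (quot U).obj h) := eqToHom_map _ _

instance : StrictMonoidal (FinProjStoch U) where
  tensor_assoc := StrictMonoidal.tensor_assoc (C := NNMat U)
  unit_tensor := StrictMonoidal.unit_tensor (C := NNMat U)
  tensor_unit := StrictMonoidal.tensor_unit (C := NNMat U)
  associator_eq X Y Z :=
    (congrArg cls (StrictMonoidal.associator_eq (C := NNMat U) X Y Z)).trans (quot_eqToHom _)
  leftUnitor_eq X :=
    (congrArg cls (StrictMonoidal.leftUnitor_eq (C := NNMat U) X)).trans (quot_eqToHom _)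
  rightUnitor_eq X :=
    (congrArg cls (StrictMonoidal.rightUnitor_eq (C := NNMat U) X)).trans (quot_eqToHom _)

instance : SymmetricCategory (FinProjStoch U) where
  braiding X Y := (quot U).mapIso (β_ (show NNMat U from X) (show NNMat U from Y))
  braiding_naturality_right X := by
    rintro Y Z ⟨f⟩
    exact congrArg cls (BraidedCategory.braiding_naturality_right (C := NNMat U) X f)
  braiding_naturality_left := by
    rintro X Y ⟨f⟩ Z
    exact congrArg cls (BraidedCategory.braiding_naturality_left (C := NNMat U) f Z)
  hexagon_forward X Y Z := congrArg cls (BraidedCategory.hexagon_forward (C := NNMat U) X Y Z)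
  hexagon_reverse X Y Z := congrArg cls (BraidedCategory.hexagon_reverse (C := NNMat U) X Y Z)
  symmetry X Y := congrArg cls (SymmetricCategory.symmetry (C := NNMat U) X Y)

/-- The comonoid structure of an object, inherited from the matrices. -/
@[reducible]
def comon (X : FinProjStoch U) : ComonObj X where
  counit := cls ε[(show NNMat U from X)]
  comul := cls Δ[(show NNMat U from X)]
  counit_comul := congrArg cls (ComonObj.counit_comul (show NNMat U from X))
  comul_counit := congrArg cls (ComonObj.comul_counit (show NNMat U from X))
  comul_assoc := congrArg cls (ComonObj.comul_assoc (show NNMat U from X))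

/-- The monoid structure of an object, inherited from the matrices. -/
@[reducible]
def mon (X : FinProjStoch U) : MonObj X where
  one := cls η[(show NNMat U from X)]
  mul := cls μ[(show NNMat U from X)]
  one_mul := congrArg cls (MonObj.one_mul (show NNMat U from X))
  mul_one := congrArg cls (MonObj.mul_one (show NNMat U from X))
  mul_assoc := congrArg cls (MonObj.mul_assoc (show NNMat U from X))

instance : CopyDiscardCategory (FinProjStoch U) where
  comonObj X := comon X
  isCommComonObj X := by
    let := comon X
    exact ⟨congrArg cls (IsCommComonObj.comul_comm (show NNMat U from X))⟩
  copy_tensor X Y := congrArg cls (CopyDiscardCategory.copy_tensor (C := NNMat U) X Y)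
  discard_tensor X Y := congrArg cls (CopyDiscardCategory.discard_tensor (C := NNMat U) X Y)
  copy_unit := congrArg cls (CopyDiscardCategory.copy_unit (C := NNMat U))
  discard_unit := congrArg cls (CopyDiscardCategory.discard_unit (C := NNMat U))

instance : HypergraphCategory (FinProjStoch U) where
  monObj X := mon X
  isCommMonObj X := by
    let := mon X
    exact ⟨congrArg cls (IsCommMonObj.mul_comm (show NNMat U from X))⟩
  compare_tensor X Y := congrArg cls (HypergraphCategory.compare_tensor (C := NNMat U) X Y)
  omni_tensor X Y := congrArg cls (HypergraphCategory.omni_tensor (C := NNMat U) X Y)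
  compare_unit := congrArg cls (HypergraphCategory.compare_unit (C := NNMat U))
  omni_unit := congrArg cls (HypergraphCategory.omni_unit (C := NNMat U))
  special X := congrArg cls (HypergraphCategory.special (C := NNMat U) X)
  frobenius_left X := congrArg cls (HypergraphCategory.frobenius_left (C := NNMat U) X)
  frobenius_right X := congrArg cls (HypergraphCategory.frobenius_right (C := NNMat U) X)

end FinProjStoch

lemma eq_eqToHom_comp_comp {E : Type u} [Category.{v} E] {X Y : E} (f : X ⟶ Y) (h : X = X)
    (h' : Y = Y) : f = eqToHom h ≫ f ≫ eqToHom h' := by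
  simp

/-- The quotient functor, which is a hypergraph functor. -/
def normalise (U : Type w) : HypergraphFunctor (NNMat U) (FinProjStoch U) where
  toFunctor := FinProjStoch.quot U
  obj_unit := rfl
  obj_tensor _ _ := rfl
  map_tensor f g := eq_eqToHom_comp_comp _ _ _
  map_braiding X Y := eq_eqToHom_comp_comp _ _ _
  map_copy X := (Category.comp_id _).symm
  map_del X := (Category.comp_id _).symm
  map_compare X := (Category.id_comp _).symm
  map_omni X := (Category.id_comp _).symm

/-- The category of finite sets and stochastic matrices: the total morphisms among the matrices. -/
abbrev FinStoch (U : Type w) : Type w := Tot (NNMat U)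

end

end PGM

open PGM PGM.OrderedDAG

namespace PGM

/-! Composing `F` with `⋆_G` gives a CD-functor `H` on `CDSyn G` whose boxes `f_v`, from the parents
of `v` to `v`, need not be total. The image of the copy-composition is a state built by copying,
selecting parents and applying the `f_v` in increasing order of `v`. The task is to make the boxes
total without changing the wiring, at the cost of a scalar.

Take the largest vertex `v`. A total conditional with trivial first output writes `f_v` as a
reweighting by its mass, the effect `f_v ≫ ε`, followed by a total `g_v`. Selecting the parents
commutes with copying, so the mass can be moved in front of the box (`graph_comp_weight_comp`),
where it reweights the state of the earlier variables by an effect on the parents of `v`. By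
chordality these parents form a clique: if `u` is the largest of them, then all others are parents
of `u`. The effect is therefore a function of `u` and the parents of `u`
(`isLocalEffect_of_clique`). It slides past the boxes of the vertices between `u` and `v`
(`graph_comp_weight_fst`) and is absorbed into the box of `u` (`graph_comp_weight_whiskerRight`). If
`v` has no parents, it slides all the way down and becomes a scalar. What remains is a
copy-composition of the same shape with one vertex less, and the argument repeats
(`IsCopyComp.exists_weight`, `IsCopyComp.exists_total`). In the end the state equals a scalar `s`
times a copy-composition `σ'` of total boxes.

After `q`, the state of `ω` is `s` times `σ'`. Both states are total, so deleting their outputs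
gives `q s = 1`, and faithfulness of `q` on total morphisms gives equality before `q`. The total
boxes define `K` by the universal property of the free CD-category (`Free.extendTo`), and `K` after
`!_G` agrees with `ω` because functors out of a free category are determined by generators
(`Free.cdFunctor_ext`). This is `exists_total_factorisation`.

For matrices, total conditionals fail at the empty set: no total matrix leads from a nonempty set to
the empty one. The elimination only needs to split masses off boxes with target `H v`, however, and
these sets are nonempty because their product carries a probability distribution. Normalising
columns then does the splitting. As both categories of networks are full subcategories of the same
category, the functor is the inclusion of one into the other. -/

lemma Theory.not_hasCompare_cd (h : Theory.cd.HasCompare) : False :=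
  absurd h.eq_hyp (by simp)

lemma Theory.not_hasCopy_sym (h : Theory.sym.HasCopy) : False :=
  h.ne_sym rfl

lemma Theory.not_hasCompare_sym (h : Theory.sym.HasCompare) : False :=
  absurd h.eq_hyp (by simp)

/-! ### Functors from a free CD-category to a strict CD-category -/

namespace Free

section ExtendTo

variable {A : Type u} {S : Signature A} {E : Type u₁} [Category.{v₁} E] [MonoidalCategory E]
  [CopyDiscardCategory E]
  (m : List A → E) (m_nil : m [] = 𝟙_ E) (m_append : ∀ X Y, m (X ++ Y) = m X ⊗ m Y)
  (ψ : ∀ σ : S.Gen, m (S.dom σ) ⟶ m (S.cod σ))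

/-- Interpretation of formal diagrams in a strict CD-category, given the images of the
generators. -/
def evalTo : ∀ {X Y : List A}, Tm .cd S X Y → (m X ⟶ m Y)
  | _, _, .id X => 𝟙 (m X)
  | _, _, .comp f g => evalTo f ≫ evalTo g
  | _, _, .tensor f g =>
      eqToHom (m_append _ _) ≫ (evalTo f ⊗ₘ evalTo g) ≫ eqToHom (m_append _ _).symm
  | _, _, .braid X Y =>
      eqToHom (m_append _ _) ≫ (β_ (m X) (m Y)).hom ≫ eqToHom (m_append _ _).symm
  | _, _, .gen σ => ψ σ
  | _, _, .copy X => Δ[m X] ≫ eqToHom (m_append _ _).symm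
  | _, _, .del X => ε[m X] ≫ eqToHom m_nil.symm
  | _, _, @Tm.compare _ _ _ h _ => (Theory.not_hasCompare_cd h).elim
  | _, _, @Tm.omni _ _ _ h _ => (Theory.not_hasCompare_cd h).elim

lemma evalTo_eqTo {X Y : List A} (h : X = Y) :
    evalTo m m_nil m_append ψ (Tm.eqTo h) = eqToHom (congrArg m h) := by
  cases h; simp [Tm.eqTo, evalTo]

lemma evalTo_comp {X Y Z : List A} (f : Tm .cd S X Y) (g : Tm .cd S Y Z) :
    evalTo m m_nil m_append ψ (f.comp g) =
      evalTo m m_nil m_append ψ f ≫ evalTo m m_nil m_append ψ g := rfl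

lemma evalTo_id (X : List A) : evalTo m m_nil m_append ψ (Tm.id X) = 𝟙 (m X) := rfl

lemma evalTo_tensor {X Y X' Y' : List A} (f : Tm .cd S X Y) (g : Tm .cd S X' Y') :
    evalTo m m_nil m_append ψ (f.tensor g) = eqToHom (m_append _ _) ≫
      (evalTo m m_nil m_append ψ f ⊗ₘ evalTo m m_nil m_append ψ g) ≫
        eqToHom (m_append _ _).symm := rfl

lemma evalTo_braid (X Y : List A) : evalTo m m_nil m_append ψ (Tm.braid X Y) =
    eqToHom (m_append _ _) ≫ (β_ (m X) (m Y)).hom ≫ eqToHom (m_append _ _).symm := rfl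

lemma evalTo_copy (X : List A) :
    evalTo m m_nil m_append ψ (Tm.copy X) = Δ[m X] ≫ eqToHom (m_append _ _).symm := rfl

lemma evalTo_del (X : List A) :
    evalTo m m_nil m_append ψ (Tm.del X) = ε[m X] ≫ eqToHom m_nil.symm := rfl

variable [StrictMonoidal E]

lemma evalTo_middle (X X' Y Y' : List A) :
    evalTo m m_nil m_append ψ (Tm.middle X X' Y Y') =
      eqToHom (by simp only [m_append]) ≫ tensorμ (m X) (m X') (m Y) (m Y') ≫
        eqToHom (by simp only [m_append]) := by
  simp only [Tm.middle, Tm.assoc, Tm.assocInv, evalTo_comp, evalTo_tensor, evalTo_id, evalTo_braid,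
    evalTo_eqTo, tensorμ, StrictMonoidal.associator_eq, associator_inv_eq, ← id_tensorHom,
    ← tensorHom_id, eqToHom_comp_tensorHom, comp_eqToHom_tensorHom,
    tensorHom_eqToHom_comp, tensorHom_comp_eqToHom, id_tensorHom_eqToHom,
    Category.assoc, eqToHom_trans, eqToHom_trans_assoc]

set_option linter.unusedSimpArgs false in
-- Every law is an axiom of strict CD-categories, conjugated by the identifications `m (X ++ Y) = m
-- X ⊗ m Y`. These hold only propositionally, so each case moves all `eqToHom` to the two ends and
-- then quotes the axiom. The laws of compare and omni do not occur in the theory `cd`.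
lemma evalTo_rel {X Y : List A} {f g : Tm .cd S X Y} (h : Tm.Rel f g) :
    evalTo m m_nil m_append ψ f = evalTo m m_nil m_append ψ g := by
  induction h with
  | comp_left g _ ih => simp [evalTo, ih]
  | comp_right f _ ih => simp [evalTo, ih]
  | tensor_left g _ ih => simp [evalTo, ih]
  | tensor_right f _ ih => simp [evalTo, ih]
  | id_comp f => simp [evalTo]
  | comp_id f => simp [evalTo]
  | comp_assoc f g h => simp [evalTo]
  | tensor_id X Y => simp [evalTo]
  | tensor_comp f f' g g' => simp [evalTo]
  | assoc_naturality f f' f'' =>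
    simp only [evalTo_comp, evalTo_tensor, evalTo_id, evalTo_braid, Tm.assoc, Tm.assocInv,
      evalTo_eqTo, eqToHom_comp_tensorHom, comp_eqToHom_tensorHom, tensorHom_eqToHom_comp,
      tensorHom_comp_eqToHom, Category.assoc, eqToHom_trans, eqToHom_trans_assoc,
      eqToHom_refl, Category.id_comp, Category.comp_id,
      tensorHom_assoc_eq]
  | unit_tensor f =>
    simp only [evalTo, evalTo_eqTo, id_tensorHom_of_unit m_nil]
    simp
  | tensor_unit f =>
    simp only [evalTo, evalTo_eqTo, tensorHom_id_of_unit m_nil]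
    simp
  | braid_naturality f g => simp [evalTo]
  | hexagon_forward X Y Z =>
    have h := BraidedCategory.hexagon_forward (m X) (m Y) (m Z)
    simp only [StrictMonoidal.associator_eq, associator_inv_eq, StrictMonoidal.leftUnitor_eq,
      leftUnitor_inv_eq, StrictMonoidal.rightUnitor_eq, rightUnitor_inv_eq, ← id_tensorHom,
      ← tensorHom_id] at h
    simp only [evalTo_comp, evalTo_tensor, evalTo_id, evalTo_braid, Tm.assoc, Tm.assocInv,
      evalTo_eqTo, eqToHom_comp_tensorHom, comp_eqToHom_tensorHom, tensorHom_eqToHom_comp,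
      tensorHom_comp_eqToHom, Category.assoc, eqToHom_trans, eqToHom_trans_assoc,
      eqToHom_refl, Category.id_comp, Category.comp_id,
      braiding_congr (rfl : m X = m X) (m_append Y Z), reassoc_of% h.symm]
  | hexagon_reverse X Y Z =>
    have h := BraidedCategory.hexagon_reverse (m X) (m Y) (m Z)
    simp only [StrictMonoidal.associator_eq, associator_inv_eq, StrictMonoidal.leftUnitor_eq,
      leftUnitor_inv_eq, StrictMonoidal.rightUnitor_eq, rightUnitor_inv_eq, ← id_tensorHom,
      ← tensorHom_id] at h
    simp only [evalTo_comp, evalTo_tensor, evalTo_id, evalTo_braid, Tm.assoc, Tm.assocInv,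
      evalTo_eqTo, eqToHom_comp_tensorHom, comp_eqToHom_tensorHom, tensorHom_eqToHom_comp,
      tensorHom_comp_eqToHom, Category.assoc, eqToHom_trans, eqToHom_trans_assoc,
      eqToHom_refl, Category.id_comp, Category.comp_id,
      braiding_congr (m_append X Y) (rfl : m Z = m Z), reassoc_of% h.symm]
  | symmetry X Y => simp [evalTo]
  | copy_del_left X =>
    have h := ComonObj.counit_comul (m X)
    simp only [StrictMonoidal.associator_eq, associator_inv_eq, StrictMonoidal.leftUnitor_eq,
      leftUnitor_inv_eq, StrictMonoidal.rightUnitor_eq, rightUnitor_inv_eq, ← id_tensorHom,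
      ← tensorHom_id] at h
    simp only [evalTo_comp, evalTo_tensor, evalTo_id, evalTo_braid, Tm.assoc, Tm.assocInv,
      evalTo_copy, evalTo_del,
      evalTo_eqTo, eqToHom_comp_tensorHom, comp_eqToHom_tensorHom, tensorHom_eqToHom_comp,
      tensorHom_comp_eqToHom, Category.assoc, eqToHom_trans, eqToHom_trans_assoc,
      eqToHom_refl, Category.id_comp, Category.comp_id,
      reassoc_of% h]
  | copy_del_right X =>
    have h := ComonObj.comul_counit (m X)
    simp only [StrictMonoidal.associator_eq, associator_inv_eq, StrictMonoidal.leftUnitor_eq,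
      leftUnitor_inv_eq, StrictMonoidal.rightUnitor_eq, rightUnitor_inv_eq, ← id_tensorHom,
      ← tensorHom_id] at h
    simp only [evalTo_comp, evalTo_tensor, evalTo_id, evalTo_braid, Tm.assoc, Tm.assocInv,
      evalTo_copy, evalTo_del,
      evalTo_eqTo, eqToHom_comp_tensorHom, comp_eqToHom_tensorHom, tensorHom_eqToHom_comp,
      tensorHom_comp_eqToHom, Category.assoc, eqToHom_trans, eqToHom_trans_assoc,
      eqToHom_refl, Category.id_comp, Category.comp_id,
      reassoc_of% h]
  | copy_assoc X =>
    have h := ComonObj.comul_assoc (m X)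
    simp only [StrictMonoidal.associator_eq, associator_inv_eq, StrictMonoidal.leftUnitor_eq,
      leftUnitor_inv_eq, StrictMonoidal.rightUnitor_eq, rightUnitor_inv_eq, ← id_tensorHom,
      ← tensorHom_id] at h
    simp only [evalTo_comp, evalTo_tensor, evalTo_id, evalTo_braid, Tm.assoc, Tm.assocInv,
      evalTo_copy, evalTo_del,
      evalTo_eqTo, eqToHom_comp_tensorHom, comp_eqToHom_tensorHom, tensorHom_eqToHom_comp,
      tensorHom_comp_eqToHom, Category.assoc, eqToHom_trans, eqToHom_trans_assoc,
      eqToHom_refl, Category.id_comp, Category.comp_id,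
      reassoc_of% h]
  | copy_comm X =>
    have h := IsCommComonObj.comul_comm (m X)
    simp only [evalTo_comp, evalTo_tensor, evalTo_id, evalTo_braid, Tm.assoc, Tm.assocInv,
      evalTo_copy, evalTo_del,
      evalTo_eqTo, eqToHom_comp_tensorHom, comp_eqToHom_tensorHom, tensorHom_eqToHom_comp,
      tensorHom_comp_eqToHom, Category.assoc, eqToHom_trans, eqToHom_trans_assoc,
      eqToHom_refl, Category.id_comp, Category.comp_id,
      reassoc_of% h]
  | copy_tensor X Y =>
    have h := CopyDiscardCategory.copy_tensor (m X) (m Y)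
    simp only [evalTo_comp, evalTo_tensor, evalTo_id, evalTo_braid, Tm.assoc, Tm.assocInv,
      evalTo_copy, evalTo_del,
      evalTo_eqTo, eqToHom_comp_tensorHom, comp_eqToHom_tensorHom, tensorHom_eqToHom_comp,
      tensorHom_comp_eqToHom, Category.assoc, eqToHom_trans, eqToHom_trans_assoc,
      eqToHom_refl, Category.id_comp, Category.comp_id,
      evalTo_middle, copy_congr (m_append X Y), h]
  | del_tensor X Y =>
    have h := CopyDiscardCategory.discard_tensor (m X) (m Y)
    simp only [StrictMonoidal.associator_eq, associator_inv_eq, StrictMonoidal.leftUnitor_eq,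
      leftUnitor_inv_eq, StrictMonoidal.rightUnitor_eq, rightUnitor_inv_eq, ← id_tensorHom,
      ← tensorHom_id] at h
    simp only [evalTo_comp, evalTo_tensor, evalTo_id, evalTo_braid, Tm.assoc, Tm.assocInv,
      evalTo_copy, evalTo_del,
      evalTo_eqTo, eqToHom_comp_tensorHom, comp_eqToHom_tensorHom, tensorHom_eqToHom_comp,
      tensorHom_comp_eqToHom, Category.assoc, eqToHom_trans, eqToHom_trans_assoc,
      eqToHom_refl, Category.id_comp, Category.comp_id,
      del_congr (m_append X Y), h]
  | copy_unit =>
    have h := CopyDiscardCategory.copy_unit (C := E)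
    simp only [StrictMonoidal.associator_eq, associator_inv_eq, StrictMonoidal.leftUnitor_eq,
      leftUnitor_inv_eq, StrictMonoidal.rightUnitor_eq, rightUnitor_inv_eq, ← id_tensorHom,
      ← tensorHom_id] at h
    simp only [evalTo_comp, evalTo_tensor, evalTo_id, evalTo_braid, Tm.assoc, Tm.assocInv,
      evalTo_copy, evalTo_del,
      evalTo_eqTo, eqToHom_comp_tensorHom, comp_eqToHom_tensorHom, tensorHom_eqToHom_comp,
      tensorHom_comp_eqToHom, Category.assoc, eqToHom_trans, eqToHom_trans_assoc,
      eqToHom_refl, Category.id_comp, Category.comp_id,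
      copy_congr m_nil, h]
  | del_unit =>
    have h := CopyDiscardCategory.discard_unit (C := E)
    simp only [evalTo_comp, evalTo_tensor, evalTo_id, evalTo_braid, Tm.assoc, Tm.assocInv,
      evalTo_copy, evalTo_del,
      evalTo_eqTo, eqToHom_comp_tensorHom, comp_eqToHom_tensorHom, tensorHom_eqToHom_comp,
      tensorHom_comp_eqToHom, Category.assoc, eqToHom_trans, eqToHom_trans_assoc,
      eqToHom_refl, Category.id_comp, Category.comp_id,
      del_congr m_nil, h]
  | compare_omni_left => exact (Theory.not_hasCompare_cd ‹_›).elim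
  | compare_omni_right => exact (Theory.not_hasCompare_cd ‹_›).elim
  | compare_assoc => exact (Theory.not_hasCompare_cd ‹_›).elim
  | compare_comm => exact (Theory.not_hasCompare_cd ‹_›).elim
  | compare_tensor => exact (Theory.not_hasCompare_cd ‹_›).elim
  | omni_tensor => exact (Theory.not_hasCompare_cd ‹_›).elim
  | compare_unit => exact (Theory.not_hasCompare_cd ‹_›).elim
  | omni_unit => exact (Theory.not_hasCompare_cd ‹_›).elim
  | special => exact (Theory.not_hasCompare_cd ‹_›).elim
  | frobenius_left => exact (Theory.not_hasCompare_cd ‹_›).elim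
  | frobenius_right => exact (Theory.not_hasCompare_cd ‹_›).elim

/-- The CD-functor out of a free CD-category that is given by the monoid homomorphism `m` on
objects and by `ψ` on generating morphisms. -/
def extendTo : CDFunctor (Free .cd S) E where
  obj := m
  map f := Quot.lift (evalTo m m_nil m_append ψ)
    (fun _ _ h => evalTo_rel m m_nil m_append ψ h) f
  map_id X := rfl
  map_comp := by rintro X Y Z ⟨f⟩ ⟨g⟩; rfl
  obj_unit := m_nil
  obj_tensor := m_append
  map_tensor := by rintro X X' Y Y' ⟨f⟩ ⟨g⟩; rfl
  map_braiding X Y := rfl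
  map_copy X := rfl
  map_del X := rfl

end ExtendTo

/-! ### Uniqueness of functors out of a free category -/

section Unique

variable {E : Type u₁} [Category.{v₁} E]

/-- Two functors that agree on objects only propositionally send a morphism to different hom types.
Heterogeneous equality compares the two images without choosing casts, and this congruence
propagates it through formal diagrams. -/
lemma comp_heq_comp {X X' Y Y' Z Z' : E} {f : X ⟶ Y} {f' : X' ⟶ Y'} {g : Y ⟶ Z} {g' : Y' ⟶ Z'}
    (hX : X = X') (hY : Y = Y') (hZ : Z = Z') (hf : f ≍ f') (hg : g ≍ g') :
    f ≫ g ≍ f' ≫ g' := by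
  subst hX hY hZ hf hg; rfl

lemma eqToHom_comp_eqToHom_heq {X X' Y Y' : E} (h : X = X') (f : X' ⟶ Y') (h' : Y' = Y) :
    eqToHom h ≫ f ≫ eqToHom h' ≍ f := by
  subst h h'; simp

variable [MonoidalCategory E]

lemma tensorHom_heq_tensorHom {X X' Y Y' Z Z' W W' : E} {f : X ⟶ Y} {f' : X' ⟶ Y'} {g : Z ⟶ W}
    {g' : Z' ⟶ W'} (hX : X = X') (hY : Y = Y') (hZ : Z = Z') (hW : W = W') (hf : f ≍ f')
    (hg : g ≍ g') : (f ⊗ₘ g) ≍ (f' ⊗ₘ g') := by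
  subst hX hY hZ hW hf hg; rfl

variable {A : Type u} {T : Theory} {S : Signature A}

section Sym

variable {B : Type u₂} [Category.{v₂} B] [MonoidalCategory B] [SymmetricCategory B]
  [SymmetricCategory E]

lemma map_tensor_heq (H : SymFunctor B E) {X X' Y Y' : B} (f : X ⟶ Y) (g : X' ⟶ Y') :
    H.map (f ⊗ₘ g) ≍ (H.map f ⊗ₘ H.map g) := by
  rw [H.map_tensor]; exact eqToHom_comp_eqToHom_heq _ _ _

lemma map_tensor_congr {H K : SymFunctor B E} (h : ∀ X, H.obj X = K.obj X) {X X' Y Y' : B}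
    {f : X ⟶ Y} {g : X' ⟶ Y'} (hf : H.map f ≍ K.map f) (hg : H.map g ≍ K.map g) :
    H.map (f ⊗ₘ g) ≍ K.map (f ⊗ₘ g) :=
  (map_tensor_heq H f g).trans
    ((tensorHom_heq_tensorHom (h _) (h _) (h _) (h _) hf hg).trans (map_tensor_heq K f g).symm)

lemma map_comp_congr {H K : SymFunctor B E} (h : ∀ X, H.obj X = K.obj X) {X Y Z : B}
    {f : X ⟶ Y} {g : Y ⟶ Z} (hf : H.map f ≍ K.map f) (hg : H.map g ≍ K.map g) :
    H.map (f ≫ g) ≍ K.map (f ≫ g) := by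
  rw [H.map_comp, K.map_comp]
  exact comp_heq_comp (h _) (h _) (h _) hf hg

lemma map_id_congr {H K : SymFunctor B E} (h : ∀ X, H.obj X = K.obj X) (X : B) :
    H.map (𝟙 X) ≍ K.map (𝟙 X) := by
  rw [H.map_id, K.map_id, h]

lemma map_eqToHom_congr {H K : SymFunctor B E} (h : ∀ X, H.obj X = K.obj X) {X Y : B}
    (e : X = Y) : H.map (eqToHom e) ≍ K.map (eqToHom e) := by
  subst e; exact map_id_congr h X

lemma map_braiding_congr {H K : SymFunctor B E} (h : ∀ X, H.obj X = K.obj X) (X Y : B) :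
    H.map (β_ X Y).hom ≍ K.map (β_ X Y).hom := by
  rw [H.map_braiding, K.map_braiding]
  refine (eqToHom_comp_eqToHom_heq _ _ _).trans
    (HEq.trans ?_ (eqToHom_comp_eqToHom_heq _ _ _).symm)
  rw [h, h]

end Sym

lemma map_copy_congr {B : Type u₂} [Category.{v₂} B] [MonoidalCategory B] [CopyDiscardCategory B]
    [CopyDiscardCategory E] {H K : CDFunctor B E} (h : ∀ X, H.obj X = K.obj X) (X : B) :
    H.map Δ[X] ≍ K.map Δ[X] := by
  rw [H.map_copy, K.map_copy]
  refine (comp_eqToHom_heq _ _).trans (HEq.trans ?_ (comp_eqToHom_heq _ _).symm)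
  rw [h]

lemma map_del_congr {B : Type u₂} [Category.{v₂} B] [MonoidalCategory B] [CopyDiscardCategory B]
    [CopyDiscardCategory E] {H K : CDFunctor B E} (h : ∀ X, H.obj X = K.obj X) (X : B) :
    H.map ε[X] ≍ K.map ε[X] := by
  rw [H.map_del, K.map_del]
  refine (comp_eqToHom_heq _ _).trans (HEq.trans ?_ (comp_eqToHom_heq _ _).symm)
  rw [h]

/-- CD-functors out of a free CD-category are determined by their values on objects and
generators. -/
lemma cdFunctor_ext [CopyDiscardCategory E] {H K : CDFunctor (Free .cd S) E}
    (h : ∀ X, H.obj X = K.obj X)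
    (hgen : ∀ σ : S.Gen, H.map (mk (Tm.gen σ)) ≍ K.map (mk (Tm.gen σ))) :
    H.toFunctor = K.toFunctor := by
  have key : ∀ {X Y : List A} (t : Tm .cd S X Y), H.map (mk t) ≍ K.map (mk t) := by
    intro X Y t
    induction t with
    | id X => exact map_id_congr (H := H.toSymFunctor) h X
    | comp f g hf hg => exact map_comp_congr (H := H.toSymFunctor) h hf hg
    | tensor f g hf hg => exact map_tensor_congr (H := H.toSymFunctor) h hf hg
    | braid X Y => exact map_braiding_congr (H := H.toSymFunctor) h X Y
    | gen σ => exact hgen σ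
    | copy X => exact map_copy_congr h X
    | del X => exact map_del_congr h X
    | compare X => exact (Theory.not_hasCompare_cd ‹_›).elim
    | omni X => exact (Theory.not_hasCompare_cd ‹_›).elim
  refine CategoryTheory.Functor.hext h ?_
  rintro X Y ⟨t⟩
  exact key t

/-- Symmetric monoidal functors out of a free symmetric monoidal category are determined by their
values on objects and generators. -/
lemma symFunctor_ext [SymmetricCategory E] {H K : SymFunctor (Free .sym S) E}
    (h : ∀ X, H.obj X = K.obj X)
    (hgen : ∀ σ : S.Gen, H.map (mk (Tm.gen σ)) ≍ K.map (mk (Tm.gen σ))) :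
    H.toFunctor = K.toFunctor := by
  have key : ∀ {X Y : List A} (t : Tm .sym S X Y), H.map (mk t) ≍ K.map (mk t) := by
    intro X Y t
    induction t with
    | id X => exact map_id_congr h X
    | comp f g hf hg => exact map_comp_congr h hf hg
    | tensor f g hf hg => exact map_tensor_congr h hf hg
    | braid X Y => exact map_braiding_congr h X Y
    | gen σ => exact hgen σ
    | copy X => exact (Theory.not_hasCopy_sym ‹_›).elim
    | del X => exact (Theory.not_hasCopy_sym ‹_›).elim
    | compare X => exact (Theory.not_hasCompare_sym ‹_›).elim
    | omni X => exact (Theory.not_hasCompare_sym ‹_›).elim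
  refine CategoryTheory.Functor.hext h ?_
  rintro X Y ⟨t⟩
  exact key t

end Unique

end Free


/-! ### Graphs of morphisms and reweighting by effects -/

section Weight

variable {C : Type u} [Category.{v} C] [MonoidalCategory C] [CopyDiscardCategory C]

/-- The graph of `f`: copy the input and apply `f` to one of the copies. -/
def graph {A B : C} (f : A ⟶ B) : A ⟶ A ⊗ B := Δ[A] ≫ A ◁ f

/-- Reweighting by the effect `w`: copy the input and apply `w` to one of the copies. -/
def weight {A : C} (w : A ⟶ 𝟙_ C) : A ⟶ A := graph w ≫ (ρ_ A).hom

lemma graph_comp {A B B' : C} (f : A ⟶ B) (g : B ⟶ B') : graph (f ≫ g) = graph f ≫ A ◁ g := by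
  simp [graph]

/-- `f` commutes with copying. -/
def Copyable {A B : C} (f : A ⟶ B) : Prop := f ≫ Δ[B] = Δ[A] ≫ (f ⊗ₘ f)

lemma Copyable.comp {A B D : C} {f : A ⟶ B} {g : B ⟶ D} (hf : Copyable f) (hg : Copyable g) :
    Copyable (f ≫ g) := by
  unfold Copyable at *
  rw [Category.assoc, hg, reassoc_of% hf, tensorHom_comp_tensorHom]

lemma copyable_eqToHom {A B : C} (h : A = B) : Copyable (eqToHom h) := by
  subst h; simp [Copyable]

/-- Copying the output of a copyable map amounts to copying its input and applying the map twice.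
One of the two instances becomes part of the argument of the graph. -/
lemma Copyable.comp_graph {A B D : C} {h : A ⟶ B} (hh : Copyable h) (f : B ⟶ D) :
    h ≫ graph f = graph (h ≫ f) ≫ h ▷ D := by
  rw [graph, reassoc_of% hh, graph, MonoidalCategory.tensorHom_def]
  simp only [Category.assoc, MonoidalCategory.whiskerLeft_comp, whisker_exchange_assoc,
    whisker_exchange]

/-- A weight behind a copyable map can be pulled back to its input. Applied to the selection of
parents, this turns an effect on the parents into an effect on all earlier variables. -/
lemma Copyable.comp_weight {A B : C} {h : A ⟶ B} (hh : Copyable h) (w : B ⟶ 𝟙_ C) :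
    h ≫ weight w = weight (h ≫ w) ≫ h := by
  rw [weight, reassoc_of% (hh.comp_graph w), weight, Category.assoc, rightUnitor_naturality]

/-- Coassociativity: on both sides the input is copied to three wires, one of which is consumed by
`w`. -/
lemma graph_weight {A : C} (w : A ⟶ 𝟙_ C) : graph (weight w) = weight w ≫ Δ[A] := by
  have h : weight w ≫ Δ[A] = Δ[A] ≫ Δ[A] ▷ A ≫ (A ⊗ A) ◁ w ≫ (ρ_ (A ⊗ A)).hom := by
    rw [weight, graph, Category.assoc, Category.assoc, ← rightUnitor_naturality,
      whisker_exchange_assoc]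
  rw [h, graph, weight, graph]
  simp only [MonoidalCategory.whiskerLeft_comp, Category.assoc]
  rw [comul_assoc_assoc]
  monoidal

/-- The mirror image of `graph_weight`, by commutativity of copying. -/
lemma copy_comp_weight_whiskerRight {A : C} (w : A ⟶ 𝟙_ C) :
    Δ[A] ≫ weight w ▷ A = weight w ≫ Δ[A] := by
  have h := congrArg (· ≫ (β_ A A).hom) (graph_weight w)
  simp only [graph, Category.assoc, IsCommComonObj.comul_comm,
    BraidedCategory.braiding_naturality_right] at h
  rw [← h, IsCommComonObj.comul_comm_assoc]

/-- Splitting off a weight that depends only on the inputs. -/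
lemma graph_comp_weight_comp {A P B : C} {π : A ⟶ P} (hπ : Copyable π) (w : P ⟶ 𝟙_ C)
    (g : P ⟶ B) : graph (π ≫ weight w ≫ g) = weight (π ≫ w) ≫ graph (π ≫ g) := by
  rw [reassoc_of% (hπ.comp_weight w), graph_comp, graph_weight, Category.assoc]
  rfl

/-- Reweighting `A ⊗ B` by `e` and forgetting the component in `A`. -/
def weightSnd {A B : C} (e : A ⊗ B ⟶ 𝟙_ C) : A ⊗ B ⟶ B :=
  A ◁ Δ[B] ≫ (α_ A B B).inv ≫ (β_ A B).hom ▷ B ≫ (α_ B A B).hom ≫ B ◁ e ≫ (ρ_ B).hom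

/-- Copying `A ⊗ B` copies the factors separately. The effect takes one copy of each, and the other
copy of `A` takes no part in what happens next, so the rest of the diagram is a morphism with output
`B` alone. -/
lemma weight_eq_weightSnd {A B : C} (e : A ⊗ B ⟶ 𝟙_ C) :
    weight e = Δ[A] ▷ B ≫ (α_ A A B).hom ≫ A ◁ weightSnd e := by
  rw [weight, graph, CopyDiscardCategory.copy_tensor, tensorμ, weightSnd,
    MonoidalCategory.tensorHom_def]
  monoidal

lemma weightSnd_whiskerRight_comp {A A' B : C} (h : A' ⟶ A) (e : A ⊗ B ⟶ 𝟙_ C) :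
    weightSnd (h ▷ B ≫ e) = h ▷ B ≫ weightSnd e := by
  unfold weightSnd
  simp only [MonoidalCategory.whiskerLeft_comp, Category.assoc]
  rw [← whisker_exchange_assoc, associator_inv_naturality_left_assoc,
    ← comp_whiskerRight_assoc, BraidedCategory.braiding_naturality_left]
  simp

/-- The copy of `A` that `e` consumes can, by coassociativity, be made from the copy that is fed to
`f`. Hence a reweighted graph is again a graph, of a morphism that has absorbed the weight. -/
lemma graph_comp_weight {A B : C} (f : A ⟶ B) (e : A ⊗ B ⟶ 𝟙_ C) :
    graph f ≫ weight e = graph (graph f ≫ weightSnd e) := by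
  rw [weight_eq_weightSnd, graph, graph, Category.assoc, whisker_exchange_assoc]
  simp only [MonoidalCategory.whiskerLeft_comp, Category.assoc]
  rw [comul_assoc_assoc]
  simp

/-- Absorbing a weight that depends only on the output of `f` and on the inputs of `f`. -/
lemma graph_comp_weight_whiskerRight {A P B : C} {π : A ⟶ P} (hπ : Copyable π) (f : P ⟶ B)
    (e : P ⊗ B ⟶ 𝟙_ C) :
    graph (π ≫ f) ≫ weight (π ▷ B ≫ e) = graph (π ≫ graph f ≫ weightSnd e) := by
  rw [graph_comp_weight, weightSnd_whiskerRight_comp, reassoc_of% (hπ.comp_graph f)]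

/-- The copy of `B` that reaches the effect is deleted at once, so by counitality `B` is not copied
at all. -/
lemma weight_fst {A : C} (B : C) (w : A ⟶ 𝟙_ C) :
    weight (A ◁ ε[B] ≫ (ρ_ A).hom ≫ w) = weight w ▷ B := by
  have h : weightSnd (A ◁ ε[B] ≫ (ρ_ A).hom ≫ w) = w ▷ B ≫ (λ_ B).hom := by
    unfold weightSnd
    simp only [MonoidalCategory.whiskerLeft_comp, Category.assoc]
    rw [← associator_naturality_right_assoc, ← whisker_exchange_assoc,
      ← associator_inv_naturality_right_assoc, ← MonoidalCategory.whiskerLeft_comp_assoc,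
      comul_counit]
    have h1 : A ◁ (ρ_ B).inv ≫ (α_ A B (𝟙_ C)).inv ≫ (β_ A B).hom ▷ 𝟙_ C ≫
        (α_ B A (𝟙_ C)).hom ≫ B ◁ (ρ_ A).hom = (β_ A B).hom := by monoidal
    rw [reassoc_of% h1, ← BraidedCategory.braiding_naturality_left_assoc]
    simp
  rw [weight_eq_weightSnd, h, weight, graph]
  monoidal

/-- Commuting a weight with a graph. -/
lemma graph_comp_weight_fst {A B : C} (f : A ⟶ B) (w : A ⟶ 𝟙_ C) :
    graph f ≫ weight (A ◁ ε[B] ≫ (ρ_ A).hom ≫ w) = weight w ≫ graph f := by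
  rw [weight_fst, graph, Category.assoc, whisker_exchange,
    reassoc_of% copy_comp_weight_whiskerRight w]

end Weight

/-! ### Copy-compositions and elimination of variables -/

section Elimination

variable {C : Type u} [Category.{v} C] [MonoidalCategory C] [CopyDiscardCategory C]
  {V : Type w} (X : V → C)

/-- The tensor product of the objects assigned to the entries of a list, which is read from right
to left. -/
def tensorList : List V → C
  | [] => 𝟙_ C
  | v :: r => tensorList r ⊗ X v

variable {X} {P : V → List V → C} (π : ∀ v r, tensorList X r ⟶ P v r)

/-- The state `σ` is an iterated copy-composition, along the maps `π` to the inputs, of morphisms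
with the property `Q`. -/
def IsCopyComp (Q : MorphismProperty C) : ∀ r : List V, (𝟙_ C ⟶ tensorList X r) → Prop
  | [], σ => σ = 𝟙 (𝟙_ C)
  | v :: r, σ => ∃ (σ₀ : 𝟙_ C ⟶ tensorList X r) (f : P v r ⟶ X v),
      IsCopyComp Q r σ₀ ∧ Q f ∧ σ = σ₀ ≫ graph (π v r ≫ f)

/-- The effect `w` depends only on some variable and its inputs. -/
def IsLocalEffect : ∀ r : List V, (tensorList X r ⟶ 𝟙_ C) → Prop
  | [], _ => True
  | v :: r, w => (∃ e : P v r ⊗ X v ⟶ 𝟙_ C, w = π v r ▷ X v ≫ e) ∨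
      ∃ w' : tensorList X r ⟶ 𝟙_ C, IsLocalEffect r w' ∧
        w = tensorList X r ◁ ε[X v] ≫ (ρ_ _).hom ≫ w'

variable {π}

/-- A local effect is absorbed into the copy-composition, up to a scalar. -/
lemma IsCopyComp.exists_weight (hπ : ∀ v r, Copyable (π v r)) :
    ∀ (r : List V) (σ : 𝟙_ C ⟶ tensorList X r) (w : tensorList X r ⟶ 𝟙_ C),
      IsCopyComp π ⊤ r σ → IsLocalEffect π r w →
      ∃ (s : 𝟙_ C ⟶ 𝟙_ C) (σ' : 𝟙_ C ⟶ tensorList X r),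
        IsCopyComp π ⊤ r σ' ∧ σ ≫ weight w = s ≫ σ'
  -- With no variables left, the effect is a scalar and is collected in `s`.
  | [], σ, w, hσ, _ => ⟨σ ≫ weight w, 𝟙 _, rfl, (Category.comp_id _).symm⟩
  | v :: r, σ, w, ⟨σ₀, f, hσ₀, _, hσ⟩, Or.inl ⟨e, hw⟩ =>
    -- The effect involves only `v` and its inputs: the box `f` is replaced by one that first
    -- produces its output and then reweights by `e`. The new box need not be total, whence the
    -- property `⊤`.
    ⟨𝟙 _, σ ≫ weight w, ⟨σ₀, graph f ≫ weightSnd e, hσ₀, trivial, by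
      rw [hσ, hw]
      exact (Category.assoc _ _ _).trans
        (congrArg (σ₀ ≫ ·) (graph_comp_weight_whiskerRight (hπ v r) f e))⟩,
      (Category.id_comp _).symm⟩
  | v :: r, σ, w, ⟨σ₀, f, hσ₀, _, hσ⟩, Or.inr ⟨w', hw', hw⟩ => by
    -- The effect ignores `v`, so it commutes with the box at `v` and is absorbed further down.
    obtain ⟨s, σ', hσ', h⟩ := IsCopyComp.exists_weight hπ r σ₀ w' hσ₀ hw'
    refine ⟨s, σ' ≫ graph (π v r ≫ f), ⟨σ', f, hσ', trivial, rfl⟩, ?_⟩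
    rw [hσ, hw]
    refine (Category.assoc _ _ _).trans
      ((congrArg (σ₀ ≫ ·) (graph_comp_weight_fst (π v r ≫ f) w')).trans ?_)
    exact (reassoc_of% h) _

/-- Elimination of variables: a copy-composition is a scalar multiple of a copy-composition of
total morphisms. -/
lemma IsCopyComp.exists_total (hπ : ∀ v r, Copyable (π v r))
    (hs : ∀ v r (f : P v r ⟶ X v), ∃ g : P v r ⟶ X v, total C g ∧ f = weight (f ≫ ε[X v]) ≫ g) :
    ∀ (r : List V), (∀ v r', (v :: r') <:+ r → ∀ e : P v r' ⟶ 𝟙_ C,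
        IsLocalEffect π r' (π v r' ≫ e)) →
      ∀ σ : 𝟙_ C ⟶ tensorList X r, IsCopyComp π ⊤ r σ →
      ∃ (s : 𝟙_ C ⟶ 𝟙_ C) (σ' : 𝟙_ C ⟶ tensorList X r),
        IsCopyComp π (total C) r σ' ∧ σ = s ≫ σ'
  | [], _, σ, hσ => ⟨σ, 𝟙 _, rfl, (Category.comp_id _).symm⟩
  | v :: r, hr, σ, ⟨σ₀, f, hσ₀, _, hσ⟩ => by
    -- The current box may already carry weights from later vertices. Therefore `hs` has to split
    -- arbitrary morphisms to `X v`, not only the boxes given at the start.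
    obtain ⟨g, hg, hf⟩ := hs v r f
    -- The mass of `f` becomes a weight on the earlier variables. Its absorption changes boxes
    -- there, but the shape of the state is preserved, so the induction hypothesis still applies.
    obtain ⟨s, σ₁, hσ₁, h₁⟩ := IsCopyComp.exists_weight hπ r σ₀ _ hσ₀
      (hr v r (List.suffix_refl _) (f ≫ ε[X v]))
    obtain ⟨s', σ₂, hσ₂, h₂⟩ := IsCopyComp.exists_total hπ hs r
      (fun v' r' h => hr v' r' (h.trans (List.suffix_cons _ _))) σ₁ hσ₁
    refine ⟨s ≫ s', σ₂ ≫ graph (π v r ≫ g), ⟨σ₂, g, hσ₂, hg, rfl⟩, ?_⟩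
    rw [hσ, hf, graph_comp_weight_comp (hπ v r), reassoc_of% h₁, h₂, Category.assoc]
    exact (Category.assoc _ _ _).symm

end Elimination


/-! ### Marginalisation -/

section Copyable

variable {C : Type u} [Category.{v} C] [MonoidalCategory C] [CopyDiscardCategory C]

lemma copyable_id (A : C) : Copyable (𝟙 A) := by simp [Copyable]

lemma copyable_del (A : C) : Copyable ε[A] := by
  unfold Copyable
  rw [CopyDiscardCategory.copy_unit, MonoidalCategory.tensorHom_def, counit_comul_assoc]
  simp

lemma Copyable.tensor {A B A' B' : C} {f : A ⟶ B} {g : A' ⟶ B'} (hf : Copyable f)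
    (hg : Copyable g) : Copyable (f ⊗ₘ g) := by
  unfold Copyable at *
  rw [CopyDiscardCategory.copy_tensor, CopyDiscardCategory.copy_tensor, Category.assoc,
    ← tensorμ_natural, tensorHom_comp_tensorHom_assoc, tensorHom_comp_tensorHom_assoc, hf, hg]

lemma Copyable.map {D : Type u₂} [Category.{v₂} D] [MonoidalCategory D] [CopyDiscardCategory D]
    (H : CDFunctor C D) {A B : C} {f : A ⟶ B} (hf : Copyable f) : Copyable (H.map f) := by
  have h := congrArg H.map hf
  rw [H.map_comp, H.map_comp, H.map_copy, H.map_copy, H.map_tensor] at h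
  unfold Copyable
  rw [← cancel_mono (eqToHom (H.obj_tensor B B).symm)]
  simpa using h

end Copyable

section Marginalise

variable {A : Type u} {T : Theory} {S : Signature A}

/-- A list of generators as an object of the free category. -/
def Free.ob (T : Theory) (S : Signature A) (L : List A) : Free T S := L

lemma Free.ob_append (L M : List A) : ob T S (L ++ M) = ob T S L ⊗ ob T S M := rfl

lemma Free.ob_cons (a : A) (L : List A) : ob T S (a :: L) = ob T S [a] ⊗ ob T S L := rfl

variable [T.HasCopy]

/-- Marginalisation as a morphism between objects of the free category. -/
def marg (p : A → Bool) (L : List A) : Free.ob T S L ⟶ Free.ob T S (L.filter p) :=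
  marginalise p L

lemma copyable_marginalise (p : A → Bool) : ∀ L : List A,
    Copyable (marginalise (T := T) (S := S) p L)
  | [] => copyable_id _
  | a :: L => by
    rw [marginalise]
    split_ifs
    · exact ((copyable_id _).tensor (copyable_marginalise p L)).comp (copyable_eqToHom _)
    · exact ((copyable_del _).tensor (copyable_marginalise p L)).comp (copyable_eqToHom _)

lemma copyable_marg (p : A → Bool) (L : List A) : Copyable (marg (T := T) (S := S) p L) :=
  copyable_marginalise p L

/-- The identification of lists is hidden in an isomorphism `κ`. It is later only inverted or
composed with other morphisms, so its value never matters. -/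
lemma marg_cons_of_pos (p : A → Bool) (a : A) (L : List A) (h : p a = true) :
    ∃ κ : Free.ob T S [a] ⊗ Free.ob T S (L.filter p) ≅ Free.ob T S ((a :: L).filter p),
      marg p (a :: L) = eqToHom (Free.ob_cons a L) ≫ (𝟙 _ ⊗ₘ marg p L) ≫ κ.hom := by
  refine ⟨eqToIso (List.filter_cons_of_pos (p := p) (l := L) h).symm, ?_⟩
  rw [marg, marginalise, dif_pos h]; exact (Category.id_comp _).symm

lemma marg_cons_of_neg (p : A → Bool) (a : A) (L : List A) (h : ¬ p a = true) :
    ∃ κ : 𝟙_ (Free T S) ⊗ Free.ob T S (L.filter p) ≅ Free.ob T S ((a :: L).filter p),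
      marg p (a :: L) = eqToHom (Free.ob_cons a L) ≫ (ε[_] ⊗ₘ marg p L) ≫ κ.hom := by
  refine ⟨eqToIso (List.filter_cons_of_neg (p := p) (l := L) h).symm, ?_⟩
  rw [marg, marginalise, dif_neg h]; exact (Category.id_comp _).symm

/-- The treatment `x` of the first wire is chosen before `L`. This allows the marginalisations of `a
:: L` and of `a :: (L ++ M)` to be compared. -/
lemma marg_cons (p : A → Bool) (a : A) : ∃ (N : Free T S) (x : Free.ob T S [a] ⟶ N),
    ∀ L, ∃ κ : N ⊗ Free.ob T S (L.filter p) ≅ Free.ob T S ((a :: L).filter p),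
      marg p (a :: L) = eqToHom (Free.ob_cons a L) ≫ (x ⊗ₘ marg p L) ≫ κ.hom := by
  by_cases h : p a = true
  · exact ⟨_, 𝟙 _, fun L => marg_cons_of_pos p a L h⟩
  · exact ⟨_, ε[_], fun L => marg_cons_of_neg p a L h⟩

/-- Wires are kept or deleted independently of each other. A factorisation with an unspecified `κ`
suffices, because what follows it will be an arbitrary effect that can absorb `κ`. -/
lemma marg_append (p : A → Bool) : ∀ L M : List A,
    ∃ κ : Free.ob T S (L.filter p) ⊗ Free.ob T S (M.filter p) ⟶ Free.ob T S ((L ++ M).filter p),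
      marg p (L ++ M) = eqToHom (Free.ob_append L M) ≫ (marg p L ⊗ₘ marg p M) ≫ κ
  | [], M => by
    have h : marg (T := T) (S := S) p [] = 𝟙 _ := rfl
    refine ⟨(λ_ _).hom, ?_⟩
    have h' : (𝟙 (𝟙_ (Free T S)) ⊗ₘ marg (T := T) (S := S) p M) ≫ (λ_ _).hom =
        (λ_ _).hom ≫ marg p M := by
      rw [id_tensorHom, leftUnitor_naturality]
    rw [StrictMonoidal.leftUnitor_eq (Free.ob T S M)] at h'
    rw [h]
    refine Eq.trans ?_ (congrArg (eqToHom (Free.ob_append [] M) ≫ ·) h'.symm)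
    exact ((eqToHom_trans_assoc _ _ _).trans (Category.id_comp _)).symm
  | a :: L, M => by
    obtain ⟨κ, hκ⟩ := marg_append p L M
    obtain ⟨N, x, hx⟩ := marg_cons (T := T) (S := S) p a
    obtain ⟨κ₁, h₁⟩ := hx L
    obtain ⟨κ₂, h₂⟩ := hx (L ++ M)
    refine ⟨κ₁.inv ▷ _ ≫ (α_ _ _ _).hom ≫ N ◁ κ ≫ κ₂.hom, ?_⟩
    have e : marg (T := T) (S := S) p (a :: L) ⊗ₘ marg p M =
        eqToHom (congrArg (· ⊗ Free.ob T S M) (Free.ob_cons a L)) ≫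
          ((x ⊗ₘ marg p L) ⊗ₘ marg p M) ≫ κ₁.hom ▷ _ := by
      rw [h₁, eqToHom_comp_tensorHom, ← tensorHom_id, tensorHom_comp_tensorHom, Category.comp_id]
    refine h₂.trans ?_
    rw [e, hκ, tensorHom_eqToHom_comp]
    simp only [Category.assoc, hom_inv_whiskerRight_assoc]
    rw [associator_naturality_assoc, StrictMonoidal.associator_eq, ← id_tensorHom,
      tensorHom_comp_tensorHom_assoc, Category.comp_id]
    simp only [eqToHom_trans_assoc]

/-- Deletion can be done in two stages: first the wires outside `q`, then the remaining ones outside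
`p`. With a clique as `p` and the parents of its largest member as `q`, this makes an effect on the
clique depend on these parents. -/
lemma marg_factor (p q : A → Bool) : ∀ L : List A, (∀ a ∈ L, p a = true → q a = true) →
    ∃ κ : Free.ob T S (L.filter q) ⟶ Free.ob T S (L.filter p), marg p L = marg q L ≫ κ
  | [], _ => ⟨𝟙 _, (Category.comp_id _).symm⟩
  | a :: L, h => by
    obtain ⟨κ, hκ⟩ := marg_factor p q L fun b hb => h b (List.mem_cons_of_mem _ hb)
    by_cases hp : p a = true
    · obtain ⟨κ₁, h₁⟩ := marg_cons_of_pos (T := T) (S := S) p a L hp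
      obtain ⟨κ₂, h₂⟩ := marg_cons_of_pos (T := T) (S := S) q a L (h a List.mem_cons_self hp)
      refine ⟨κ₂.inv ≫ (𝟙 _ ⊗ₘ κ) ≫ κ₁.hom, ?_⟩
      simp only [h₁, h₂, hκ, Category.assoc, Iso.hom_inv_id_assoc, tensorHom_comp_tensorHom_assoc,
        Category.comp_id]
    · obtain ⟨κ₁, h₁⟩ := marg_cons_of_neg (T := T) (S := S) p a L hp
      by_cases hq : q a = true
      · obtain ⟨κ₂, h₂⟩ := marg_cons_of_pos (T := T) (S := S) q a L hq
        refine ⟨κ₂.inv ≫ (ε[_] ⊗ₘ κ) ≫ κ₁.hom, ?_⟩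
        simp only [h₁, h₂, hκ, Category.assoc, Iso.hom_inv_id_assoc,
          tensorHom_comp_tensorHom_assoc, Category.id_comp]
      · obtain ⟨κ₂, h₂⟩ := marg_cons_of_neg (T := T) (S := S) q a L hq
        refine ⟨κ₂.inv ≫ (𝟙 _ ⊗ₘ κ) ≫ κ₁.hom, ?_⟩
        simp only [h₁, h₂, hκ, Category.assoc, Iso.hom_inv_id_assoc,
          tensorHom_comp_tensorHom_assoc, Category.comp_id]

/-- `marginalise` recurses from the front of the list, whereas a copy-composition adds its newest
vertex at the end. This lemma and the next supply the recursion from the end. -/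
lemma marg_snoc (p : A → Bool) (L : List A) (a : A) :
    ∃ κ : Free.ob T S (L.filter p) ⊗ Free.ob T S [a] ⟶ Free.ob T S ((L ++ [a]).filter p),
      marg p (L ++ [a]) = eqToHom (Free.ob_append L [a]) ≫ (marg p L ⊗ₘ 𝟙 _) ≫ κ := by
  obtain ⟨κ, hκ⟩ := marg_append (T := T) (S := S) p L [a]
  refine ⟨(𝟙 _ ⊗ₘ marg p [a]) ≫ κ, ?_⟩
  rw [hκ, tensorHom_comp_tensorHom_assoc, Category.comp_id, Category.id_comp]

lemma marg_snoc_of_neg (p : A → Bool) (L : List A) (a : A) (h : ¬ p a = true) :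
    ∃ κ : Free.ob T S (L.filter p) ⟶ Free.ob T S ((L ++ [a]).filter p),
      marg p (L ++ [a]) = eqToHom (Free.ob_append L [a]) ≫
        (𝟙 _ ⊗ₘ ε[Free.ob T S [a]]) ≫ (ρ_ _).hom ≫ marg p L ≫ κ := by
  obtain ⟨κ, hκ⟩ := marg_append (T := T) (S := S) p L [a]
  obtain ⟨κ₁, h₁⟩ := marg_cons_of_neg (T := T) (S := S) p a [] h
  have h₂ : ∃ κ' : 𝟙_ (Free T S) ⟶ Free.ob T S ([a].filter p), marg p [a] = ε[_] ≫ κ' := by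
    refine ⟨(ρ_ _).inv ≫ κ₁.hom, ?_⟩
    have h₃ : marg (T := T) (S := S) p [] = 𝟙 (𝟙_ _) := rfl
    have h₄ : (ε[Free.ob T S [a]] ⊗ₘ 𝟙 (𝟙_ (Free T S))) =
        (ρ_ (Free.ob T S [a])).hom ≫ ε[_] ≫ (ρ_ _).inv := by simp
    rw [h₁, h₃]
    refine (congrArg (fun z => eqToHom (Free.ob_cons a []) ≫ z ≫ κ₁.hom) h₄).trans ?_
    rw [StrictMonoidal.rightUnitor_eq]
    refine (congrArg (eqToHom (Free.ob_cons a []) ≫ ·) ((Category.assoc _ _ _).trans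
      (congrArg (eqToHom _ ≫ ·) (Category.assoc _ _ _)))).trans ?_
    exact (eqToHom_trans_assoc _ _ _).trans (Category.id_comp _)
  obtain ⟨κ', h'⟩ := h₂
  refine ⟨(ρ_ _).inv ≫ (𝟙 _ ⊗ₘ κ') ≫ κ, ?_⟩
  rw [hκ, h', ← rightUnitor_naturality_assoc, Iso.hom_inv_id_assoc, ← tensorHom_id,
    tensorHom_comp_tensorHom_assoc, tensorHom_comp_tensorHom_assoc]
  simp

end Marginalise


/-! ### Variable elimination for functors on the syntax category of an ordered DAG -/

section Functors

variable {C : Type u₁} [Category.{v₁} C] [MonoidalCategory C] [CopyDiscardCategory C]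

lemma tot_eqToHom_hom {X Y : Tot C} (h : X = Y) :
    (eqToHom h).hom = eqToHom (congrArg WideSubcategory.obj h) := by
  subst h; rfl

/-- Strictness of `Tot C` makes it an admissible target of `Free.extendTo`, through which the
functor `K` is built. -/
instance [StrictMonoidal C] : StrictMonoidal (Tot C) where
  tensor_assoc X Y Z := congrArg WideSubcategory.mk (StrictMonoidal.tensor_assoc X.obj Y.obj Z.obj)
  unit_tensor X := congrArg WideSubcategory.mk (StrictMonoidal.unit_tensor X.obj)
  tensor_unit X := congrArg WideSubcategory.mk (StrictMonoidal.tensor_unit X.obj)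
  associator_eq X Y Z := WideSubcategory.hom_ext _
    ((StrictMonoidal.associator_eq X.obj Y.obj Z.obj).trans (tot_eqToHom_hom _).symm)
  leftUnitor_eq X := WideSubcategory.hom_ext _
    ((StrictMonoidal.leftUnitor_eq X.obj).trans (tot_eqToHom_hom _).symm)
  rightUnitor_eq X := WideSubcategory.hom_ext _
    ((StrictMonoidal.rightUnitor_eq X.obj).trans (tot_eqToHom_hom _).symm)

/-- A CD-functor to the total morphisms as a CD-functor to the whole category. -/
def CDFunctor.toAmbient {B : Type u₂} [Category.{v₂} B] [MonoidalCategory B]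
    [CopyDiscardCategory B] (K : CDFunctor B (Tot C)) : CDFunctor B C where
  toFunctor := K.toFunctor ⋙ totInclusion C
  obj_unit := congrArg WideSubcategory.obj K.obj_unit
  obj_tensor X Y := congrArg WideSubcategory.obj (K.obj_tensor X Y)
  map_tensor f g := by
    refine (congrArg (fun h => h.hom) (K.map_tensor f g)).trans ?_
    simp only [WideSubcategory.comp_def, tot_eqToHom_hom]
    rfl
  map_braiding X Y := by
    refine (congrArg (fun h => h.hom) (K.map_braiding X Y)).trans ?_
    simp only [WideSubcategory.comp_def, tot_eqToHom_hom]
    rfl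
  map_copy X := by
    refine (congrArg (fun h => h.hom) (K.map_copy X)).trans ?_
    simp only [WideSubcategory.comp_def, tot_eqToHom_hom]
    rfl
  map_del X := by
    refine (congrArg (fun h => h.hom) (K.map_del X)).trans ?_
    simp only [WideSubcategory.comp_def, tot_eqToHom_hom]
    rfl

variable {G : OrderedDAG.{u}} (H : CDFunctor (CDSyn G) C)

noncomputable section

/-- A vertex list as an object of the syntax category. -/
abbrev cdOb (G : OrderedDAG.{u}) (L : List G.V) : CDSyn G := Free.ob .cd G.signature L

lemma tensorList_eq : ∀ r : List G.V,
    tensorList (fun v => H.obj (cdOb G [v])) r = H.obj (cdOb G r.reverse)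
  | [] => H.obj_unit.symm
  | v :: r => by
    rw [tensorList, tensorList_eq r, List.reverse_cons]
    exact (H.obj_tensor _ _).symm

/-- The image of the marginalisation to the parents of `v`. -/
def parentMarg (v : G.V) (r : List G.V) :
    tensorList (fun v => H.obj (cdOb G [v])) r ⟶ H.obj (cdOb G (r.reverse.filter (G.isParent v))) :=
  eqToHom (tensorList_eq H r) ≫ H.map (marg (G.isParent v) r.reverse)

lemma copyable_parentMarg (v : G.V) (r : List G.V) : Copyable (parentMarg H v r) :=
  (copyable_eqToHom _).comp ((copyable_marg _ _).map H)

lemma comp_assoc_of_eq {E : Type u} [Category.{v} E] {A B D F K : E} {a : A ⟶ B} {b : B ⟶ D}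
    {c : A ⟶ D} (h : a ≫ b = c) (d : D ⟶ F) (e : F ⟶ K) :
    a ≫ (b ≫ d) ≫ e = c ≫ d ≫ e := by
  simp [← h]

lemma map_marg_snoc (p : G.V → Bool) (L : List G.V) (v : G.V) :
    ∃ κ : H.obj (cdOb G (L.filter p)) ⊗ H.obj (cdOb G [v]) ⟶ H.obj (cdOb G ((L ++ [v]).filter p)),
      H.map (marg p (L ++ [v])) = eqToHom (H.obj_tensor (cdOb G L) (cdOb G [v])) ≫
        H.map (marg p L) ▷ _ ≫ κ := by
  obtain ⟨κ, hκ⟩ := marg_snoc (T := .cd) (S := G.signature) p L v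
  refine ⟨eqToHom (H.obj_tensor _ _).symm ≫ H.map κ, ?_⟩
  rw [hκ, H.map_comp, H.map_comp, H.map_tensor, eqToHom_map, H.map_id, tensorHom_id]
  simp only [Category.assoc]
  exact Category.id_comp _

variable [StrictMonoidal C]

/-- Strictness turns both right unitors into casts, and a functor sends casts to casts. Only the
deletion is left to be preserved. -/
lemma map_del_comp {B : Type u₂} [Category.{v₂} B] [MonoidalCategory B] [CopyDiscardCategory B]
    [StrictMonoidal B] (K : CDFunctor B C) {X Z : B} (Y : B) (m : X ⟶ Z) :
    K.map ((𝟙 X ⊗ₘ ε[Y]) ≫ (ρ_ X).hom ≫ m) =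
      eqToHom (K.obj_tensor X Y) ≫ K.obj X ◁ ε[K.obj Y] ≫ (ρ_ _).hom ≫ K.map m := by
  rw [K.map_comp, K.map_comp, K.map_tensor, K.map_id, K.map_del, StrictMonoidal.rightUnitor_eq,
    StrictMonoidal.rightUnitor_eq, eqToHom_map, tensorHom_comp_eqToHom, id_tensorHom]
  simp

omit [StrictMonoidal C] in
lemma whiskerRight_comp_del {X X' Z : C} (Y : C) (h : X ⟶ X') (m : X' ⟶ Z) :
    h ▷ Y ≫ X' ◁ ε[Y] ≫ (ρ_ X').hom ≫ m = X ◁ ε[Y] ≫ (ρ_ X).hom ≫ h ≫ m := by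
  rw [← whisker_exchange_assoc, rightUnitor_naturality_assoc]

lemma map_marg_snoc_of_neg (p : G.V → Bool) (L : List G.V) (v : G.V) (hv : ¬ p v = true) :
    ∃ κ : H.obj (cdOb G (L.filter p)) ⟶ H.obj (cdOb G ((L ++ [v]).filter p)),
      H.map (marg p (L ++ [v])) = eqToHom (H.obj_tensor (cdOb G L) (cdOb G [v])) ≫
        _ ◁ ε[_] ≫ (ρ_ _).hom ≫ H.map (marg p L) ≫ κ := by
  obtain ⟨κ, hκ⟩ := marg_snoc_of_neg (T := .cd) (S := G.signature) p L v hv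
  refine ⟨H.map κ, ?_⟩
  rw [← H.map_comp]
  exact (congrArg H.map (hκ.trans (Category.id_comp _))).trans (map_del_comp H _ _)

/-- Effects on the variables in a clique are local. -/
lemma isLocalEffect_of_clique (p : G.V → Bool) : ∀ (r L : List G.V), L = r.reverse →
    r.Pairwise (· > ·) →
    (∀ a ∈ r, ∀ b ∈ r, p a = true → p b = true → a < b → G.Edge a b) →
    ∀ (h : tensorList (fun v => H.obj (cdOb G [v])) r = H.obj (cdOb G L))
      (e : H.obj (cdOb G (L.filter p)) ⟶ 𝟙_ C),
      IsLocalEffect (parentMarg H) r (eqToHom h ≫ H.map (marg p L) ≫ e)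
  | [], _, _, _, _, _, _ => trivial
  | v :: r, L, hL, hr, hp, h, e => by
    rw [List.pairwise_cons] at hr
    -- Keeping `L` as a variable with an equation lets this substitution replace the list in all
    -- dependent types at once.
    obtain rfl : L = r.reverse ++ [v] := hL.trans (List.reverse_cons ..)
    have h₀ := tensorList_eq H r
    have hh : eqToHom h ≫ eqToHom (H.obj_tensor (cdOb G r.reverse) (cdOb G [v])) =
        eqToHom h₀ ▷ H.obj (cdOb G [v]) := by
      rw [← tensorHom_id, eqToHom_tensorHom_id]
      exact eqToHom_trans _ _
    by_cases hv : p v = true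
    · left
      -- As `r` is decreasing, `v` is the largest member of the clique, so the other members are
      -- parents of `v`. The effect sees the earlier variables only through these parents.
      obtain ⟨κ, hκ⟩ := map_marg_snoc H p r.reverse v
      obtain ⟨κ', hκ'⟩ := marg_factor (T := .cd) (S := G.signature) p (G.isParent v) r.reverse
        (fun a ha hpa => (G.isParent_iff _ _).2 (hp a (List.mem_cons_of_mem _ (by simpa using ha)) v
          List.mem_cons_self hpa hv (hr.1 a (by simpa using ha))))
      refine ⟨H.map κ' ▷ _ ≫ κ ≫ e, ?_⟩
      rw [hκ, hκ', parentMarg, H.map_comp]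
      refine (comp_assoc_of_eq hh _ _).trans ?_
      simp only [comp_whiskerRight, Category.assoc]
      rfl
    · right
      -- Here `v` is outside the clique and gets deleted, and the effect lives on the earlier
      -- variables, where the clique is the same.
      obtain ⟨κ, hκ⟩ := map_marg_snoc_of_neg H p r.reverse v hv
      refine ⟨eqToHom h₀ ≫ H.map (marg p r.reverse) ≫ κ ≫ e,
        isLocalEffect_of_clique p r _ rfl hr.2 (fun a ha b hb => hp a (List.mem_cons_of_mem _ ha) b
          (List.mem_cons_of_mem _ hb)) _ _, ?_⟩
      rw [hκ]
      refine (comp_assoc_of_eq hh _ _).trans ?_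
      simp only [Category.assoc]
      exact whiskerRight_comp_del _ _ _

/-- The generator of the syntax category at a vertex. -/
def generator (G : OrderedDAG.{u}) (v : G.V) : cdOb G (G.parents v) ⟶ cdOb G [v] := box G v

/-- The copy-composition along an initial segment. -/
def segmentState (G : OrderedDAG.{u}) (r : List G.V) (h : r.reverse <+: G.vertices) :
    𝟙_ (CDSyn G) ⟶ cdOb G r.reverse :=
  copyComp G r h

/-- The recursion defining `copyComp`, with the box separated from the selection of parents. The
equalities of objects are arguments, so that the casts match whatever proofs occur later. -/
lemma segmentState_cons (v : G.V) (r : List G.V) (h : (v :: r).reverse <+: G.vertices)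
    (h₀ : r.reverse <+: G.vertices)
    (h₁ : cdOb G (r.reverse.filter (G.isParent v)) = cdOb G (G.parents v))
    (h₂ : cdOb G r.reverse ⊗ cdOb G [v] = cdOb G (v :: r).reverse) :
    segmentState G (v :: r) h = segmentState G r h₀ ≫
      graph (marg (G.isParent v) r.reverse ≫ eqToHom h₁ ≫ generator G v) ≫ eqToHom h₂ := by
  rw [graph, ← id_tensorHom, Category.assoc]
  rfl

/-- The state obtained from the copy-composition along an initial segment. -/
def stateOf (r : List G.V) (h : r.reverse <+: G.vertices) :
    𝟙_ C ⟶ tensorList (fun v => H.obj (cdOb G [v])) r :=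
  eqToHom H.obj_unit.symm ≫ H.map (segmentState G r h) ≫ eqToHom (tensorList_eq H r).symm

omit [StrictMonoidal C] in
lemma map_graph {B : Type u₂} [Category.{v₂} B] [MonoidalCategory B] [CopyDiscardCategory B]
    (K : CDFunctor B C) {X Y : B} (m : X ⟶ Y) :
    K.map (graph m) = graph (K.map m) ≫ eqToHom (K.obj_tensor X Y).symm := by
  rw [graph, ← id_tensorHom, K.map_comp, K.map_tensor, K.map_copy, K.map_id, id_tensorHom, graph]
  simp

omit [StrictMonoidal C] in
lemma graph_eqToHom_comp {X Y Z : C} (h : X = Y) (m : Y ⟶ Z) :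
    graph (eqToHom h ≫ m) = eqToHom h ≫ graph m ≫ eqToHom (by rw [h]) := by
  subst h; simp

omit [StrictMonoidal C] in
-- A CD-functor preserves graphs of morphisms, so the recursion for the copy-composition in the
-- syntax category persists in `C`. The generator enters only through its image, separately from the
-- wiring `parentMarg`.
lemma stateOf_cons (v : G.V) (r : List G.V) (h : (v :: r).reverse <+: G.vertices)
    (h₀ : r.reverse <+: G.vertices)
    (h₁ : cdOb G (r.reverse.filter (G.isParent v)) = cdOb G (G.parents v)) :
    stateOf H (v :: r) h = stateOf H r h₀ ≫
      graph (parentMarg H v r ≫ H.map (eqToHom h₁ ≫ generator G v)) := by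
  have h₂ : cdOb G r.reverse ⊗ cdOb G [v] = cdOb G (v :: r).reverse :=
    congrArg (cdOb G) (List.reverse_cons (a := v) (as := r)).symm
  rw [stateOf, stateOf, segmentState_cons v r h h₀ h₁ h₂, H.map_comp, H.map_comp,
    map_graph, eqToHom_map, parentMarg, Category.assoc (eqToHom _) (H.map _),
    graph_eqToHom_comp, H.map_comp]
  simp only [Category.assoc, eqToHom_trans_assoc, eqToHom_refl, Category.id_comp]
  refine congrArg (fun z => eqToHom _ ≫ H.map (segmentState G r h₀) ≫ graph _ ≫ z) ?_
  exact eqToHom_trans _ _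

end

end Functors


/-! ### Functors with total boxes, and the factorisation theorem -/

section

variable {C : Type u₁} [Category.{v₁} C] [MonoidalCategory C] [CopyDiscardCategory C]

/-- Composition of CD-functors. -/
def CDFunctor.comp {B : Type u} [Category.{v} B] [MonoidalCategory B] [CopyDiscardCategory B]
    {D : Type u₂} [Category.{v₂} D] [MonoidalCategory D] [CopyDiscardCategory D]
    (F : CDFunctor B C) (K : CDFunctor C D) : CDFunctor B D where
  toSymFunctor := F.toSymFunctor.comp K.toSymFunctor
  map_copy X := by
    refine (congrArg K.map (F.map_copy X)).trans ?_
    rw [K.map_comp, K.map_copy, eqToHom_map, Category.assoc, eqToHom_trans]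
    rfl
  map_del X := by
    refine (congrArg K.map (F.map_del X)).trans ?_
    rw [K.map_comp, K.map_del, eqToHom_map, Category.assoc, eqToHom_trans]
    rfl

lemma eqToHom_comp_del {X Y : C} (h : X = Y) : eqToHom h ≫ ε[Y] = ε[X] := by
  subst h; simp

lemma total_eqToHom {X Y : C} (h : X = Y) : total C (eqToHom h) := eqToHom_comp_del h

lemma tot_hom_heq {X X' Y Y' : Tot C} {f : X ⟶ Y} {f' : X' ⟶ Y'} (hX : X = X') (hY : Y = Y')
    (h : f.hom ≍ f'.hom) : f ≍ f' := by
  subst hX hY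
  exact heq_of_eq (WideSubcategory.hom_ext _ (eq_of_heq h))

lemma functor_map_heq {E : Type u} [Category.{v} E] {D : Type u₂} [Category.{v₂} D]
    (q : E ⥤ D) {X X' Y Y' : E} {f : X ⟶ Y} {f' : X' ⟶ Y'} (hX : X = X') (hY : Y = Y')
    (h : f ≍ f') : q.map f ≍ q.map f' := by
  subst hX hY h; rfl

lemma map_eqToHom_comp_eqToHom_heq {E : Type u} [Category.{v} E] {D : Type u₂} [Category.{v₂} D]
    (q : E ⥤ D) {X X' Y Y' : E} (h : X = X') (f : X' ⟶ Y') (h' : Y' = Y) :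
    q.map (eqToHom h ≫ f ≫ eqToHom h') ≍ q.map f := by
  subst h h'; simp

lemma Free.obj_eq_of_singleton {A : Type u} {T : Theory} {S : Signature A}
    {H K : SymFunctor (Free T S) C} (h : ∀ a : A, H.obj (ob T S [a]) = K.obj (ob T S [a])) :
    ∀ L : List A, H.obj (ob T S L) = K.obj (ob T S L)
  | [] => H.obj_unit.trans K.obj_unit.symm
  | a :: L => by
    rw [ob_cons, H.obj_tensor, K.obj_tensor, h a, obj_eq_of_singleton h L]

/-- Marginalisations consist of identities, deletions and casts. No generator occurs in them, so
their images depend only on the values on objects. -/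
lemma map_marginalise_congr {A : Type u} {T : Theory} [T.HasCopy] {S : Signature A}
    {H K : CDFunctor (Free T S) C} (h : ∀ X, H.obj X = K.obj X) (p : A → Bool) :
    ∀ L : List A, H.map (marginalise p L) ≍ K.map (marginalise p L)
  | [] => Free.map_id_congr (H := H.toSymFunctor) h _
  | a :: L => by
    rw [marginalise]
    split_ifs
    · exact Free.map_comp_congr (H := H.toSymFunctor) (K := K.toSymFunctor) h
        (Free.map_tensor_congr (H := H.toSymFunctor) h (Free.map_id_congr (H := H.toSymFunctor) h _)
          (map_marginalise_congr h p L)) (Free.map_eqToHom_congr (H := H.toSymFunctor) h _)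
    · exact Free.map_comp_congr (H := H.toSymFunctor) (K := K.toSymFunctor) h
        (Free.map_tensor_congr (H := H.toSymFunctor) h (Free.map_del_congr h _)
          (map_marginalise_congr h p L)) (Free.map_eqToHom_congr (H := H.toSymFunctor) h _)

noncomputable section

variable {G : OrderedDAG.{u}} (H : CDFunctor (CDSyn G) C)

/-- The starting point of the elimination: the boxes are the images of the generators, with no
totality required. -/
lemma isCopyComp_stateOf : ∀ (r : List G.V) (h : r.reverse <+: G.vertices),
    IsCopyComp (parentMarg H) ⊤ r (stateOf H r h)
  | [], _ => by
    change eqToHom _ ≫ H.map (𝟙 _) ≫ eqToHom _ = 𝟙 _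
    rw [H.map_id, Category.id_comp]
    exact (eqToHom_trans _ _).trans rfl
  | v :: r, h => by
    have h' : (r.reverse ++ [v]) <+: G.vertices := List.reverse_cons ▸ h
    have h₀ : r.reverse <+: G.vertices := (List.prefix_append _ _).trans h'
    exact ⟨_, _, isCopyComp_stateOf r h₀, trivial,
      stateOf_cons H v r h h₀ (G.filter_isParent v r.reverse h')⟩

variable [StrictMonoidal C]

/-- The CD-functor to the total morphisms with the same values on objects as `H` and prescribed
values on generators. -/
def totalFunctor (g : ∀ v : G.V, H.obj (cdOb G (G.parents v)) ⟶ H.obj (cdOb G [v]))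
    (hg : ∀ v, total C (g v)) : CDFunctor (CDSyn G) (Tot C) :=
  Free.extendTo (fun L => ⟨H.obj (cdOb G L)⟩) (congrArg WideSubcategory.mk H.obj_unit)
    (fun L M => congrArg WideSubcategory.mk (H.obj_tensor (cdOb G L) (cdOb G M)))
    (fun v => ⟨g v, hg v⟩)

/-- Exchanging the boxes leaves the wiring unchanged. -/
lemma parentMarg_totalFunctor (g : ∀ v : G.V, H.obj (cdOb G (G.parents v)) ⟶ H.obj (cdOb G [v]))
    (hg : ∀ v, total C (g v)) (v : G.V) (r : List G.V) :
    parentMarg (totalFunctor H g hg).toAmbient v r = parentMarg H v r :=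
  congrArg (eqToHom (tensorList_eq H r) ≫ ·) (eq_of_heq (map_marginalise_congr
    (H := (totalFunctor H g hg).toAmbient) (K := H) (fun _ => rfl) (G.isParent v) r.reverse))

/-- A copy-composition only asserts that boxes exist; a functor needs one box for every vertex. The
boxes are collected by induction along the segment. The conclusion is stated for every family `g'`
that agrees with `g` on `r`, so that it survives the later choice of a box at a new vertex. The
hypothesis `hs` supplies boxes at vertices outside the segment. -/
lemma IsCopyComp.exists_family (hs : ∀ v, ∃ g : H.obj (cdOb G (G.parents v)) ⟶ H.obj (cdOb G [v]),
      total C g) : ∀ (r : List G.V) (h : r.reverse <+: G.vertices)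
    (σ : 𝟙_ C ⟶ tensorList (fun v => H.obj (cdOb G [v])) r),
    IsCopyComp (parentMarg H) (total C) r σ →
    ∃ g : ∀ v : G.V, H.obj (cdOb G (G.parents v)) ⟶ H.obj (cdOb G [v]), (∀ v, total C (g v)) ∧
      ∀ g' hg', (∀ v ∈ r, g' v = g v) → stateOf (totalFunctor H g' hg').toAmbient r h = σ
  | [], h, σ, hσ => by
    choose g hg using hs
    refine ⟨g, hg, fun g' hg' _ => ?_⟩
    have h' := isCopyComp_stateOf (totalFunctor H g' hg').toAmbient [] h
    exact h'.trans hσ.symm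
  | v :: r, h, σ, ⟨σ₀, f, hσ₀, hf, hσ⟩ => by
    classical
    have h' : (r.reverse ++ [v]) <+: G.vertices := List.reverse_cons ▸ h
    have h₀ : r.reverse <+: G.vertices := (List.prefix_append _ _).trans h'
    -- A vertex occurs once in the increasing list, so the update at `v` below does not disturb the
    -- boxes along `r`.
    have hv : v ∉ r := by
      have hn := (G.pairwise_vertices.sublist h'.sublist)
      intro hvr
      exact lt_irrefl _ ((List.pairwise_append.1 hn).2.2 v (by simpa using hvr) v (by simp))
    have h₁ : cdOb G (r.reverse.filter (G.isParent v)) = cdOb G (G.parents v) :=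
      G.filter_isParent v r.reverse h'
    obtain ⟨g, hg, H'⟩ := exists_family hs r h₀ σ₀ hσ₀
    -- The inputs of `f` are the parents of `v` found in the segment. Since the segment contains
    -- everything below `v`, these are all its parents, and a cast makes `f` a box of the signature.
    have hf' : total C (eqToHom (congrArg H.obj h₁.symm) ≫ f) :=
      (total C).comp_mem _ _ (total_eqToHom _) hf
    refine ⟨Function.update g v (eqToHom (congrArg H.obj h₁.symm) ≫ f), fun w => ?_,
      fun g' hg' hgg' => ?_⟩
    · by_cases hw : w = v
      · subst hw; rw [Function.update_self]; exact hf'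
      · rw [Function.update_of_ne hw]; exact hg w
    · have e₀ : stateOf (totalFunctor H g' hg').toAmbient r h₀ = σ₀ := H' g' hg' fun w hw => by
        rw [hgg' w (List.mem_cons_of_mem _ hw), Function.update_of_ne]
        rintro rfl
        exact hv hw
      have e₁ : (totalFunctor H g' hg').toAmbient.map (eqToHom h₁ ≫ generator G v) = f := by
        have e₂ : (totalFunctor H g' hg').toAmbient.map (generator G v) = g' v := rfl
        rw [Functor.map_comp, eqToHom_map, e₂, hgg' v List.mem_cons_self, Function.update_self]
        exact (eqToHom_trans_assoc _ _ _).trans (Category.id_comp _)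
      refine (stateOf_cons _ v r h h₀ h₁).trans ?_
      rw [e₀, e₁, parentMarg_totalFunctor]
      exact hσ.symm

lemma map_state_heq {E : Type u₂} [Category.{v₂} E] (F : CDSyn point.{u} ⥤ E) (a : point.{u}.V) :
    F.map state ≍ F.map (generator point.{u} a) := by
  refine functor_map_heq F (congrArg (cdOb point.{u}) (parents_point a).symm) rfl ?_
  exact eqToHom_comp_heq _ _

lemma bang_map_state (G : OrderedDAG.{u}) (h : G.vertices.reverse.reverse <+: G.vertices) :
    (bang G).map state ≍ segmentState G G.vertices.reverse h := by
  refine (map_state_heq (bang G).toFunctor PUnit.unit).trans ?_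
  change eqToHom _ ≫ copyCompAll G ≫ eqToHom _ ≍ _
  refine (Free.eqToHom_comp_eqToHom_heq _ _ _).trans ?_
  exact comp_eqToHom_heq _ _

/-- Variable elimination for a CD-functor on the syntax category of an ordered chordal graph. -/
theorem exists_total_factorisation (hG : G.IsChordal)
    {D : Type u₂} [Category.{v₂} D] (q : C ⥤ D) (hq : (totInclusion C ⋙ q).Faithful)
    (hs : ∀ (v : G.V) (A : C) (f : A ⟶ H.obj (cdOb G [v])), ∃ g : A ⟶ H.obj (cdOb G [v]),
      total C g ∧ f = weight (f ≫ ε[_]) ≫ g)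
    (ω : CDFunctor (CDSyn point.{u}) (Tot C)) (hω : (ω.obj pt).obj = H.obj G.vertices)
    (heq : ω.toFunctor ⋙ totInclusion C ⋙ q = (bang G).toFunctor ⋙ H.toFunctor ⋙ q) :
    ∃ K : CDFunctor (CDSyn G) (Tot C), (bang G).toFunctor ⋙ K.toFunctor = ω.toFunctor ∧
      ∀ L, (K.obj L).obj = H.obj L := by
  have h : G.vertices.reverse.reverse <+: G.vertices := by rw [List.reverse_reverse]
  -- Chordality enters here: the parents of `v` form a clique among the earlier vertices, so every
  -- effect on them is local.
  have hr : ∀ v r', (v :: r') <:+ G.vertices.reverse → ∀ e : H.obj (cdOb G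
      (r'.reverse.filter (G.isParent v))) ⟶ 𝟙_ C,
      IsLocalEffect (parentMarg H) r' (parentMarg H v r' ≫ e) := by
    intro v r' hvr e
    have hp : G.vertices.reverse.Pairwise (· > ·) := List.pairwise_reverse.2 G.pairwise_vertices
    have hp' := (List.pairwise_cons.1 (hp.sublist hvr.sublist)).2
    rw [parentMarg, Category.assoc]
    refine isLocalEffect_of_clique H _ r' _ rfl hp' (fun a _ b _ ha hb hab => ?_) _ e
    exact hG a b v ((G.isParent_iff _ _).1 ha) ((G.isParent_iff _ _).1 hb) hab
  obtain ⟨s, σ', hσ', hσ⟩ := IsCopyComp.exists_total (copyable_parentMarg H) (fun v _ f => hs v _ f)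
    G.vertices.reverse hr _ (isCopyComp_stateOf H _ h)
  -- The total part of the original box at `v` serves as the default value.
  obtain ⟨g, hg, hgσ⟩ := IsCopyComp.exists_family H
    (fun v => (hs v _ (H.map (generator G v))).imp fun _ h => h.1) _ h σ' hσ'
  have hK := hgσ g hg fun _ _ => rfl
  -- A state in the image of a functor to `Tot C` is total, so there is no need to check that
  -- copy-composition preserves totality.
  have htσ' : total C σ' := by
    rw [← hK, stateOf]
    refine (total C).comp_mem _ _ (total_eqToHom _)
      ((total C).comp_mem _ _ ?_ (total_eqToHom _))
    exact ((totalFunctor H g hg).map (segmentState G _ h)).property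
  have hW : (ω.obj pt).obj = tensorList (fun v => H.obj (cdOb G [v])) G.vertices.reverse := by
    rw [tensorList_eq, List.reverse_reverse]; exact hω
  have hU : 𝟙_ C = (ω.obj (𝟙_ _)).obj := (congrArg WideSubcategory.obj ω.obj_unit).symm
  -- The state of `ω`, transported to the objects on which `σ'` lives.
  obtain ⟨p, hp⟩ : ∃ p, p = eqToHom hU ≫ (ω.map state).hom ≫ eqToHom hW := ⟨_, rfl⟩
  have htp : total C p := by
    rw [hp]
    exact (total C).comp_mem _ _ (total_eqToHom _)
      ((total C).comp_mem _ _ (ω.map state).property (total_eqToHom _))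
  have hqp : q.map p = q.map s ≫ q.map σ' := by
    rw [← q.map_comp, ← hσ, hp]
    refine eq_of_heq ((map_eqToHom_comp_eqToHom_heq q _ _ _).trans ?_)
    refine HEq.trans ?_ (map_eqToHom_comp_eqToHom_heq q _ _ _).symm
    refine (heq_of_eq (Functor.congr_hom heq state)).trans
      ((Free.eqToHom_comp_eqToHom_heq _ _ _).trans ?_)
    have hb := bang_map_state G h
    have hX : (bang G).obj (𝟙_ _) = 𝟙_ (CDSyn G) := rfl
    have hY : (bang G).obj pt = cdOb G G.vertices.reverse.reverse :=
      (List.flatMap_singleton _ _).trans (List.reverse_reverse _).symm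
    exact functor_map_heq (H.toFunctor ⋙ q) hX hY hb
  -- Deleting the outputs of the total states `p` and `σ'` leaves the trivial scalar on one side and
  -- `s` on the other. In `C` itself `s` need not be the identity.
  have hqs : q.map s = 𝟙 _ := by
    have h₁ := congrArg (· ≫ q.map ε[_]) hqp
    simp only [Category.assoc, ← q.map_comp] at h₁
    rw [(total_iff _).1 htp, (total_iff _).1 htσ', CopyDiscardCategory.discard_unit,
      Category.comp_id, q.map_id] at h₁
    exact h₁.symm
  rw [hqs, Category.id_comp] at hqp
  have hpσ : p = σ' := congrArg (fun f => f.hom) ((totInclusion C ⋙ q).map_injective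
    (X := (⟨𝟙_ C⟩ : Tot C)) (Y := (⟨tensorList _ _⟩ : Tot C)) (a₁ := ⟨p, htp⟩) (a₂ := ⟨σ', htσ'⟩) hqp)
  refine ⟨totalFunctor H g hg, ?_, fun _ => rfl⟩
  have hobj : ∀ L : List point.{u}.V, ((bang G).comp (totalFunctor H g hg)).obj L = ω.obj L := by
    refine Free.obj_eq_of_singleton (H := ((bang G).comp (totalFunctor H g hg)).toSymFunctor)
      (K := ω.toSymFunctor) fun a => ?_
    refine congrArg WideSubcategory.mk (Eq.trans ?_ hω.symm)
    exact congrArg (fun L => H.obj (cdOb G L)) (List.flatMap_singleton _ _)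
  -- It remains to compare the two functors on the one generator, whose images are `σ'` and `p` up
  -- to casts.
  refine Free.cdFunctor_ext (H := (bang G).comp (totalFunctor H g hg)) hobj fun a => ?_
  have hX : (bang G).obj (𝟙_ _) = 𝟙_ (CDSyn G) := rfl
  have hY : (bang G).obj pt = cdOb G G.vertices.reverse.reverse :=
    (List.flatMap_singleton _ _).trans (List.reverse_reverse _).symm
  have e₁ : ((bang G).comp (totalFunctor H g hg)).map state ≍ ω.map state := by
    refine tot_hom_heq (hobj _) (hobj _) ?_
    refine (functor_map_heq (totalFunctor H g hg).toAmbient.toFunctor hX hY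
      (bang_map_state G h)).trans ?_
    refine HEq.trans ?_ (Free.eqToHom_comp_eqToHom_heq hU (ω.map state).hom hW)
    rw [← hp, hpσ, ← hK]
    exact (Free.eqToHom_comp_eqToHom_heq _ _ _).symm
  exact ((map_state_heq _ a).symm.trans e₁).trans (map_state_heq ω.toFunctor a)

end

end


/-! ### Splitting off the mass by means of conditionals -/

/-- A total conditional of a morphism without first output splits off its mass. -/
lemma HasTotalConditionals.exists_weight {C : Type u} [Category.{v} C] [MonoidalCategory C]
    [CopyDiscardCategory C] (hC : HasTotalConditionals C) {A Y : C} (f : A ⟶ Y) :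
    ∃ g : A ⟶ Y, total C g ∧ f = weight (f ≫ ε[Y]) ≫ g := by
  -- The first output is taken to be the unit: deleting the second output `Y` then leaves nothing
  -- but the mass of `f`.
  obtain ⟨g, hg, h⟩ := hC A (𝟙_ C) Y (f ≫ (λ_ Y).inv)
  refine ⟨(ρ_ A).inv ≫ g, (total C).comp_mem _ _ (total_of_inv _ (total_rightUnitor A)) hg, ?_⟩
  have e : (f ≫ (λ_ Y).inv) ≫ 𝟙_ C ◁ ε[Y] ≫ (ρ_ (𝟙_ C)).hom ≫ Δ[𝟙_ C] =
      (f ≫ ε[Y]) ≫ (λ_ (𝟙_ C)).inv := by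
    rw [CopyDiscardCategory.copy_unit, ← unitors_equal, Iso.hom_inv_id]
    simp
  rw [IsConditional, e] at h
  rw [← cancel_mono (λ_ Y).inv, h, weight, graph]
  -- The copied first output consists of unit wires, so the exchange in the definition of a
  -- conditional is a unitor.
  have e' : A ◁ (λ_ (𝟙_ C)).inv ≫ (α_ A (𝟙_ C) (𝟙_ C)).inv ≫ (β_ (A ⊗ 𝟙_ C) (𝟙_ C)).hom =
      (λ_ (A ⊗ 𝟙_ C)).inv := by
    rw [braiding_tensorUnit_right]
    monoidal
  simp only [MonoidalCategory.whiskerLeft_comp, Category.assoc]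
  rw [reassoc_of% e', ← leftUnitor_inv_naturality, Iso.hom_inv_id_assoc]

/-! ### Normalisation of nonnegative matrices -/

section Mat

noncomputable section

variable {U : Type w}

namespace NNMat

lemma weight_entry {A : NNMat U} (w : A ⟶ 𝟙_ (NNMat U)) (b a : A.El) [DecidableEq A.El] :
    (weight w).entry b a = if b = a then w.entry nil a else 0 := by
  have e : weight w = fn (Y := prod A A) (fun x => pair x x) ≫ (𝟙 A ⊗ₘ w) ≫
      fn (castEl (prod_one A)) := by
    rw [weight, graph, Category.assoc]; rfl
  rw [e]
  refine (fn_comp_entry _ _ _ _).trans ((comp_fn_cast_entry _ _ _ _).trans ?_)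
  rw [castEl_prod_one_symm]
  refine (tensor_entry _ _ _ _).trans ?_
  simp only [fst_pair, snd_pair, id_eq_fn, fn_entry]
  split_ifs <;> simp

lemma weight_comp_entry {A Y : NNMat U} (w : A ⟶ 𝟙_ (NNMat U)) (g : A ⟶ Y) (y : Y.El) (a : A.El) :
    (weight w ≫ g).entry y a = g.entry y a * w.entry nil a := by
  classical
  rw [comp_entry]
  simp [weight_entry]

lemma comp_del_entry {A Y : NNMat U} (f : A ⟶ Y) (a : A.El) :
    (f ≫ ε[Y]).entry nil a = ∑ y, f.entry y a := by
  rw [comp_entry]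
  refine Finset.sum_congr rfl fun y _ => ?_
  have : (ε[Y]).entry nil y = 1 := (fn_entry _ _ _).trans (if_pos rfl)
  rw [this, _root_.one_mul]

lemma total_iff_sum {A Y : NNMat U} (f : A ⟶ Y) :
    total (NNMat U) f ↔ ∀ a, ∑ y, f.entry y a = 1 := by
  have h : ∀ a : A.El, (ε[A]).entry nil a = 1 := fun a => (fn_entry _ _ _).trans (if_pos rfl)
  rw [total_iff]
  refine ⟨fun e a => ?_, fun e => hom_ext fun n a => ?_⟩
  · rw [← comp_del_entry, e, h]
  · rw [eq_nil n, comp_del_entry, e, h]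

/-- Normalising the columns of a matrix. -/
lemma exists_weight {A Y : NNMat U} (y₀ : Y.El) (f : A ⟶ Y) :
    ∃ g : A ⟶ Y, total (NNMat U) g ∧ f = weight (f ≫ ε[Y]) ≫ g := by
  classical
  -- A column of sum zero is reproduced by any distribution, since its weight is zero; the point
  -- mass at `y₀` is a default. This is why the target must be nonempty.
  refine ⟨Hom.mk fun y a => if ∑ y', f.entry y' a = 0 then (if y = y₀ then 1 else 0) else
    f.entry y a / ∑ y', f.entry y' a, (total_iff_sum _).2 fun a => ?_, hom_ext fun y a => ?_⟩
  · by_cases h : ∑ y', f.entry y' a = 0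
    · simp only [h, if_true]
      simp
    · simp only [h, if_false]
      rw [← Finset.sum_div, div_self h]
  · rw [weight_comp_entry, comp_del_entry]
    by_cases h : ∑ y', f.entry y' a = 0
    · rw [h, mul_zero]
      exact Finset.sum_eq_zero_iff.1 h y (Finset.mem_univ y)
    · simp only [h, if_false]
      rw [div_mul_cancel₀ _ h]

/-- An empty sum is `0`, not `1`. -/
lemma nonempty_of_total_state {Y : NNMat U} {f : 𝟙_ (NNMat U) ⟶ Y} (hf : total (NNMat U) f) :
    Nonempty Y.El := by
  by_contra h
  rw [not_nonempty_iff] at h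
  have := (total_iff_sum f).1 hf nil
  simp at this

end NNMat

/-- Two stochastic matrices that differ by a factor have columns of the same sum `1`, which forces
the factor to be `1`. -/
lemma normalise_isNormalisationCospan (U : Type w) : IsNormalisationCospan (normalise U) where
  map_injective {X Y} f g h := by
    obtain ⟨c, _, hc⟩ := (FinProjStoch.cls_eq_iff f.hom g.hom).1 h
    refine WideSubcategory.hom_ext _ (NNMat.hom_ext fun y x => ?_)
    have hf := (NNMat.total_iff_sum f.hom).1 f.property x
    have hg := (NNMat.total_iff_sum g.hom).1 g.property x
    -- The factor is determined only once a column `x` is fixed; with no columns there is nothing to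
    -- prove.
    have h1 : c = 1 := by
      rw [← hg, ← _root_.mul_one c, ← hf, Finset.mul_sum]
      exact Finset.sum_congr rfl fun y _ => hc y x
    rw [← hc, h1, _root_.one_mul]

end

end Mat

/-! ### Chordal networks of stochastic matrices -/

open OrderedDAG in
-- The elimination theorem applies once the set at each vertex is known to be nonempty, for then
-- masses can be split off by normalising columns. The nonemptiness comes from the distribution of
-- the network.
lemma isBayesian_of_isChordalNet (U : Type w) :
    IsChordalNet.{u} (normalise U) ≤ IsBayesian.{u} (NNMat U) := by
  rintro X ⟨hG, F, hF, hω⟩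
  let H : CDFunctor (CDSyn X.graph) (NNMat U) := (star X.graph).comp F.toCDFunctor
  -- `normalise` is the identity on objects, so the compatibility after normalisation already
  -- determines the objects before it.
  have hobj : ∀ L : List X.graph.V, H.obj (cdOb X.graph L) = (X.assign.obj L).obj := fun L =>
    congrArg (fun K => K.obj L) hF
  have hpt : (X.dist.obj pt).obj = H.obj X.graph.vertices := by
    have h : X.dist.obj pt = _ := congrArg (fun K => K.obj ([PUnit.unit] : List _)) X.compat
    rw [h]
    refine (hobj _).symm.trans (congrArg (fun L => H.obj (cdOb X.graph L)) ?_)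
    exact (List.flatMap_singleton _ _).trans (fiber_toPoint X.graph _)
  -- The set of joint values carries a probability distribution.
  have hne : Nonempty (H.obj X.graph.vertices : NNMat U).El := by
    rw [← hpt]
    have hU : (X.dist.obj (𝟙_ _)).obj = 𝟙_ (NNMat U) := congrArg WideSubcategory.obj X.dist.obj_unit
    exact NNMat.nonempty_of_total_state ((total (NNMat U)).comp_mem _ _ (total_eqToHom hU.symm)
      (X.dist.map state).property)
  -- The set at `v` is a factor of the set of joint values, and a component of a joint value is an
  -- element of it.
  have hv : ∀ v, Nonempty (H.obj (cdOb X.graph [v]) : NNMat U).El := by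
    intro v
    obtain ⟨l, r, h⟩ := List.append_of_mem (X.graph.mem_vertices v)
    have e : H.obj X.graph.vertices =
        H.obj (cdOb X.graph l) ⊗ (H.obj (cdOb X.graph [v]) ⊗ H.obj (cdOb X.graph r)) := by
      rw [← H.obj_tensor, ← H.obj_tensor, h]
      rfl
    rw [e] at hne
    obtain ⟨x⟩ := hne
    exact ⟨NNMat.fst (NNMat.snd x)⟩
  obtain ⟨K, hK, hK'⟩ := exists_total_factorisation H hG (normalise U).toFunctor
    (normalise_isNormalisationCospan U) (fun v A f => NNMat.exists_weight (hv v).some f) X.dist hpt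
    hω.symm
  refine ⟨K, ?_, hK⟩
  -- The vertex-list category has no generating morphisms, so agreement on objects is enough.
  exact Free.symFunctor_ext (H := (vertexInclusion X.graph).comp K.toSymFunctor) (K := X.assign)
    (fun L => congrArg WideSubcategory.mk ((hK' L).trans (hobj L))) (fun σ => σ.elim)

end PGM

theorem mainTheorem1 :
    (∀ (G : OrderedDAG.{u}), G.IsChordal →
      ∀ (C : Type u₁) [Category.{v₁} C] [MonoidalCategory C] [HypergraphCategory C]
        [StrictMonoidal C]
        (D : Type u₂) [Category.{v₂} D] [MonoidalCategory D] [HypergraphCategory D]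
        [StrictMonoidal D],
        HasTotalConditionals C →
        ∀ q : HypergraphFunctor C D, IsNormalisationCospan q →
        ∀ (ω : CDFunctor (CDSyn point.{u}) (Tot C)) (F : HypergraphFunctor (Syn G) C),
          (ω.obj pt).obj = F.obj G.vertices →
          ω.toFunctor ⋙ totInclusion C ⋙ q.toFunctor =
            (bang G).toFunctor ⋙ (PGM.star G).toFunctor ⋙ F.toFunctor ⋙ q.toFunctor →
          ∃ K : CDFunctor (CDSyn G) (Tot C),
            (bang G).toFunctor ⋙ K.toFunctor = ω.toFunctor ∧
            ∀ v : G.V, (K.obj [v]).obj = F.obj [v]) ∧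
    (∀ U : Type w,
      ∃ VE : (IsChordalNet.{u} (normalise U)).FullSubcategory ⥤
          (IsBayesian.{u} (NNMat U)).FullSubcategory,
        VE ⋙ (IsBayesian.{u} (NNMat U)).ι = (IsChordalNet.{u} (normalise U)).ι) := by
  -- Both categories of networks are full subcategories of `Net`, so an inclusion of their objects
  -- is all that a functor fixing objects and morphisms requires.
  refine ⟨fun G hG C _ _ _ _ D _ _ _ _ hC q hq ω F hω heq => ?_, fun U =>
    ⟨ObjectProperty.ιOfLE (isBayesian_of_isChordalNet U), rfl⟩⟩
  obtain ⟨K, hK, hK'⟩ := exists_total_factorisation ((PGM.star G).comp F.toCDFunctor) hG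
    q.toFunctor hq (fun v A f => hC.exists_weight f) ω hω heq
  exact ⟨K, hK, fun v => hK' [v]⟩
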